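/- **Setting.** Let $\mathbf B$ be a quaternion algebra over $\mathbb Q$, $\mathbf Z\cong\mathbb G_m$ the centre of $\mathbf B^\times$, and $\mathbf G=\mathbf Z\backslash\mathbf B^\times$. Write $\mathbb A$ for the adele ring of $\mathbb Q$, and for a linear algebraic group $\mathbf M$ over $\mathbb Q$ and $U\subseteq\mathbf M(\mathbb A)$ let $[U]$ be the image of $U$ in $[\mathbf M(\mathbb A)]=\mathbf M(\mathbb Q)\backslash\mathbf M(\mathbb A)$. Fix a maximal $\mathbb Z$-order $\mathbb O\subset\mathbf B(\mathbb Q)$, with local completions $\mathbb O_p\subset\mathbf B(\mathbb Q_p)$, a maximal compact torus $K_\infty<\mathbf G(\mathbb R)$, a Haar measure $\mathrm m$ on $\mathbf G(\mathbb A)$ (for example the one of covolume $1$) and a compact neighbourhood $\Omega$ of the identity in $\mathbf G(\mathbb A)$. *Joint toral sets.* Let $\mathbf T<\mathbf G$ be a maximal torus defined and anisotropic over $\mathbb Q$; it is the image of $\mathbf E^\times$ for a unique quadratic subfield $E=\mathbf E(\mathbb Q)\subset\mathbf B(\mathbb Q)$. Let $g\in\mathbf G(\mathbb A)$ and $s\in\mathbf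 T(\mathbb A)$, and assume $g_\infty^{-1}\mathbf T(\mathbb R)g_\infty=K_\infty$. The joint homogeneous toral set of this datum is $$[\mathbf T^\Delta(\mathbb A)(g,sg)]=[\{(tg,tsg):t\in\mathbf T(\mathbb A)\}]\subset[(\mathbf G\times\mathbf G)(\mathbb A)].$$ Choose representatives of $g$ in $\mathbf B^\times(\mathbb A)$ and of $s$ in $\mathbf E^\times(\mathbb A)$, again denoted $g,s$. Its local orders are $\Lambda_p=\mathbf E(\mathbb Q_p)\cap g_p\mathbb O_pg_p^{-1}$ and its global order is $\Lambda=\bigcap_p\Lambda_p\subset E$. Put $\mathfrak s=\bigcap_p s_p\Lambda_p\subset E$, an invertible fractional $\Lambda$-ideal, well defined up to multiplication by $\mathbb Q^\times$, and let $[\mathfrak s]\in\operatorname{Pic}(\Lambda)$ be its class. For an integral ideal $\mathfrak a\subseteq\Lambda$ put $\operatorname{Nr}\mathfrak a=[\Lambda:\mathfrak a]$. *Hecke sets.* For $\xi=(\xi_1,\xi_2)\in(\mathbf G\times\mathbf G)(\mathbb A)$ the homogeneous Hecke set is $[\mathbf G^\Delta(\mathbb A)\xi]=[\{(h\xi_1,h\xi_2):h\in\mathbf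 G(\mathbb A)\}]$, and its volume is $$\operatorname{vol}([\mathbf G^\Delta(\mathbb A)\xi])=\mathrm m\bigl(\{h\in\mathbf G(\mathbb A):(h,h)\in\xi(\Omega\times\Omega)\xi^{-1}\}\bigr)^{-1}.$$ **Proposition.** Let $(\mathbf T_i,g_i,s_i)_{i\in\mathbb N}$ be a sequence of data as above (with $\mathbf B,\mathbb O,K_\infty,\mathrm m,\Omega$ fixed), with global orders $\Lambda_i$ and ideals $\mathfrak s_i$. The following are equivalent. 1. $\displaystyle\inf_{[\mathbf T_i^\Delta(\mathbb A)(g_i,s_ig_i)]\subset[\mathbf G^\Delta(\mathbb A)\xi]}\operatorname{vol}([\mathbf G^\Delta(\mathbb A)\xi])\to\infty$ as $i\to\infty$. 2. $\displaystyle\min_{\mathfrak a\subseteq\Lambda_i,\ [\mathfrak a]=[\mathfrak s_i]}\operatorname{Nr}\mathfrak a\to\infty$ as $i\to\infty$, where $\mathfrak a$ runs over the invertible integral ideals of $\Lambda_i$ in the class $[\mathfrak s_i]$. 3. For every compact set $B\subset\mathbf G(\mathbb A)$ there is $N\in\mathbb N$ such that $g_i^{-1}\mathbf T_i(\mathbb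 Q)s_ig_i\cap B=\emptyset$ for all $i>N$. -/

import Mathlib

open scoped RestrictedProduct Pointwise Topology

noncomputable section

namespace JointToral

/-! ### The adele ring of `ℚ` -/

instance factPrime (p : Nat.Primes) : Fact (p : ℕ).Prime := ⟨p.2⟩

/-- The ring of finite adeles of `ℚ`: the restricted product of the fields `ℚ_p` with respect to
the rings `ℤ_p`, with its restricted product topology. -/
abbrev FinAdele : Type :=
  Πʳ p : Nat.Primes, [ℚ_[(p : ℕ)], PadicInt.subring (p : ℕ)]

theorem rat_mem_padicInt (q : ℚ) :
    ∀ᶠ p : Nat.Primes in Filter.cofinite, ((q : ℚ) : ℚ_[(p : ℕ)]) ∈ PadicInt.subring (p : ℕ) := by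
  have hfin : {p : Nat.Primes | (p : ℕ) ∣ q.den}.Finite := by
    refine Set.Finite.of_finite_image (f := fun p : Nat.Primes => (p : ℕ)) ?_
      Subtype.val_injective.injOn
    refine (Set.finite_Iic q.den).subset ?_
    rintro _ ⟨p, hp, rfl⟩
    exact Nat.le_of_dvd q.den_pos hp
  filter_upwards [hfin.compl_mem_cofinite] with p hp
  exact Padic.norm_rat_le_one hp

/-- The diagonal embedding of `ℚ` into the finite adeles. -/
def ratToFinAdele : ℚ →+* FinAdele where
  toFun q := ⟨fun p => (q : ℚ_[(p : ℕ)]), rat_mem_padicInt q⟩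
  map_zero' := by ext p; simp
  map_one' := by ext p; simp
  map_add' x y := by ext p; exact Rat.cast_add x y
  map_mul' x y := by ext p; exact Rat.cast_mul x y

instance algebraFinAdele : Algebra ℚ FinAdele := ratToFinAdele.toAlgebra

/-- The adele ring of `ℚ`, with the diagonal `ℚ`-algebra structure. -/
abbrev Adele : Type := ℝ × FinAdele

/-- The real component of an adele. -/
def toReal : Adele →ₐ[ℚ] ℝ := AlgHom.fst ℚ ℝ FinAdele

/-- The `p`-adic component of an adele. -/
def toPadic (p : Nat.Primes) : Adele →ₐ[ℚ] ℚ_[(p : ℕ)] where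
  toFun x := x.2 p
  map_zero' := rfl
  map_one' := rfl
  map_add' _ _ := rfl
  map_mul' _ _ := rfl
  commutes' q := by
    change ((q : ℚ) : ℚ_[(p : ℕ)]) = algebraMap ℚ ℚ_[(p : ℕ)] q
    simp

/-! ### Quaternion algebras over `ℚ` and their projective groups of units -/

section Quaternion

/-- The points `𝐁(R)` in a `ℚ`-algebra `R` of the quaternion algebra `𝐁 = (a, b / ℚ)`, with
basis `1, i, j, ij` and `i² = a`, `j² = b`, `ij = -ji`. Every quaternion algebra over `ℚ` is of this
form with `a ≠ 0` and `b ≠ 0`. -/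
abbrev BPt (a b : ℚ) (R : Type) [CommRing R] [Algebra ℚ R] : Type :=
  QuaternionAlgebra R (algebraMap ℚ R a) 0 (algebraMap ℚ R b)

/-- The topology of `R⁴` on a quaternion algebra over a topological ring `R`. -/
instance topBPt (a b : ℚ) (R : Type) [CommRing R] [Algebra ℚ R] [TopologicalSpace R] :
    TopologicalSpace (BPt a b R) :=
  TopologicalSpace.induced
    (QuaternionAlgebra.equivProd (algebraMap ℚ R a) 0 (algebraMap ℚ R b)) inferInstance

variable {a b : ℚ} {R S : Type} [CommRing R] [Algebra ℚ R] [CommRing S] [Algebra ℚ S]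

/-- Functoriality of `R ↦ 𝐁(R)`. -/
def BPt.map (a b : ℚ) (f : R →ₐ[ℚ] S) : BPt a b R →+* BPt a b S where
  toFun x := ⟨f x.re, f x.imI, f x.imJ, f x.imK⟩
  map_zero' := by ext <;> simp
  map_one' := by ext <;> simp
  map_add' x y := by ext <;> simp
  map_mul' x y := by ext <;> simp

/-- The inclusion `𝐁(ℚ) → 𝐁(R)`. -/
abbrev BPt.ofRat (a b : ℚ) (R : Type) [CommRing R] [Algebra ℚ R] : BPt a b ℚ →+* BPt a b R :=
  BPt.map a b (Algebra.ofId ℚ R)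

/-- The scalar units `𝐙(R) = Rˣ` in `𝐁ˣ(R)`. -/
def scalars (a b : ℚ) (R : Type) [CommRing R] [Algebra ℚ R] : Subgroup (BPt a b R)ˣ :=
  (Units.map (algebraMap R (BPt a b R) : R →* BPt a b R)).range

instance scalars_normal : (scalars a b R).Normal where
  conj_mem := by
    rintro _ ⟨r, rfl⟩ g
    refine ⟨r, ?_⟩
    rw [eq_mul_inv_iff_mul_eq]
    ext1
    exact Algebra.commutes (r : R) (g : BPt a b R)

/-- The points `𝐆(R) = 𝐁ˣ(R) / Rˣ` of the projective group of units. For the rings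
`R = ℚ, ℚ_p, ℝ` and the adeles this is the group of `R`-points of the algebraic
group `𝐆 = 𝐙 \ 𝐁ˣ`. When `R` is a topological ring it carries the quotient of the topology of the
group of units. -/
abbrev GPt (a b : ℚ) (R : Type) [CommRing R] [Algebra ℚ R] : Type :=
  (BPt a b R)ˣ ⧸ scalars a b R

/-- Functoriality of `R ↦ 𝐆(R)`. -/
def GPt.map (a b : ℚ) (f : R →ₐ[ℚ] S) : GPt a b R →* GPt a b S :=
  QuotientGroup.map _ _ (Units.map (BPt.map a b f : BPt a b R →* BPt a b S)) <| by
    rintro _ ⟨r, rfl⟩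
    refine ⟨Units.map (f : R →* S) r, ?_⟩
    ext <;> simp [BPt.map, QuaternionAlgebra.algebraMap_eq]

/-- The diagonal embedding `𝐆(ℚ) → 𝐆(𝔸)`. -/
def GPt.diag (a b : ℚ) : GPt a b ℚ →* GPt a b Adele := GPt.map a b (Algebra.ofId ℚ Adele)

/-! ### Maximal orders -/

/-- A `ℤ`-order of `𝐁(ℚ)`: a subring, finitely generated over `ℤ`, which spans `𝐁(ℚ)` over `ℚ`. -/
structure IsZOrder (O : Subring (BPt a b ℚ)) : Prop where
  fg : O.toAddSubgroup.FG
  span_eq_top : Submodule.span ℚ (O : Set (BPt a b ℚ)) = ⊤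

/-- The local order `𝕆_p ⊆ 𝐁(ℚ_p)`, the `ℤ_p`-algebra generated by the order `𝕆`; it is the
`ℤ_p`-span of `𝕆` and the `p`-adic closure of `𝕆`. -/
def localOrder (O : Subring (BPt a b ℚ)) (p : Nat.Primes) :
    Subalgebra ℤ_[(p : ℕ)] (BPt a b ℚ_[(p : ℕ)]) :=
  Algebra.adjoin ℤ_[(p : ℕ)] (BPt.ofRat a b ℚ_[(p : ℕ)] '' (O : Set (BPt a b ℚ)))

/-! ### Tori -/

/-- The points `𝐄(R) ⊆ 𝐁(R)` of the algebra subvariety attached to a subalgebra `E` of `𝐁(ℚ)`; it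
is the `R`-span of `E`. -/
def EPt (E : Subalgebra ℚ (BPt a b ℚ)) (R : Type) [CommRing R] [Algebra ℚ R] :
    Subalgebra R (BPt a b R) :=
  Algebra.adjoin R (BPt.ofRat a b R '' (E : Set (BPt a b ℚ)))

/-- The torus `𝐓̃(R) = 𝐄(R)ˣ ⊆ 𝐁ˣ(R)`. -/
def torusTilde (E : Subalgebra ℚ (BPt a b ℚ)) (R : Type) [CommRing R] [Algebra ℚ R] :
    Subgroup (BPt a b R)ˣ :=
  (Units.map ((EPt E R).val : EPt E R →* BPt a b R)).range

/-- The torus `𝐓(R) = 𝐄(R)ˣ / Rˣ ⊆ 𝐆(R)`. -/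
def torus (E : Subalgebra ℚ (BPt a b ℚ)) (R : Type) [CommRing R] [Algebra ℚ R] :
    Subgroup (GPt a b R) :=
  (torusTilde E R).map (QuotientGroup.mk' (scalars a b R))

/-- A maximal compact torus of `𝐆(ℝ)`: the image of `ℂˣ` for an embedding of real algebras of `ℂ`
in `𝐁(ℝ)`. -/
def IsMaxCompactTorus (K : Subgroup (GPt a b ℝ)) : Prop :=
  ∃ ι : ℂ →ₐ[ℝ] BPt a b ℝ,
    K = ((Units.map (ι : ℂ →* BPt a b ℝ)).range).map (QuotientGroup.mk' (scalars a b ℝ))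

end Quaternion

/-! ### Joint homogeneous toral sets -/

/-- The datum `(𝐓, g, s)` of a joint homogeneous toral set: a maximal torus `𝐓 < 𝐆` over `ℚ`,
anisotropic over `ℚ`, given by a quadratic subfield `E ⊆ 𝐁(ℚ)`, and elements `g ∈ 𝐆(𝔸)`,
`s ∈ 𝐓(𝔸)`, given by representatives `gRep ∈ 𝐁ˣ(𝔸)`, `sRep ∈ 𝐓̃(𝔸)`. -/
structure ToralDatum (a b : ℚ) where
  E : Subalgebra ℚ (BPt a b ℚ)
  isField : IsField E
  finrank_eq_two : Module.finrank ℚ E = 2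
  gRep : (BPt a b Adele)ˣ
  sRep : (BPt a b Adele)ˣ
  sRep_mem : sRep ∈ torusTilde E Adele

/-- The homogeneous space `[(𝐆 × 𝐆)(𝔸)] = (𝐆 × 𝐆)(ℚ) \ (𝐆 × 𝐆)(𝔸)`. -/
abbrev AdelicQuotient (a b : ℚ) : Type :=
  Quotient (QuotientGroup.rightRel ((GPt.diag a b).range.prod (GPt.diag a b).range))

/-- The projection `(𝐆 × 𝐆)(𝔸) → [(𝐆 × 𝐆)(𝔸)]`. -/
def proj {a b : ℚ} (x : GPt a b Adele × GPt a b Adele) : AdelicQuotient a b :=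
  Quotient.mk _ x

/-- The homogeneous Hecke set `[𝐆^Δ(𝔸) ξ]`. -/
def heckeSet {a b : ℚ} (ξ : GPt a b Adele × GPt a b Adele) : Set (AdelicQuotient a b) :=
  proj '' {x | ∃ h : GPt a b Adele, x = (h, h) * ξ}

/-- The volume of the homogeneous Hecke set `[𝐆^Δ(𝔸) ξ]`: the inverse of the measure
of `𝐆^Δ(𝔸) ∩ ξ (Ω × Ω) ξ⁻¹`, with respect to the Haar measure `μ` of `𝐆(𝔸) ≃ 𝐆^Δ(𝔸)` and the
reference identity neighbourhood `Ω ⊆ 𝐆(𝔸)`. -/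
def heckeVol {a b : ℚ} [MeasurableSpace (GPt a b Adele)] (μ : MeasureTheory.Measure (GPt a b Adele))
    (Ω : Set (GPt a b Adele)) (ξ : GPt a b Adele × GPt a b Adele) : ENNReal :=
  (μ {h | ∃ ω ∈ Ω ×ˢ Ω, (h, h) = ξ * ω * ξ⁻¹})⁻¹

namespace ToralDatum

variable {a b : ℚ} (D : ToralDatum a b)

/-- The element `g ∈ 𝐆(𝔸)`. -/
def g : GPt a b Adele := QuotientGroup.mk D.gRep

/-- The twist `s ∈ 𝐓(𝔸)`. -/
def s : GPt a b Adele := QuotientGroup.mk D.sRep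

/-- The joint homogeneous toral set `[𝐓^Δ(𝔸) (g, s g)]`. -/
def jointSet : Set (AdelicQuotient a b) :=
  proj '' {x | ∃ t ∈ torus D.E Adele, x = (t, t) * (D.g, D.s * D.g)}

/-- The compact torus `g_∞⁻¹ 𝐓(ℝ) g_∞` is equal to the fixed torus `K_∞`. -/
def HasRealTorus (K : Subgroup (GPt a b ℝ)) : Prop :=
  {x | ∃ t ∈ torus D.E ℝ, x = (GPt.map a b toReal D.g)⁻¹ * t * GPt.map a b toReal D.g}
    = (K : Set (GPt a b ℝ))

/-- The subset `g⁻¹ 𝐓(ℚ) s g` of `𝐆(𝔸)`. -/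
def twistOrbit : Set (GPt a b Adele) :=
  {x | ∃ t ∈ torus D.E ℚ, x = D.g⁻¹ * GPt.diag a b t * D.s * D.g}

/-- The component `g_p ∈ 𝐁ˣ(ℚ_p)` of the representative of `g`. -/
def gLoc (p : Nat.Primes) : (BPt a b ℚ_[(p : ℕ)])ˣ :=
  Units.map (BPt.map a b (toPadic p) : BPt a b Adele →* BPt a b ℚ_[(p : ℕ)]) D.gRep

/-- The component `s_p ∈ 𝐓̃(ℚ_p)` of the representative of `s`. -/
def sLoc (p : Nat.Primes) : (BPt a b ℚ_[(p : ℕ)])ˣ :=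
  Units.map (BPt.map a b (toPadic p) : BPt a b Adele →* BPt a b ℚ_[(p : ℕ)]) D.sRep

/-- The order `g_p 𝕆_p g_p⁻¹` of `𝐁(ℚ_p)`. -/
def conjOrder (O : Subring (BPt a b ℚ)) (p : Nat.Primes) : Subring (BPt a b ℚ_[(p : ℕ)]) where
  carrier := {x | ∃ y ∈ localOrder O p, x = D.gLoc p * y * (D.gLoc p)⁻¹.val}
  zero_mem' := ⟨0, zero_mem _, by simp⟩
  one_mem' := ⟨1, one_mem _, by simp⟩
  add_mem' := by
    rintro _ _ ⟨x, hx, rfl⟩ ⟨y, hy, rfl⟩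
    exact ⟨x + y, add_mem hx hy, by rw [mul_add, add_mul]⟩
  mul_mem' := by
    rintro _ _ ⟨x, hx, rfl⟩ ⟨y, hy, rfl⟩
    exact ⟨x * y, mul_mem hx hy, by simp [mul_assoc]⟩
  neg_mem' := by
    rintro _ ⟨x, hx, rfl⟩
    exact ⟨-x, neg_mem hx, by rw [mul_neg, neg_mul]⟩

/-- The local order `Λ_p = 𝐄(ℚ_p) ∩ g_p 𝕆_p g_p⁻¹`. -/
def localRing (O : Subring (BPt a b ℚ)) (p : Nat.Primes) : Subring (BPt a b ℚ_[(p : ℕ)]) :=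
  (EPt D.E ℚ_[(p : ℕ)]).toSubring ⊓ D.conjOrder O p

/-- The global order `Λ = ⋂_p Λ_p` of the field `E`. It is commutative, being contained in `E`. -/
def globalRing (O : Subring (BPt a b ℚ)) : Subring (BPt a b ℚ) :=
  D.E.toSubring ⊓ ⨅ p : Nat.Primes, (D.localRing O p).comap (BPt.ofRat a b ℚ_[(p : ℕ)])

/-- The fractional `Λ`-ideal `𝔰 = ⋂_p s_p Λ_p ⊂ E` of the finite part of the twist. Another choice
of the representative of `s` multiplies it by a rational number. -/
def twistIdeal (O : Subring (BPt a b ℚ)) : Set (BPt a b ℚ) :=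
  {x | x ∈ D.E ∧ ∀ p : Nat.Primes, ∃ l ∈ D.localRing O p,
    BPt.ofRat a b ℚ_[(p : ℕ)] x = D.sLoc p * l}

/-- The integral ideal `𝔞 ⊆ Λ` lies in the class `[𝔰] ∈ Pic(Λ)`, that is `𝔞 = e 𝔰` for
some `e ∈ Eˣ`. Such an ideal is invertible, because `𝔰` is. -/
def InTwistClass (O : Subring (BPt a b ℚ)) (I : Ideal (D.globalRing O)) : Prop :=
  ∃ e ∈ D.E, e ≠ 0 ∧
    (Subtype.val : D.globalRing O → BPt a b ℚ) '' (I : Set (D.globalRing O))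
      = (fun x => e * x) '' D.twistIdeal O

/-- The norm `Nr 𝔞 = [Λ : 𝔞]` of an integral ideal. -/
def idealNorm (O : Subring (BPt a b ℚ)) (I : Ideal (D.globalRing O)) : ℕ∞ :=
  ENat.card (D.globalRing O ⧸ I)

end ToralDatum

end JointToral

end

/-! All three conditions say that the twisted orbit $g_i^{-1}\mathbf T_i(\mathbb Q)s_ig_i$
eventually leaves every box `adelicBox O N`, the set of classes of $x$ with $Nx_p$ and $Nx_p^{-1}$
in $\mathbb O_p$ at every prime. The boxes are open and exhaust $\mathbf G(\mathbb A)$, so a compact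
set lies in one of them. Conversely the real component of an orbit element lies in the compact group
$K_\infty$, so the part of the orbit in a box lies in a compact set. This turns condition 3 into a
statement about boxes (`IsZOrder.forall_isCompact_iff`).

Condition 1. A Hecke set contains the toral set exactly when $\eta=\xi_1^{-1}\xi_2$ lies in the
twisted orbit (`ToralDatum.jointSet_subset_heckeSet_iff`). Since $\mathbf G(\mathbb A)$ is
unimodular, its volume is the inverse of $\mathrm m(\Omega\cap\eta\Omega\eta^{-1})$. This overlap is
bounded below on compact sets. The converse is the main point: an overlap of at least $\varepsilon$
forces $\eta$ into a box that depends only on $\varepsilon$. A packing argument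
(`exists_conj_mem_of_le_overlap`) shows that among any $r+1$ elements of a compact set two have a
quotient $v_iv_j^{-1}$ that $\eta^{-1}$ conjugates into the open subgroup `unitBox O`. Applied to
$v_i=1+t_i\beta$ with $\beta\in\mathbb O$ and well separated integers $t_i$
(`exists_separated_units`), it bounds the denominators of $\eta_p^{-1}\mathbb O_p\eta_p$
(`IsZOrder.factorial_smul_conj_mem`). The identity $\sum_e eze^{-1}=4\operatorname{Re}z$ over the
basis $e=1,i,j,ij$ turns this into a bound for $\eta$ itself, modulo scalars.

Condition 2. For $e\in E^\times$ put $x=g^{-1}esg$. Integrality of all $x_p$ means $e\mathfrak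
s\subseteq\Lambda$, and a bounded denominator of $x_p^{-1}$ means that $e\mathfrak s$ contains a
bounded positive integer, hence has bounded index. Scalars are harmless because $\mathbb Q$ has
class number one. The two directions are `exists_mem_twistOrbit_of_idealNorm_le` and
`exists_idealNorm_le`. -/

noncomputable section

namespace JointToral

/-! ### The reduced norm -/

section ReducedNorm

variable {a b : ℚ} {R S : Type} [CommRing R] [Algebra ℚ R] [CommRing S] [Algebra ℚ S]

/-- The reduced norm of a quaternion algebra. -/
def nrd (x : BPt a b R) : R :=
  x.re ^ 2 - algebraMap ℚ R a * x.imI ^ 2 - algebraMap ℚ R b * x.imJ ^ 2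
    + algebraMap ℚ R a * algebraMap ℚ R b * x.imK ^ 2

theorem mul_star_eq_nrd (x : BPt a b R) : x * star x = algebraMap R (BPt a b R) (nrd x) := by
  ext <;> simp [nrd, QuaternionAlgebra.algebraMap_eq] <;> ring

theorem star_mul_eq_nrd (x : BPt a b R) : star x * x = algebraMap R (BPt a b R) (nrd x) := by
  ext <;> simp [nrd, QuaternionAlgebra.algebraMap_eq] <;> ring

theorem nrd_mul (x y : BPt a b R) : nrd (x * y) = nrd x * nrd y := by
  simp [nrd]; ring

theorem nrd_one : nrd (1 : BPt a b R) = 1 := by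
  simp [nrd]

theorem nrd_smul (r : R) (x : BPt a b R) : nrd (r • x) = r ^ 2 * nrd x := by
  simp [nrd]; ring

theorem star_eq_sub (x : BPt a b R) : star x = algebraMap R (BPt a b R) (2 * x.re) - x := by
  ext <;> simp [QuaternionAlgebra.algebraMap_eq]; ring

theorem nrd_one_add_smul (t : R) (y : BPt a b R) :
    nrd (1 + t • y) = 1 + t * (2 * y.re) + t ^ 2 * nrd y := by
  simp [nrd]; ring

theorem nrd_inv_mul_nrd (x : (BPt a b R)ˣ) :
    nrd (x⁻¹.val) * nrd x.val = 1 := by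
  rw [← nrd_mul, Units.inv_mul, nrd_one]

theorem nrd_unit_ne_zero [Nontrivial R] (x : (BPt a b R)ˣ) : nrd x.val ≠ 0 := by
  intro h
  have := nrd_inv_mul_nrd x
  simp [h] at this

theorem inv_eq_smul_star (x : (BPt a b R)ˣ) : x⁻¹.val = nrd (x⁻¹.val) • star x.val := by
  have h : x⁻¹.val * (x.val * star x.val) = x⁻¹.val * algebraMap R (BPt a b R) (nrd x.val) := by
    rw [mul_star_eq_nrd]
  rw [← mul_assoc, Units.inv_mul, one_mul] at h
  rw [h, ← Algebra.commutes, ← Algebra.smul_def, smul_smul, nrd_inv_mul_nrd, one_smul]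

/-- An element whose reduced norm is the unit `c`, as a unit. -/
def unitOfNrd (x : BPt a b R) (c : Rˣ) (h : nrd x = c) : (BPt a b R)ˣ where
  val := x
  inv := (c⁻¹.val) • star x
  val_inv := by
    rw [mul_smul_comm, mul_star_eq_nrd, h, Algebra.smul_def, ← map_mul, Units.inv_mul, map_one]
  inv_val := by
    rw [smul_mul_assoc, star_mul_eq_nrd, h, Algebra.smul_def, ← map_mul, Units.inv_mul, map_one]

@[simp] theorem unitOfNrd_val (x : BPt a b R) (c : Rˣ) (h : nrd x = c) :
    (unitOfNrd x c h).val = x := rfl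

theorem mul_self_of_re_eq_zero (x : BPt a b R) (h : x.re = 0) :
    x * x = algebraMap R (BPt a b R) (-nrd x) := by
  have h1 : star x = -x := by rw [star_eq_sub, h]; simp
  have := mul_star_eq_nrd x
  rw [h1, mul_neg] at this
  rw [map_neg, ← this, neg_neg]

theorem nrd_map (f : R →ₐ[ℚ] S) (x : BPt a b R) : nrd (BPt.map a b f x) = f (nrd x) := by
  simp [BPt.map, nrd]

theorem map_smul' (f : R →ₐ[ℚ] S) (r : R) (x : BPt a b R) :
    BPt.map a b f (r • x) = f r • BPt.map a b f x := by
  ext <;> simp [BPt.map]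

theorem map_algebraMap (f : R →ₐ[ℚ] S) (r : R) :
    BPt.map a b f (algebraMap R _ r) = algebraMap S _ (f r) := by
  ext <;> simp [BPt.map, QuaternionAlgebra.algebraMap_eq]

theorem map_ofRat (f : R →ₐ[ℚ] S) (β : BPt a b ℚ) :
    BPt.map a b f (BPt.ofRat a b R β) = BPt.ofRat a b S β := by
  ext <;> simp [BPt.map, Algebra.ofId_apply]

theorem ofRat_injective [Nontrivial R] : Function.Injective (BPt.ofRat a b R) := by
  intro x y h
  have h1 := congrArg QuaternionAlgebra.re h
  have h2 := congrArg QuaternionAlgebra.imI h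
  have h3 := congrArg QuaternionAlgebra.imJ h
  have h4 := congrArg QuaternionAlgebra.imK h
  have hinj : Function.Injective (algebraMap ℚ R) := (algebraMap ℚ R).injective
  ext
  · exact hinj h1
  · exact hinj h2
  · exact hinj h3
  · exact hinj h4

theorem ofRat_smul (q : ℚ) (x : BPt a b ℚ) :
    BPt.ofRat a b R (q • x) = algebraMap ℚ R q • BPt.ofRat a b R x := by
  ext <;> simp [BPt.map, Algebra.ofId_apply] <;> rw [Algebra.smul_def]

/-- The unit `r` of `R` as a scalar unit. -/
def scalarUnit (a b : ℚ) : Rˣ →* (BPt a b R)ˣ :=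
  Units.map (algebraMap R (BPt a b R) : R →* BPt a b R)

theorem scalarUnit_mem (r : Rˣ) : scalarUnit a b r ∈ scalars a b R := ⟨r, rfl⟩

theorem scalarUnit_val (r : Rˣ) :
    (scalarUnit a b r).val = algebraMap R (BPt a b R) r.val := rfl

theorem scalarUnit_mul_val (r : Rˣ) (x : (BPt a b R)ˣ) :
    (scalarUnit a b r * x).val = r.val • x.val := by
  rw [Units.val_mul, scalarUnit_val, Algebra.smul_def]

theorem mk_scalarUnit_mul (r : Rˣ) (x : (BPt a b R)ˣ) :
    (QuotientGroup.mk (scalarUnit a b r * x) : GPt a b R) = QuotientGroup.mk x := by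
  rw [QuotientGroup.eq]
  have : (scalarUnit a b r * x)⁻¹ * x = x⁻¹ * (scalarUnit a b r)⁻¹ * (x⁻¹)⁻¹ := by group
  rw [this]
  exact scalars_normal.conj_mem _ (inv_mem (scalarUnit_mem r)) _

theorem mk_eq_mk_iff (x y : (BPt a b R)ˣ) :
    (QuotientGroup.mk x : GPt a b R) = QuotientGroup.mk y ↔ ∃ r : Rˣ, y = scalarUnit a b r * x := by
  constructor
  · intro h
    rw [QuotientGroup.eq] at h
    obtain ⟨r, hr⟩ := h
    refine ⟨r, ?_⟩
    have h1 : y = x * scalarUnit a b r := by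
      rw [scalarUnit, hr]; group
    rw [h1]
    ext1
    exact (Algebra.commutes (r : R) (x : BPt a b R)).symm
  · rintro ⟨r, rfl⟩
    exact (mk_scalarUnit_mul r x).symm

end ReducedNorm

/-! ### Components of adelic points -/

section Components

variable {a b : ℚ}

/-- The `p`-adic component of an adelic point of `𝐁`. -/
abbrev locMap (a b : ℚ) (p : Nat.Primes) : BPt a b Adele →+* BPt a b ℚ_[(p : ℕ)] :=
  BPt.map a b (toPadic p)

/-- The real component of an adelic point of `𝐁`. -/
abbrev realMap (a b : ℚ) : BPt a b Adele →+* BPt a b ℝ := BPt.map a b toReal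

/-- The `p`-adic component of an adelic point of `𝐁ˣ`. -/
abbrev locUnit (a b : ℚ) (p : Nat.Primes) : (BPt a b Adele)ˣ →* (BPt a b ℚ_[(p : ℕ)])ˣ :=
  Units.map (BPt.map a b (toPadic p) : BPt a b Adele →* BPt a b ℚ_[(p : ℕ)])

/-- The real component of an adelic point of `𝐁ˣ`. -/
abbrev realUnit (a b : ℚ) : (BPt a b Adele)ˣ →* (BPt a b ℝ)ˣ :=
  Units.map (BPt.map a b toReal : BPt a b Adele →* BPt a b ℝ)

theorem adele_ext {x y : Adele} (h : toReal x = toReal y) (hp : ∀ p, toPadic p x = toPadic p y) :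
    x = y :=
  Prod.ext h (RestrictedProduct.ext _ _ hp)

theorem BPt_ext {x y : BPt a b Adele} (h : realMap a b x = realMap a b y)
    (hp : ∀ p, locMap a b p x = locMap a b p y) : x = y := by
  ext1
  · exact adele_ext (congrArg QuaternionAlgebra.re h) fun p => congrArg QuaternionAlgebra.re (hp p)
  · exact adele_ext (congrArg QuaternionAlgebra.imI h) fun p => congrArg QuaternionAlgebra.imI (hp p)
  · exact adele_ext (congrArg QuaternionAlgebra.imJ h) fun p => congrArg QuaternionAlgebra.imJ (hp p)
  · exact adele_ext (congrArg QuaternionAlgebra.imK h) fun p => congrArg QuaternionAlgebra.imK (hp p)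

theorem exists_adele (r : ℝ) (c : ∀ p : Nat.Primes, ℚ_[(p : ℕ)])
    (h : ∀ᶠ p in Filter.cofinite, ‖c p‖ ≤ 1) :
    ∃ x : Adele, toReal x = r ∧ ∀ p, toPadic p x = c p :=
  ⟨(r, ⟨c, by filter_upwards [h] with p hp using (PadicInt.mem_subring_iff _).2 hp⟩), rfl,
    fun _ => rfl⟩

theorem eventually_norm_le_one (x : Adele) :
    ∀ᶠ p : Nat.Primes in Filter.cofinite, ‖toPadic p x‖ ≤ 1 := by
  filter_upwards [x.2.2] with p hp using (PadicInt.mem_subring_iff _).1 hp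

theorem exists_adele_unit (r : ℝ) (hr : r ≠ 0) (c : ∀ p : Nat.Primes, ℚ_[(p : ℕ)])
    (hc : ∀ p, c p ≠ 0) (h : ∀ᶠ p in Filter.cofinite, ‖c p‖ = 1) :
    ∃ x : Adeleˣ, toReal x.val = r ∧ ∀ p, toPadic p x.val = c p := by
  obtain ⟨x, hx, hxp⟩ := exists_adele r c (h.mono fun p hp => hp.le)
  obtain ⟨y, hy, hyp⟩ := exists_adele r⁻¹ (fun p => (c p)⁻¹) (h.mono fun p hp => by simp [hp])
  refine ⟨⟨x, y, ?_, ?_⟩, hx, hxp⟩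
  · refine adele_ext ?_ fun p => ?_
    · simp [hx, hy, hr]
    · simp [hxp, hyp, hc]
  · refine adele_ext ?_ fun p => ?_
    · simp [hx, hy, hr]
    · simp [hxp, hyp, hc]

theorem eventually_norm_eq_one (x : Adeleˣ) :
    ∀ᶠ p : Nat.Primes in Filter.cofinite, ‖toPadic p x.val‖ = 1 := by
  filter_upwards [eventually_norm_le_one x.val, eventually_norm_le_one x⁻¹.val] with p h1 h2
  have h3 : ‖toPadic p x.val‖ * ‖toPadic p x⁻¹.val‖ = 1 := by
    rw [← norm_mul, ← map_mul, Units.mul_inv, map_one, norm_one]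
  refine le_antisymm h1 ?_
  nlinarith [norm_nonneg (toPadic p x.val)]

theorem eventually_norm_ratCast_eq_one (q : ℚ) (hq : q ≠ 0) :
    ∀ᶠ p : Nat.Primes in Filter.cofinite, ‖(q : ℚ_[(p : ℕ)])‖ = 1 := by
  have := eventually_norm_eq_one (Units.map (algebraMap ℚ Adele : ℚ →* Adele) (Units.mk0 q hq))
  filter_upwards [this] with p hp
  rwa [Units.coe_map, MonoidHom.coe_coe, Units.val_mk0, AlgHom.commutes, eq_ratCast] at hp

/-- The maximum of the norms of the coordinates of a quaternion. -/
def coordNorm {F : Type} [NormedField F] [Algebra ℚ F] (x : BPt a b F) : ℝ :=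
  max (max ‖x.re‖ ‖x.imI‖) (max ‖x.imJ‖ ‖x.imK‖)

theorem coordNorm_le_iff {F : Type} [NormedField F] [Algebra ℚ F] {x : BPt a b F} {r : ℝ} :
    coordNorm x ≤ r ↔ ‖x.re‖ ≤ r ∧ ‖x.imI‖ ≤ r ∧ ‖x.imJ‖ ≤ r ∧ ‖x.imK‖ ≤ r := by
  simp [coordNorm, and_assoc]

theorem coordNorm_lt_iff {F : Type} [NormedField F] [Algebra ℚ F] {x : BPt a b F} {r : ℝ} :
    coordNorm x < r ↔ ‖x.re‖ < r ∧ ‖x.imI‖ < r ∧ ‖x.imJ‖ < r ∧ ‖x.imK‖ < r := by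
  simp [coordNorm, and_assoc]

theorem coordNorm_smul {F : Type} [NormedField F] [Algebra ℚ F] (r : F) (x : BPt a b F) :
    coordNorm (r • x) = ‖r‖ * coordNorm x := by
  simp [coordNorm, mul_max_of_nonneg]

theorem coordNorm_nonneg {F : Type} [NormedField F] [Algebra ℚ F] (x : BPt a b F) :
    0 ≤ coordNorm x :=
  le_max_of_le_left (le_max_of_le_left (norm_nonneg _))

theorem exists_coord_eq_coordNorm {F : Type} [NormedField F] [Algebra ℚ F] (x : BPt a b F) :
    ‖x.re‖ = coordNorm x ∨ ‖x.imI‖ = coordNorm x ∨ ‖x.imJ‖ = coordNorm x ∨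
      ‖x.imK‖ = coordNorm x := by
  unfold coordNorm
  rcases max_choice (max ‖x.re‖ ‖x.imI‖) (max ‖x.imJ‖ ‖x.imK‖) with h | h <;> rw [h]
  · rcases max_choice ‖x.re‖ ‖x.imI‖ with h | h <;> rw [h] <;> simp
  · rcases max_choice ‖x.imJ‖ ‖x.imK‖ with h | h <;> rw [h] <;> simp

theorem coordNorm_pos {F : Type} [NormedField F] [Algebra ℚ F] {x : BPt a b F} (hx : x ≠ 0) :
    0 < coordNorm x := by
  refine lt_of_le_of_ne (coordNorm_nonneg x) fun h => hx ?_
  have := (coordNorm_le_iff (x := x)).1 h.symm.le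
  simp only [norm_le_zero_iff] at this
  ext <;> simp [this]

theorem eventually_coordNorm_le_one (x : BPt a b Adele) :
    ∀ᶠ p : Nat.Primes in Filter.cofinite, coordNorm (locMap a b p x) ≤ 1 := by
  filter_upwards [eventually_norm_le_one x.re, eventually_norm_le_one x.imI,
    eventually_norm_le_one x.imJ, eventually_norm_le_one x.imK] with p h1 h2 h3 h4
  exact coordNorm_le_iff.2 ⟨h1, h2, h3, h4⟩

theorem exists_BPt (xr : BPt a b ℝ) (xf : ∀ p : Nat.Primes, BPt a b ℚ_[(p : ℕ)])
    (h : ∀ᶠ p in Filter.cofinite, coordNorm (xf p) ≤ 1) :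
    ∃ x : BPt a b Adele, realMap a b x = xr ∧ ∀ p, locMap a b p x = xf p := by
  obtain ⟨x1, h1, h1p⟩ := exists_adele xr.re (fun p => (xf p).re)
    (h.mono fun p hp => (coordNorm_le_iff.1 hp).1)
  obtain ⟨x2, h2, h2p⟩ := exists_adele xr.imI (fun p => (xf p).imI)
    (h.mono fun p hp => (coordNorm_le_iff.1 hp).2.1)
  obtain ⟨x3, h3, h3p⟩ := exists_adele xr.imJ (fun p => (xf p).imJ)
    (h.mono fun p hp => (coordNorm_le_iff.1 hp).2.2.1)
  obtain ⟨x4, h4, h4p⟩ := exists_adele xr.imK (fun p => (xf p).imK)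
    (h.mono fun p hp => (coordNorm_le_iff.1 hp).2.2.2)
  refine ⟨⟨x1, x2, x3, x4⟩, ?_, fun p => ?_⟩
  · ext1 <;> assumption
  · ext1 <;> simp [BPt.map, h1p, h2p, h3p, h4p]

theorem exists_unit (xr : (BPt a b ℝ)ˣ) (xf : ∀ p : Nat.Primes, (BPt a b ℚ_[(p : ℕ)])ˣ)
    (h : ∀ᶠ p in Filter.cofinite, coordNorm (xf p).val ≤ 1 ∧ coordNorm (xf p)⁻¹.val ≤ 1) :
    ∃ x : (BPt a b Adele)ˣ, realUnit a b x = xr ∧ ∀ p, locUnit a b p x = xf p := by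
  obtain ⟨x, hx, hxp⟩ := exists_BPt xr.val (fun p => (xf p).val) (h.mono fun p hp => hp.1)
  obtain ⟨y, hy, hyp⟩ := exists_BPt xr⁻¹.val (fun p => (xf p)⁻¹.val) (h.mono fun p hp => hp.2)
  refine ⟨⟨x, y, BPt_ext ?_ fun p => ?_, BPt_ext ?_ fun p => ?_⟩, ?_, fun p => ?_⟩
  · rw [map_mul, hx, hy, Units.mul_inv, map_one]
  · rw [map_mul, hxp, hyp, Units.mul_inv, map_one]
  · rw [map_mul, hx, hy, Units.inv_mul, map_one]
  · rw [map_mul, hxp, hyp, Units.inv_mul, map_one]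
  · ext1; exact hx
  · ext1; exact hxp p

end Components

/-! ### Rational numbers with prescribed absolute values -/

section RationalApproximation

theorem norm_natCast_prod_pow (v : Nat.Primes → ℕ) (s : Finset Nat.Primes) (p : Nat.Primes) :
    ‖((∏ q ∈ s, (q : ℕ) ^ v q : ℕ) : ℚ_[(p : ℕ)])‖
      = if p ∈ s then ((p : ℝ) ^ v p)⁻¹ else 1 := by
  classical
  push_cast
  rw [norm_prod]
  have : ∀ q ∈ s, ‖((q : ℕ) : ℚ_[(p : ℕ)]) ^ v q‖ = if q = p then ((p : ℝ) ^ v p)⁻¹ else 1 := by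
    intro q _
    split_ifs with h
    · subst h
      rw [norm_pow, Padic.norm_p, inv_pow]
    · rw [norm_pow, Padic.norm_natCast_eq_one_iff.2, one_pow]
      exact (Nat.coprime_primes p.2 q.2).2 fun h' => h (Subtype.ext h'.symm)
  rw [Finset.prod_congr rfl this, Finset.prod_ite_eq']

/-- Only finitely many primes impose a condition, so `N` can be a product of high powers of these
primes. -/
theorem exists_nat_norm_mul_le (r : Nat.Primes → ℝ) (h : ∀ᶠ p in Filter.cofinite, r p ≤ 1) :
    ∃ N : ℕ, 0 < N ∧ ∀ p : Nat.Primes, ‖(N : ℚ_[(p : ℕ)])‖ * r p ≤ 1 := by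
  have hv : ∀ p : Nat.Primes, ∃ k : ℕ, r p ≤ (p : ℝ) ^ k := fun p =>
    (pow_unbounded_of_one_lt (r p) (by exact_mod_cast p.2.one_lt)).imp fun _ hk => hk.le
  choose v hv using hv
  rw [Filter.eventually_cofinite] at h
  refine ⟨∏ q ∈ h.toFinset, (q : ℕ) ^ v q,
    Finset.prod_pos fun q _ => pow_pos q.2.pos _, fun p => ?_⟩
  have hp : (0 : ℝ) < p := by exact_mod_cast p.2.pos
  rw [norm_natCast_prod_pow]
  split_ifs with hps
  · rw [inv_mul_le_iff₀ (by positivity), mul_one]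
    exact hv p
  · simpa using hps

/-- This is the class number one of $\mathbb Q$: the positive valuations are collected in a
numerator and the negative ones in a denominator. -/
theorem exists_rat_norm_eq (z : ∀ p : Nat.Primes, ℚ_[(p : ℕ)]) (hz : ∀ p, z p ≠ 0)
    (h : ∀ᶠ p in Filter.cofinite, ‖z p‖ = 1) :
    ∃ q : ℚ, q ≠ 0 ∧ ∀ p : Nat.Primes, ‖(q : ℚ_[(p : ℕ)])‖ = ‖z p‖ := by
  rw [Filter.eventually_cofinite] at h
  set s := h.toFinset with hs
  set A := ∏ q ∈ s, (q : ℕ) ^ ((z q).valuation.toNat) with hA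
  set B := ∏ q ∈ s, (q : ℕ) ^ ((-(z q).valuation).toNat) with hB
  have hA0 : A ≠ 0 := (Finset.prod_pos fun q _ => pow_pos q.2.pos _).ne'
  have hB0 : B ≠ 0 := (Finset.prod_pos fun q _ => pow_pos q.2.pos _).ne'
  refine ⟨A / B, by positivity, fun p => ?_⟩
  have hp : (p : ℝ) ≠ 0 := by exact_mod_cast p.2.ne_zero
  have hAp := norm_natCast_prod_pow (fun q => (z q).valuation.toNat) s p
  have hBp := norm_natCast_prod_pow (fun q => (-(z q).valuation).toNat) s p
  rw [← hA] at hAp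
  rw [← hB] at hBp
  push_cast
  rw [norm_div, hAp, hBp]
  split_ifs with hps
  · rw [Padic.norm_eq_zpow_neg_valuation (hz p), div_eq_mul_inv, inv_inv, ← zpow_natCast,
      ← zpow_natCast, ← zpow_neg, ← zpow_add₀ (by exact_mod_cast p.2.ne_zero)]
    congr 1
    omega
  · have : ‖z p‖ = 1 := by simpa [hs] using hps
    simp [this]

end RationalApproximation

/-! ### Local orders -/

section LocalOrder

variable {a b : ℚ}

theorem coordNorm_add_le {p : Nat.Primes} {r : ℝ} {x y : BPt a b ℚ_[(p : ℕ)]}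
    (hx : coordNorm x ≤ r) (hy : coordNorm y ≤ r) : coordNorm (x + y) ≤ r := by
  obtain ⟨h1, h2, h3, h4⟩ := coordNorm_le_iff.1 hx
  obtain ⟨h1', h2', h3', h4'⟩ := coordNorm_le_iff.1 hy
  exact coordNorm_le_iff.2 ⟨(Padic.nonarchimedean _ _).trans (max_le h1 h1'),
    (Padic.nonarchimedean _ _).trans (max_le h2 h2'),
    (Padic.nonarchimedean _ _).trans (max_le h3 h3'),
    (Padic.nonarchimedean _ _).trans (max_le h4 h4')⟩

theorem coordNorm_zero {F : Type} [NormedField F] [Algebra ℚ F] :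
    coordNorm (0 : BPt a b F) = 0 := by
  simp [coordNorm]

theorem norm_nrd_le {p : Nat.Primes} (x : BPt a b ℚ_[(p : ℕ)]) :
    ‖nrd x‖ ≤ (1 + ‖(a : ℚ_[(p : ℕ)])‖ + ‖(b : ℚ_[(p : ℕ)])‖
      + ‖(a : ℚ_[(p : ℕ)])‖ * ‖(b : ℚ_[(p : ℕ)])‖) * coordNorm x ^ 2 := by
  obtain ⟨h1, h2, h3, h4⟩ := coordNorm_le_iff.1 (le_refl (coordNorm x))
  have e1 : ‖x.re‖ ^ 2 ≤ coordNorm x ^ 2 := by gcongr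
  have e2 : ‖x.imI‖ ^ 2 ≤ coordNorm x ^ 2 := by gcongr
  have e3 : ‖x.imJ‖ ^ 2 ≤ coordNorm x ^ 2 := by gcongr
  have e4 : ‖x.imK‖ ^ 2 ≤ coordNorm x ^ 2 := by gcongr
  unfold nrd
  simp only [eq_ratCast]
  refine (norm_add_le _ _).trans ?_
  refine (add_le_add (norm_sub_le _ _) le_rfl).trans ?_
  refine (add_le_add (add_le_add (norm_sub_le _ _) le_rfl) le_rfl).trans ?_
  simp only [norm_mul, norm_pow]
  have := mul_le_mul_of_nonneg_left e2 (norm_nonneg (a : ℚ_[(p : ℕ)]))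
  have := mul_le_mul_of_nonneg_left e3 (norm_nonneg (b : ℚ_[(p : ℕ)]))
  have := mul_le_mul_of_nonneg_left e4
    (mul_nonneg (norm_nonneg (a : ℚ_[(p : ℕ)])) (norm_nonneg (b : ℚ_[(p : ℕ)])))
  linarith

variable {O : Subring (BPt a b ℚ)}

theorem IsZOrder.exists_nat_smul_mem (hO : IsZOrder O) (β : BPt a b ℚ) :
    ∃ M : ℕ, 0 < M ∧ (M : ℚ) • β ∈ O := by
  have hβ : β ∈ Submodule.span ℚ (O : Set (BPt a b ℚ)) := by rw [hO.span_eq_top]; trivial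
  induction hβ using Submodule.span_induction with
  | mem x hx => exact ⟨1, one_pos, by simpa using hx⟩
  | zero => exact ⟨1, one_pos, by simp⟩
  | add x y _ _ hx hy =>
    obtain ⟨M, hM, hM'⟩ := hx
    obtain ⟨N, hN, hN'⟩ := hy
    refine ⟨M * N, by positivity, ?_⟩
    have : ((M * N : ℕ) : ℚ) • (x + y) = N • ((M : ℚ) • x) + M • ((N : ℚ) • y) := by
      simp only [← Nat.cast_smul_eq_nsmul ℚ, smul_smul, smul_add]
      push_cast
      rw [mul_comm (M : ℚ)]
    rw [this]
    exact add_mem (nsmul_mem hM' _) (nsmul_mem hN' _)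
  | smul q x _ hx =>
    obtain ⟨M, hM, hM'⟩ := hx
    refine ⟨M * q.den, by positivity, ?_⟩
    have : ((M * q.den : ℕ) : ℚ) • q • x = q.num • ((M : ℚ) • x) := by
      rw [← Int.cast_smul_eq_zsmul ℚ, smul_smul, smul_smul]
      congr 1
      push_cast
      rw [mul_assoc, Rat.den_mul_eq_num, mul_comm]
    rw [this]
    exact zsmul_mem hM' _

theorem natCast_smul_mem_of_dvd {M N : ℕ} (h : M ∣ N) {β : BPt a b ℚ} (hβ : (M : ℚ) • β ∈ O) :
    (N : ℚ) • β ∈ O := by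
  obtain ⟨k, rfl⟩ := h
  have : ((M * k : ℕ) : ℚ) • β = k • ((M : ℚ) • β) := by
    rw [← Nat.cast_smul_eq_nsmul ℚ, smul_smul]
    push_cast
    rw [mul_comm]
  rw [this]
  exact nsmul_mem hβ _

theorem IsZOrder.exists_nat_smul_mem_finset (hO : IsZOrder O) (s : Finset (BPt a b ℚ)) :
    ∃ M : ℕ, 0 < M ∧ ∀ β ∈ s, (M : ℚ) • β ∈ O := by
  choose M hM hM' using hO.exists_nat_smul_mem
  exact ⟨∏ β ∈ s, M β, Finset.prod_pos fun β _ => hM β, fun β hβ =>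
    natCast_smul_mem_of_dvd (Finset.dvd_prod_of_mem M hβ) (hM' β)⟩

theorem exists_nat_norm_mul_coordNorm_le (x : BPt a b Adele) :
    ∃ N : ℕ, 0 < N ∧ ∀ p : Nat.Primes, ‖(N : ℚ_[(p : ℕ)])‖ * coordNorm (locMap a b p x) ≤ 1 :=
  exists_nat_norm_mul_le _ (eventually_coordNorm_le_one x)

theorem norm_natCast_le_one (p : Nat.Primes) (n : ℕ) : ‖(n : ℚ_[(p : ℕ)])‖ ≤ 1 := by
  simpa using Padic.norm_int_le_one (p := p) n

theorem norm_natCast_pos (p : Nat.Primes) {n : ℕ} (hn : 0 < n) : 0 < ‖(n : ℚ_[(p : ℕ)])‖ :=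
  norm_pos_iff.2 (by exact_mod_cast hn.ne')

theorem norm_natCast_le_of_dvd (p : Nat.Primes) {m n : ℕ} (h : m ∣ n) :
    ‖(n : ℚ_[(p : ℕ)])‖ ≤ ‖(m : ℚ_[(p : ℕ)])‖ := by
  obtain ⟨k, rfl⟩ := h
  rw [Nat.cast_mul, norm_mul]
  exact mul_le_of_le_one_right (norm_nonneg _) (norm_natCast_le_one p k)

/-- Finitely many generators have a common denominator, and the ultrametric inequality carries the
bound to their integral combinations, so one `M` serves all primes. -/
theorem IsZOrder.exists_norm_mul_coordNorm_ofRat_le (hO : IsZOrder O) :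
    ∃ M : ℕ, 0 < M ∧ ∀ (p : Nat.Primes), ∀ β ∈ O,
      ‖(M : ℚ_[(p : ℕ)])‖ * coordNorm (BPt.ofRat a b ℚ_[(p : ℕ)] β) ≤ 1 := by
  obtain ⟨s, hs⟩ := hO.fg
  have hN : ∀ β : BPt a b ℚ, ∃ N : ℕ, 0 < N ∧ ∀ p : Nat.Primes,
      ‖(N : ℚ_[(p : ℕ)])‖ * coordNorm (BPt.ofRat a b ℚ_[(p : ℕ)] β) ≤ 1 := fun β => by
    obtain ⟨N, hN, h⟩ := exists_nat_norm_mul_coordNorm_le (BPt.ofRat a b Adele β)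
    exact ⟨N, hN, fun p => by simpa only [map_ofRat] using h p⟩
  choose N hN hN' using hN
  refine ⟨∏ β ∈ s, N β, Finset.prod_pos fun β _ => hN β, fun p β hβ => ?_⟩
  have hpos : 0 < ‖((∏ β ∈ s, N β : ℕ) : ℚ_[(p : ℕ)])‖ :=
    norm_natCast_pos p (Finset.prod_pos fun β _ => hN β)
  have hβ' : β ∈ AddSubgroup.closure (s : Set (BPt a b ℚ)) := by rw [hs]; exact hβ
  rw [← le_div_iff₀' hpos]
  induction hβ' using AddSubgroup.closure_induction with
  | mem x hx =>
    rw [le_div_iff₀' hpos]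
    refine le_trans ?_ (hN' x p)
    exact mul_le_mul_of_nonneg_right
      (norm_natCast_le_of_dvd p (Finset.dvd_prod_of_mem N (by exact_mod_cast hx)))
      (coordNorm_nonneg _)
  | zero =>
    rw [map_zero, coordNorm_zero]
    positivity
  | add x y hx' hy' hx hy =>
    rw [map_add]
    refine coordNorm_add_le (hx ?_) (hy ?_)
    · rw [hs] at hx'; exact hx'
    · rw [hs] at hy'; exact hy'
  | neg x hx' hx =>
    rw [map_neg, ← neg_one_smul ℚ_[(p : ℕ)], coordNorm_smul, norm_neg, norm_one, one_mul]
    rw [hs] at hx'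
    exact hx hx'

theorem ofRat_mem_localOrder (p : Nat.Primes) {β : BPt a b ℚ} (hβ : β ∈ O) :
    BPt.ofRat a b ℚ_[(p : ℕ)] β ∈ localOrder O p :=
  Algebra.subset_adjoin ⟨β, hβ, rfl⟩

theorem smul_mem_localOrder {p : Nat.Primes} {c : ℚ_[(p : ℕ)]} (hc : ‖c‖ ≤ 1)
    {y : BPt a b ℚ_[(p : ℕ)]} (hy : y ∈ localOrder O p) : c • y ∈ localOrder O p :=
  (localOrder O p).smul_mem hy (⟨c, hc⟩ : ℤ_[(p : ℕ)])

theorem algebraMap_mem_localOrder {p : Nat.Primes} {c : ℚ_[(p : ℕ)]} (hc : ‖c‖ ≤ 1) :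
    algebraMap _ (BPt a b ℚ_[(p : ℕ)]) c ∈ localOrder O p := by
  exact (localOrder O p).algebraMap_mem (⟨c, hc⟩ : ℤ_[(p : ℕ)])

theorem coe_closure_image_eq {R : Type} [CommRing R] [Algebra ℚ R] (T : Subring (BPt a b ℚ)) :
    (Submonoid.closure (BPt.ofRat a b R '' (T : Set (BPt a b ℚ))) : Set (BPt a b R))
      = BPt.ofRat a b R '' (T : Set (BPt a b ℚ)) := by
  have : BPt.ofRat a b R '' (T : Set (BPt a b ℚ))
      = (T.toSubmonoid.map (BPt.ofRat a b R : BPt a b ℚ →* BPt a b R) : Set (BPt a b R)) := rfl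
  rw [this, Submonoid.closure_eq]

theorem localOrder_toSubmodule (p : Nat.Primes) :
    Subalgebra.toSubmodule (localOrder O p)
      = Submodule.span ℤ_[(p : ℕ)] (BPt.ofRat a b ℚ_[(p : ℕ)] '' (O : Set (BPt a b ℚ))) := by
  rw [localOrder, Algebra.adjoin_eq_span, coe_closure_image_eq]

theorem IsZOrder.exists_norm_mul_coordNorm_le (hO : IsZOrder O) :
    ∃ M : ℕ, 0 < M ∧ ∀ (p : Nat.Primes), ∀ y ∈ localOrder O p,
      ‖(M : ℚ_[(p : ℕ)])‖ * coordNorm y ≤ 1 := by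
  obtain ⟨M, hM, h⟩ := hO.exists_norm_mul_coordNorm_ofRat_le
  refine ⟨M, hM, fun p y hy => ?_⟩
  have hpos := norm_natCast_pos p hM
  rw [← Subalgebra.mem_toSubmodule, localOrder_toSubmodule] at hy
  rw [← le_div_iff₀' hpos]
  induction hy using Submodule.span_induction with
  | mem x hx =>
    obtain ⟨β, hβ, rfl⟩ := hx
    rw [le_div_iff₀' hpos]
    exact h p β hβ
  | zero => simp [coordNorm]
  | add x y _ _ hx hy => exact coordNorm_add_le hx hy
  | smul c x _ hx =>
    have : c • x = (c : ℚ_[(p : ℕ)]) • x := rfl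
    rw [this, coordNorm_smul]
    exact (mul_le_of_le_one_left (coordNorm_nonneg _) c.2).trans hx

/-- As the order spans, it contains a common multiple `M` of $1,i,j,ij$. The same `M` works at every
prime, and it is what makes the local orders uniformly comparable with $\mathbb Z_p^4$. -/
theorem IsZOrder.exists_mem_of_coordNorm_le (hO : IsZOrder O) :
    ∃ M : ℕ, 0 < M ∧ ∀ (p : Nat.Primes) (y : BPt a b ℚ_[(p : ℕ)]),
      coordNorm y ≤ ‖(M : ℚ_[(p : ℕ)])‖ → y ∈ localOrder O p := by
  classical
  obtain ⟨M, hM, h⟩ := hO.exists_nat_smul_mem_finset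
    {⟨1, 0, 0, 0⟩, ⟨0, 1, 0, 0⟩, ⟨0, 0, 1, 0⟩, ⟨0, 0, 0, 1⟩}
  refine ⟨M, hM, fun p y hy => ?_⟩
  have hpos := norm_natCast_pos p hM
  have hM0 : (M : ℚ_[(p : ℕ)]) ≠ 0 := norm_pos_iff.1 hpos
  obtain ⟨h1, h2, h3, h4⟩ := coordNorm_le_iff.1 hy
  have key : ∀ β : BPt a b ℚ, (M : ℚ) • β ∈ O → ∀ c : ℚ_[(p : ℕ)], ‖c‖ ≤ ‖(M : ℚ_[(p : ℕ)])‖ →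
      c • BPt.ofRat a b ℚ_[(p : ℕ)] β ∈ localOrder O p := by
    intro β hβ c hc
    have : c • BPt.ofRat a b ℚ_[(p : ℕ)] β
        = (c / M) • BPt.ofRat a b ℚ_[(p : ℕ)] ((M : ℚ) • β) := by
      rw [ofRat_smul, smul_smul]
      congr 1
      simp [hM0]
    rw [this]
    refine smul_mem_localOrder ?_ (ofRat_mem_localOrder p hβ)
    rw [norm_div]
    exact div_le_one_of_le₀ hc hpos.le
  have hy' : y = y.re • BPt.ofRat a b ℚ_[(p : ℕ)] ⟨1, 0, 0, 0⟩
      + y.imI • BPt.ofRat a b ℚ_[(p : ℕ)] ⟨0, 1, 0, 0⟩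
      + y.imJ • BPt.ofRat a b ℚ_[(p : ℕ)] ⟨0, 0, 1, 0⟩
      + y.imK • BPt.ofRat a b ℚ_[(p : ℕ)] ⟨0, 0, 0, 1⟩ := by
    ext <;> simp [BPt.map]
  rw [hy']
  exact add_mem (add_mem (add_mem (key _ (h _ (by simp)) _ h1) (key _ (h _ (by simp)) _ h2))
    (key _ (h _ (by simp)) _ h3)) (key _ (h _ (by simp)) _ h4)

/-- The powers $y^n$ stay in the bounded set $\mathbb O_p$, so $\operatorname{nrd}(y)^n$ is bounded
in $n$. -/
theorem IsZOrder.norm_nrd_le_one (hO : IsZOrder O) {p : Nat.Primes} {y : BPt a b ℚ_[(p : ℕ)]}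
    (hy : y ∈ localOrder O p) : ‖nrd y‖ ≤ 1 := by
  obtain ⟨M, hM, h⟩ := hO.exists_norm_mul_coordNorm_le
  have hpos := norm_natCast_pos p hM
  by_contra! hlt
  set C : ℝ := 1 + ‖(a : ℚ_[(p : ℕ)])‖ + ‖(b : ℚ_[(p : ℕ)])‖
      + ‖(a : ℚ_[(p : ℕ)])‖ * ‖(b : ℚ_[(p : ℕ)])‖
  have hC : 0 ≤ C := by positivity
  obtain ⟨n, hn⟩ := pow_unbounded_of_one_lt (C * (1 / ‖(M : ℚ_[(p : ℕ)])‖) ^ 2) hlt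
  have hpow : nrd (y ^ n) = nrd y ^ n := by
    clear hn
    induction n with
    | zero => simp [nrd_one]
    | succ n ih => rw [pow_succ, nrd_mul, ih, pow_succ]
  rw [← norm_pow, ← hpow] at hn
  have h1 := norm_nrd_le (y ^ n)
  have h2 : coordNorm (y ^ n) ≤ 1 / ‖(M : ℚ_[(p : ℕ)])‖ := by
    rw [le_div_iff₀' hpos]
    exact h p _ (pow_mem hy n)
  have h3 : coordNorm (y ^ n) ^ 2 ≤ (1 / ‖(M : ℚ_[(p : ℕ)])‖) ^ 2 :=
    pow_le_pow_left₀ (coordNorm_nonneg _) h2 2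
  exact absurd (hn.trans_le (h1.trans (mul_le_mul_of_nonneg_left h3 hC))) (lt_irrefl _)

/-- Polarisation: the reduced trace is $\operatorname{nrd}(1+y)-1-\operatorname{nrd}(y)$. -/
theorem IsZOrder.norm_trd_le_one (hO : IsZOrder O) {p : Nat.Primes} {y : BPt a b ℚ_[(p : ℕ)]}
    (hy : y ∈ localOrder O p) : ‖2 * y.re‖ ≤ 1 := by
  have h1 := hO.norm_nrd_le_one hy
  have h2 := hO.norm_nrd_le_one (add_mem (one_mem _) hy)
  have h3 := nrd_one_add_smul 1 y
  have h4 : 2 * y.re = nrd (1 + y) + (-1 + - nrd y) := by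
    rw [one_smul] at h3
    rw [h3]; ring
  rw [h4]
  refine (Padic.nonarchimedean _ _).trans (max_le h2 ((Padic.nonarchimedean _ _).trans
    (max_le ?_ ?_)))
  · simp
  · rwa [norm_neg]

theorem IsZOrder.star_mem (hO : IsZOrder O) {p : Nat.Primes} {y : BPt a b ℚ_[(p : ℕ)]}
    (hy : y ∈ localOrder O p) : star y ∈ localOrder O p := by
  rw [star_eq_sub]
  exact sub_mem (algebraMap_mem_localOrder (hO.norm_trd_le_one hy)) hy

theorem IsZOrder.norm_nrd_eq_one (hO : IsZOrder O) {p : Nat.Primes}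
    {y : (BPt a b ℚ_[(p : ℕ)])ˣ} (hy : y.val ∈ localOrder O p) (hy' : y⁻¹.val ∈ localOrder O p) :
    ‖nrd y.val‖ = 1 := by
  have h1 := hO.norm_nrd_le_one hy
  have h2 := hO.norm_nrd_le_one hy'
  have h3 := congrArg norm (nrd_inv_mul_nrd y)
  rw [norm_mul, norm_one] at h3
  nlinarith [norm_nonneg (nrd y.val)]

theorem IsZOrder.inv_mem (hO : IsZOrder O) {p : Nat.Primes}
    {y : (BPt a b ℚ_[(p : ℕ)])ˣ} (hy : y.val ∈ localOrder O p) (h : ‖nrd y.val‖ = 1) :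
    y⁻¹.val ∈ localOrder O p := by
  rw [inv_eq_smul_star]
  refine smul_mem_localOrder ?_ (hO.star_mem hy)
  have h3 := congrArg norm (nrd_inv_mul_nrd y)
  rw [norm_mul, norm_one, h, mul_one] at h3
  exact h3.le

end LocalOrder

/-! ### Topology of the adelic points -/

section TopologicalRing

variable {a b : ℚ} {R : Type} [CommRing R] [Algebra ℚ R] [TopologicalSpace R]

theorem continuous_BPt_iff {X : Type} [TopologicalSpace X] {f : X → BPt a b R} :
    Continuous f ↔ Continuous (fun x => (f x).re) ∧ Continuous (fun x => (f x).imI) ∧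
      Continuous (fun x => (f x).imJ) ∧ Continuous (fun x => (f x).imK) := by
  rw [continuous_induced_rng]
  simp only [Function.comp_def, continuous_prodMk, QuaternionAlgebra.equivProd_apply]

theorem continuous_re : Continuous (fun x : BPt a b R => x.re) :=
  (continuous_BPt_iff.1 continuous_id).1

theorem continuous_imI : Continuous (fun x : BPt a b R => x.imI) :=
  (continuous_BPt_iff.1 continuous_id).2.1

theorem continuous_imJ : Continuous (fun x : BPt a b R => x.imJ) :=
  (continuous_BPt_iff.1 continuous_id).2.2.1

theorem continuous_imK : Continuous (fun x : BPt a b R => x.imK) :=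
  (continuous_BPt_iff.1 continuous_id).2.2.2

instance BPt.isTopologicalRing [IsTopologicalRing R] : IsTopologicalRing (BPt a b R) where
  continuous_add := by
    have h1 := continuous_re (a := a) (b := b) (R := R)
    have h2 := continuous_imI (a := a) (b := b) (R := R)
    have h3 := continuous_imJ (a := a) (b := b) (R := R)
    have h4 := continuous_imK (a := a) (b := b) (R := R)
    refine continuous_BPt_iff.2 ⟨?_, ?_, ?_, ?_⟩ <;>
      simp only [QuaternionAlgebra.re_add, QuaternionAlgebra.imI_add, QuaternionAlgebra.imJ_add,
        QuaternionAlgebra.imK_add] <;> fun_prop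
  continuous_mul := by
    have h1 := continuous_re (a := a) (b := b) (R := R)
    have h2 := continuous_imI (a := a) (b := b) (R := R)
    have h3 := continuous_imJ (a := a) (b := b) (R := R)
    have h4 := continuous_imK (a := a) (b := b) (R := R)
    refine continuous_BPt_iff.2 ⟨?_, ?_, ?_, ?_⟩ <;>
      simp only [QuaternionAlgebra.re_mul, QuaternionAlgebra.imI_mul, QuaternionAlgebra.imJ_mul,
        QuaternionAlgebra.imK_mul] <;> fun_prop
  continuous_neg := by
    have h1 := continuous_re (a := a) (b := b) (R := R)
    have h2 := continuous_imI (a := a) (b := b) (R := R)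
    have h3 := continuous_imJ (a := a) (b := b) (R := R)
    have h4 := continuous_imK (a := a) (b := b) (R := R)
    refine continuous_BPt_iff.2 ⟨?_, ?_, ?_, ?_⟩ <;>
      simp only [QuaternionAlgebra.re_neg, QuaternionAlgebra.imI_neg, QuaternionAlgebra.imJ_neg,
        QuaternionAlgebra.imK_neg] <;> fun_prop

instance BPt.t2Space [T2Space R] : T2Space (BPt a b R) :=
  T2Space.of_injective_continuous
    (QuaternionAlgebra.equivProd (algebraMap ℚ R a) 0 (algebraMap ℚ R b)).injective
    continuous_induced_dom

end TopologicalRing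

/-! ### Open and compact boxes in the adelic group -/

section AdelicTopology

variable {a b : ℚ}

instance fact_isOpen_padicInt :
    Fact (∀ p : Nat.Primes, IsOpen ((PadicInt.subring (p : ℕ) : Set ℚ_[(p : ℕ)]))) :=
  ⟨fun p => by
    convert (PadicInt.isOpenEmbedding_coe (p := p)).isOpen_range using 1
    exact Subtype.range_coe.symm⟩

theorem isOpen_forall_norm_le_one : IsOpen {c : Adele | ∀ p, ‖toPadic p c‖ ≤ 1} := by
  have h := (RestrictedProduct.isOpen_forall_mem (R := fun p : Nat.Primes => ℚ_[(p : ℕ)])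
    (A := fun p => (PadicInt.subring (p : ℕ) : Set ℚ_[(p : ℕ)]))
    fact_isOpen_padicInt.out).preimage (continuous_snd (X := ℝ))
  exact h

theorem isOpen_forall_norm_le {M : ℕ} (hM : 0 < M) :
    IsOpen {c : Adele | ∀ p, ‖toPadic p c‖ ≤ ‖(M : ℚ_[(p : ℕ)])‖} := by
  have h := isOpen_forall_norm_le_one.preimage
    (continuous_const_mul (algebraMap ℚ Adele (M : ℚ)⁻¹))
  convert h using 1
  ext c
  simp only [Set.mem_preimage, Set.mem_ofPred_eq, map_mul, AlgHom.commutes, eq_ratCast,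
    Rat.cast_inv, Rat.cast_natCast, norm_mul, norm_inv]
  refine forall_congr' fun p => ?_
  rw [inv_mul_le_iff₀ (norm_natCast_pos p hM), mul_one]

theorem isOpen_forall_coordNorm_le {M : ℕ} (hM : 0 < M) :
    IsOpen {y : BPt a b Adele | ∀ p, coordNorm (locMap a b p y) ≤ ‖(M : ℚ_[(p : ℕ)])‖} := by
  have h := isOpen_forall_norm_le hM
  have := ((h.preimage (continuous_re (a := a) (b := b))).inter
    (h.preimage (continuous_imI (a := a) (b := b)))).inter
    ((h.preimage (continuous_imJ (a := a) (b := b))).inter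
    (h.preimage (continuous_imK (a := a) (b := b))))
  convert this using 1
  ext y
  simp only [coordNorm_le_iff, Set.mem_ofPred_eq, Set.mem_inter_iff, Set.mem_preimage, forall_and,
    and_assoc]
  rfl

variable {O : Subring (BPt a b ℚ)}

/-- The set is an additive subgroup that contains a neighbourhood of zero. -/
theorem IsZOrder.isOpen_forall_smul_mem (hO : IsZOrder O) (N : ℕ) :
    IsOpen {y : BPt a b Adele | ∀ p, (N : ℚ_[(p : ℕ)]) • locMap a b p y ∈ localOrder O p} := by
  obtain ⟨M, hM, h⟩ := hO.exists_mem_of_coordNorm_le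
  let H : AddSubgroup (BPt a b Adele) :=
    { carrier := {y | ∀ p, (N : ℚ_[(p : ℕ)]) • locMap a b p y ∈ localOrder O p}
      zero_mem' := fun p => by rw [map_zero, smul_zero]; exact zero_mem _
      add_mem' := fun {x y} hx hy p => by
        rw [map_add, smul_add]; exact add_mem (hx p) (hy p)
      neg_mem' := fun {x} hx p => by
        rw [map_neg, smul_neg]; exact neg_mem (hx p) }
  refine H.isOpen_of_mem_nhds (g := 0)
    (Filter.mem_of_superset ((isOpen_forall_coordNorm_le hM).mem_nhds ?_) ?_)
  · intro p
    rw [map_zero, coordNorm_zero]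
    positivity
  · exact fun y hy p => smul_mem_localOrder (norm_natCast_le_one p N) (h p _ (hy p))

/-- The set of the classes of the elements `x ∈ 𝐁ˣ(𝔸)` such that `N x_p, N x_p⁻¹ ∈ 𝕆_p` for all
primes `p`. -/
def adelicBox (O : Subring (BPt a b ℚ)) (N : ℕ) : Set (GPt a b Adele) :=
  {η | ∃ x : (BPt a b Adele)ˣ, QuotientGroup.mk x = η ∧
    ∀ p, (N : ℚ_[(p : ℕ)]) • (locUnit a b p x).val ∈ localOrder O p ∧
      (N : ℚ_[(p : ℕ)]) • (locUnit a b p x)⁻¹.val ∈ localOrder O p}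

theorem IsZOrder.isOpen_adelicBox (hO : IsZOrder O) (N : ℕ) : IsOpen (adelicBox O N) := by
  have h := hO.isOpen_forall_smul_mem N
  have h1 := (h.preimage (Units.continuous_val)).inter
    ((h.preimage (Units.continuous_val)).preimage continuous_inv)
  have h2 := QuotientGroup.isOpenMap_coe (N := scalars a b Adele) _ h1
  convert h2 using 1
  ext η
  constructor
  · rintro ⟨x, rfl, hx⟩
    exact ⟨x, ⟨fun p => (hx p).1, fun p => (hx p).2⟩, rfl⟩
  · rintro ⟨x, ⟨h1, h2⟩, rfl⟩
    exact ⟨x, rfl, fun p => ⟨h1 p, h2 p⟩⟩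

theorem natCast_smul_mem_localOrder_of_dvd {M N : ℕ} (h : M ∣ N) {p : Nat.Primes}
    {y : BPt a b ℚ_[(p : ℕ)]} (hy : (M : ℚ_[(p : ℕ)]) • y ∈ localOrder O p) :
    (N : ℚ_[(p : ℕ)]) • y ∈ localOrder O p := by
  obtain ⟨k, rfl⟩ := h
  rw [Nat.cast_mul, mul_comm, mul_smul]
  exact smul_mem_localOrder (norm_natCast_le_one p k) hy

theorem adelicBox_mono {M N : ℕ} (h : M ∣ N) : adelicBox O M ⊆ adelicBox O N := by
  rintro _ ⟨x, rfl, hx⟩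
  exact ⟨x, rfl, fun p => ⟨natCast_smul_mem_localOrder_of_dvd h (hx p).1,
    natCast_smul_mem_localOrder_of_dvd h (hx p).2⟩⟩

theorem IsZOrder.exists_nat_smul_locMap_mem (hO : IsZOrder O) (y : BPt a b Adele) :
    ∃ N : ℕ, 0 < N ∧ ∀ p, (N : ℚ_[(p : ℕ)]) • locMap a b p y ∈ localOrder O p := by
  obtain ⟨M, hM, h⟩ := hO.exists_mem_of_coordNorm_le
  obtain ⟨N, hN, h'⟩ := exists_nat_norm_mul_coordNorm_le y
  refine ⟨M * N, by positivity, fun p => h p _ ?_⟩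
  rw [coordNorm_smul, Nat.cast_mul, norm_mul, mul_assoc]
  exact mul_le_of_le_one_right (norm_nonneg _) (h' p)

theorem IsZOrder.exists_mem_adelicBox (hO : IsZOrder O) (η : GPt a b Adele) :
    ∃ N : ℕ, 0 < N ∧ η ∈ adelicBox O N := by
  obtain ⟨x, rfl⟩ := QuotientGroup.mk_surjective η
  obtain ⟨M, hM, h⟩ := hO.exists_nat_smul_locMap_mem x.val
  obtain ⟨N, hN, h'⟩ := hO.exists_nat_smul_locMap_mem x⁻¹.val
  exact ⟨M * N, by positivity, x, rfl, fun p =>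
    ⟨natCast_smul_mem_localOrder_of_dvd (dvd_mul_right _ _) (h p),
      natCast_smul_mem_localOrder_of_dvd (dvd_mul_left _ _) (h' p)⟩⟩

/-- The boxes form an open cover directed by divisibility, so a compact set is contained in a single
one. -/
theorem IsZOrder.exists_subset_adelicBox (hO : IsZOrder O) {B : Set (GPt a b Adele)}
    (hB : IsCompact B) : ∃ N : ℕ, 0 < N ∧ B ⊆ adelicBox O N := by
  have : Nonempty {N : ℕ // 0 < N} := ⟨⟨1, one_pos⟩⟩
  obtain ⟨N, hN⟩ := hB.elim_directed_cover (fun N : {N : ℕ // 0 < N} => adelicBox O N)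
    (fun N => hO.isOpen_adelicBox N) (fun η _ => by
      obtain ⟨N, hN, h⟩ := hO.exists_mem_adelicBox η
      exact Set.mem_iUnion.2 ⟨⟨N, hN⟩, h⟩)
    (fun M N => ⟨⟨M * N, Nat.mul_pos M.2 N.2⟩, adelicBox_mono (dvd_mul_right _ _),
      adelicBox_mono (dvd_mul_left _ _)⟩)
  exact ⟨N, N.2, hN⟩

/-- The box is closed and contained in $N^{-1}\prod_p\mathbb Z_p$, which is compact as a translate
of the image of a product of compact spaces. -/
theorem isCompact_finAdele_box {N : ℕ} (hN : 0 < N) :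
    IsCompact {c : FinAdele | ∀ p : Nat.Primes, ‖(N : ℚ_[(p : ℕ)])‖ * ‖c p‖ ≤ 1} := by
  have hc : CompactSpace (∀ p : Nat.Primes, (PadicInt.subring (p : ℕ) : Set ℚ_[(p : ℕ)])) := by
    have : ∀ p : Nat.Primes, CompactSpace (PadicInt.subring (p : ℕ) : Set ℚ_[(p : ℕ)]) :=
      fun p => inferInstanceAs (CompactSpace ℤ_[(p : ℕ)])
    infer_instance
  have h1 : IsCompact (Set.range (RestrictedProduct.structureMap
      (fun p : Nat.Primes => ℚ_[(p : ℕ)])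
      (fun p => (PadicInt.subring (p : ℕ) : Set ℚ_[(p : ℕ)])) Filter.cofinite)) :=
    isCompact_range RestrictedProduct.isEmbedding_structureMap.continuous
  rw [RestrictedProduct.range_structureMap] at h1
  have h2 := h1.image (continuous_const_mul (ratToFinAdele (N : ℚ)⁻¹))
  refine h2.of_isClosed_subset ?_ ?_
  · have : ∀ p : Nat.Primes, Continuous fun c : FinAdele => c p := fun p =>
      RestrictedProduct.continuous_eval p
    simp only [Set.ofPred_forall]
    exact isClosed_iInter fun p =>
      isClosed_le (continuous_const.mul (this p).norm) continuous_const
  · intro c hc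
    refine ⟨ratToFinAdele (N : ℚ) * c, fun p => ?_, ?_⟩
    · refine (PadicInt.mem_subring_iff _).2 ?_
      have := hc p
      rw [← norm_mul] at this
      have h3 : (ratToFinAdele (N : ℚ) * c) p = (N : ℚ_[(p : ℕ)]) * c p := by
        change (((N : ℚ) : ℚ) : ℚ_[(p : ℕ)]) * c p = _
        rw [Rat.cast_natCast]
      rwa [← h3] at this
    · change ratToFinAdele (N : ℚ)⁻¹ * (ratToFinAdele (N : ℚ) * c) = c
      rw [← mul_assoc, ← map_mul, inv_mul_cancel₀ (by positivity), map_one, one_mul]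

theorem isCompact_BPt_box {C : Set (BPt a b ℝ)} (hC : IsCompact C) {N : ℕ} (hN : 0 < N) :
    IsCompact {y : BPt a b Adele | realMap a b y ∈ C ∧
      ∀ p : Nat.Primes, ‖(N : ℚ_[(p : ℕ)])‖ * coordNorm (locMap a b p y) ≤ 1} := by
  have hF := isCompact_finAdele_box hN
  let Φ : BPt a b ℝ × FinAdele × FinAdele × FinAdele × FinAdele → BPt a b Adele := fun t =>
    ⟨(t.1.re, t.2.1), (t.1.imI, t.2.2.1), (t.1.imJ, t.2.2.2.1), (t.1.imK, t.2.2.2.2)⟩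
  have hΦ : Continuous Φ := by
    have h1 := continuous_re (a := a) (b := b) (R := ℝ)
    have h2 := continuous_imI (a := a) (b := b) (R := ℝ)
    have h3 := continuous_imJ (a := a) (b := b) (R := ℝ)
    have h4 := continuous_imK (a := a) (b := b) (R := ℝ)
    refine continuous_BPt_iff.2 ⟨?_, ?_, ?_, ?_⟩ <;> simp only [Φ] <;> fun_prop
  convert (hC.prod (hF.prod (hF.prod (hF.prod hF)))).image hΦ using 1
  ext y
  constructor
  · rintro ⟨hr, hp⟩
    have hp' : ∀ p : Nat.Primes, ‖(N : ℚ_[(p : ℕ)])‖ * ‖toPadic p y.re‖ ≤ 1 ∧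
        ‖(N : ℚ_[(p : ℕ)])‖ * ‖toPadic p y.imI‖ ≤ 1 ∧
        ‖(N : ℚ_[(p : ℕ)])‖ * ‖toPadic p y.imJ‖ ≤ 1 ∧
        ‖(N : ℚ_[(p : ℕ)])‖ * ‖toPadic p y.imK‖ ≤ 1 := fun p => by
      have := hp p
      rw [← coordNorm_smul, coordNorm_le_iff] at this
      simpa [BPt.map] using this
    exact ⟨(realMap a b y, y.re.2, y.imI.2, y.imJ.2, y.imK.2),
      ⟨hr, fun p => (hp' p).1, fun p => (hp' p).2.1, fun p => (hp' p).2.2.1,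
        fun p => (hp' p).2.2.2⟩, rfl⟩
  · rintro ⟨⟨r, c1, c2, c3, c4⟩, ⟨hr, h1, h2, h3, h4⟩, rfl⟩
    refine ⟨hr, fun p => ?_⟩
    rw [← coordNorm_smul, coordNorm_le_iff]
    simp only [QuaternionAlgebra.re_smul, QuaternionAlgebra.imI_smul, QuaternionAlgebra.imJ_smul,
      QuaternionAlgebra.imK_smul, smul_eq_mul, norm_mul]
    exact ⟨h1 p, h2 p, h3 p, h4 p⟩

/-- Units carry the topology of a closed subset of $\{(x,y)\}$ through $x\mapsto(x,x^{-1})$, so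
bounds on both $x$ and $x^{-1}$ at all places are needed and suffice for compactness. -/
theorem IsZOrder.exists_isCompact_box (hO : IsZOrder O) {C : Set (BPt a b ℝ)} (hC : IsCompact C)
    {N : ℕ} (hN : 0 < N) :
    ∃ Q : Set (GPt a b Adele), IsCompact Q ∧ ∀ x : (BPt a b Adele)ˣ,
      (realUnit a b x).val ∈ C → (realUnit a b x)⁻¹.val ∈ C →
      (∀ p, (N : ℚ_[(p : ℕ)]) • (locUnit a b p x).val ∈ localOrder O p ∧
        (N : ℚ_[(p : ℕ)]) • (locUnit a b p x)⁻¹.val ∈ localOrder O p) →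
      QuotientGroup.mk x ∈ Q := by
  obtain ⟨M, hM, h⟩ := hO.exists_norm_mul_coordNorm_le
  have hP := isCompact_BPt_box hC (Nat.mul_pos hM hN)
  have hP' := hP.prod (MulOpposite.opHomeomorph.isCompact_image.2 hP)
  have hS := Units.isClosedEmbedding_embedProduct.isCompact_preimage hP'
  have hb : ∀ (p : Nat.Primes) (y : BPt a b ℚ_[(p : ℕ)]),
      (N : ℚ_[(p : ℕ)]) • y ∈ localOrder O p → ‖((M * N : ℕ) : ℚ_[(p : ℕ)])‖ * coordNorm y ≤ 1 := by
    intro p y hy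
    have := h p _ hy
    rwa [coordNorm_smul, ← mul_assoc, ← norm_mul, ← Nat.cast_mul] at this
  refine ⟨_, hS.image QuotientGroup.continuous_mk, fun x h1 h2 h3 => ⟨x, ⟨?_, ?_⟩, rfl⟩⟩
  · exact ⟨h1, fun p => hb p _ (h3 p).1⟩
  · exact ⟨x⁻¹.val, ⟨h2, fun p => hb p _ (h3 p).2⟩, rfl⟩

end AdelicTopology

/-! ### Tori and twisted orbits -/

section Tori

variable {a b : ℚ} {R S : Type} [CommRing R] [Algebra ℚ R] [CommRing S] [Algebra ℚ S]

theorem ofRat_rat (x : BPt a b ℚ) : BPt.ofRat a b ℚ x = x := rfl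

theorem EPt_rat (E : Subalgebra ℚ (BPt a b ℚ)) : EPt E ℚ = E := by
  have h : BPt.ofRat a b ℚ '' (E : Set (BPt a b ℚ)) = E := by
    ext x
    simp [ofRat_rat]
  exact (congrArg (Algebra.adjoin ℚ) h).trans (Algebra.adjoin_eq E)

theorem ofRat_mem_EPt {E : Subalgebra ℚ (BPt a b ℚ)} {x : BPt a b ℚ} (hx : x ∈ E) :
    BPt.ofRat a b R x ∈ EPt E R :=
  Algebra.subset_adjoin ⟨x, hx, rfl⟩

theorem map_mem_EPt {E : Subalgebra ℚ (BPt a b ℚ)} (f : R →ₐ[ℚ] S) {x : BPt a b R}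
    (hx : x ∈ EPt E R) : BPt.map a b f x ∈ EPt E S := by
  induction hx using Algebra.adjoin_induction with
  | mem x hx =>
    obtain ⟨e, he, rfl⟩ := hx
    rw [map_ofRat]
    exact ofRat_mem_EPt he
  | algebraMap r =>
    rw [map_algebraMap]
    exact (EPt E S).algebraMap_mem _
  | add x y _ _ hx hy => rw [map_add]; exact add_mem hx hy
  | mul x y _ _ hx hy => rw [map_mul]; exact mul_mem hx hy

theorem EPt_mul_comm {E : Subalgebra ℚ (BPt a b ℚ)} (hE : ∀ x ∈ E, ∀ y ∈ E, x * y = y * x)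
    {x y : BPt a b R} (hx : x ∈ EPt E R) (hy : y ∈ EPt E R) : x * y = y * x := by
  induction hx, hy using Algebra.adjoin_induction₂ with
  | mem_mem x y hx hy =>
    obtain ⟨e, he, rfl⟩ := hx
    obtain ⟨f, hf, rfl⟩ := hy
    rw [← map_mul, ← map_mul, hE e he f hf]
  | algebraMap_both r s => exact Algebra.commutes _ _
  | algebraMap_left r x _ => exact Algebra.commutes _ _
  | algebraMap_right r x _ => exact (Algebra.commutes _ _).symm
  | add_left x y z _ _ _ h1 h2 => rw [add_mul, mul_add, h1, h2]
  | add_right x y z _ _ _ h1 h2 => rw [add_mul, mul_add, h1, h2]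
  | mul_left x y z _ _ _ h1 h2 => rw [mul_assoc, h2, ← mul_assoc, h1, mul_assoc]
  | mul_right x y z _ _ _ h1 h2 => rw [← mul_assoc, h1, mul_assoc, h2, mul_assoc]

theorem mem_torusTilde {E : Subalgebra ℚ (BPt a b ℚ)} {u : (BPt a b R)ˣ} :
    u ∈ torusTilde E R ↔ u.val ∈ EPt E R ∧ u⁻¹.val ∈ EPt E R := by
  constructor
  · rintro ⟨v, rfl⟩
    exact ⟨v.val.2, v⁻¹.val.2⟩
  · rintro ⟨h1, h2⟩
    exact ⟨⟨⟨u.val, h1⟩, ⟨u⁻¹.val, h2⟩, Subtype.ext u.mul_inv, Subtype.ext u.inv_mul⟩,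
      Units.ext rfl⟩

theorem map_mem_torusTilde {E : Subalgebra ℚ (BPt a b ℚ)} (f : R →ₐ[ℚ] S) {u : (BPt a b R)ˣ}
    (hu : u ∈ torusTilde E R) :
    Units.map (BPt.map a b f : BPt a b R →* BPt a b S) u ∈ torusTilde E S := by
  rw [mem_torusTilde] at hu ⊢
  exact ⟨map_mem_EPt f hu.1, map_mem_EPt f hu.2⟩

theorem map_mem_torus {E : Subalgebra ℚ (BPt a b ℚ)} (f : R →ₐ[ℚ] S) {t : GPt a b R}
    (ht : t ∈ torus E R) : GPt.map a b f t ∈ torus E S := by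
  obtain ⟨u, hu, rfl⟩ := ht
  exact ⟨_, map_mem_torusTilde f hu, rfl⟩

theorem mem_torus_mul_comm {E : Subalgebra ℚ (BPt a b ℚ)} (hE : ∀ x ∈ E, ∀ y ∈ E, x * y = y * x)
    {s t : GPt a b R} (hs : s ∈ torus E R) (ht : t ∈ torus E R) : s * t = t * s := by
  obtain ⟨u, hu, rfl⟩ := hs
  obtain ⟨v, hv, rfl⟩ := ht
  rw [← map_mul, ← map_mul]
  congr 1
  ext1
  exact EPt_mul_comm hE (mem_torusTilde.1 hu).1 (mem_torusTilde.1 hv).1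

theorem map_scalarUnit (f : R →ₐ[ℚ] S) (r : Rˣ) :
    Units.map (BPt.map a b f : BPt a b R →* BPt a b S) (scalarUnit a b r)
      = scalarUnit a b (Units.map (f : R →* S) r) := by
  ext1
  exact map_algebraMap f r.val

end Tori

namespace ToralDatum

variable {a b : ℚ} (D : ToralDatum a b)

theorem E_mul_comm : ∀ x ∈ D.E, ∀ y ∈ D.E, x * y = y * x := fun x hx y hy =>
  congrArg Subtype.val (D.isField.mul_comm ⟨x, hx⟩ ⟨y, hy⟩)

theorem s_mem_torus : D.s ∈ torus D.E Adele := ⟨D.sRep, D.sRep_mem, rfl⟩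

theorem diag_mem_torus {t : GPt a b ℚ} (ht : t ∈ torus D.E ℚ) :
    GPt.diag a b t ∈ torus D.E Adele := map_mem_torus _ ht

/-- Both $t$ and $s$ have real component in $\mathbf T(\mathbb R)$, and conjugation by $g_\infty$
carries that group to $K_\infty$. -/
theorem map_toReal_mem_of_mem_twistOrbit {K : Subgroup (GPt a b ℝ)} (hD : D.HasRealTorus K)
    {η : GPt a b Adele} (hη : η ∈ D.twistOrbit) : GPt.map a b toReal η ∈ K := by
  obtain ⟨t, ht, rfl⟩ := hη
  rw [← SetLike.mem_coe, ← hD]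
  refine ⟨GPt.map a b toReal (GPt.diag a b t * D.s),
    map_mem_torus _ (mul_mem (D.diag_mem_torus ht) D.s_mem_torus), ?_⟩
  simp only [map_mul, map_inv, mul_assoc]

end ToralDatum

/-! ### Reduction of the compactness condition to the finite places -/

section CompactTorus

variable {a b : ℚ}

theorem continuous_algHom_complex (ι : ℂ →ₐ[ℝ] BPt a b ℝ) : Continuous ι := by
  have h : ∀ f : BPt a b ℝ →ₗ[ℝ] ℝ, Continuous fun z => f (ι z) := fun f =>
    (f ∘ₗ ι.toLinearMap).continuous_of_finiteDimensional
  refine continuous_BPt_iff.2 ⟨?_, ?_, ?_, ?_⟩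
  · exact h ⟨⟨fun x => x.re, fun _ _ => rfl⟩, fun _ _ => rfl⟩
  · exact h ⟨⟨fun x => x.imI, fun _ _ => rfl⟩, fun _ _ => rfl⟩
  · exact h ⟨⟨fun x => x.imJ, fun _ _ => rfl⟩, fun _ _ => rfl⟩
  · exact h ⟨⟨fun x => x.imK, fun _ _ => rfl⟩, fun _ _ => rfl⟩

variable {O : Subring (BPt a b ℚ)} {K : Subgroup (GPt a b ℝ)}

/-- A box leaves the real component free. Membership in $K_\infty$ supplies the missing bound,
because modulo real scalars $K_\infty$ is the image of the unit circle. -/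
theorem IsZOrder.exists_isCompact_adelicBox (hO : IsZOrder O) (hK : IsMaxCompactTorus K)
    {N : ℕ} (hN : 0 < N) :
    ∃ Q : Set (GPt a b Adele), IsCompact Q ∧
      ∀ η ∈ adelicBox O N, GPt.map a b toReal η ∈ K → η ∈ Q := by
  obtain ⟨ι, rfl⟩ := hK
  have hC : IsCompact (ι '' Metric.sphere (0 : ℂ) 1) :=
    (isCompact_sphere _ _).image (continuous_algHom_complex ι)
  obtain ⟨Q, hQ, h⟩ := hO.exists_isCompact_box hC hN
  refine ⟨Q, hQ, ?_⟩
  rintro _ ⟨x, rfl, hx⟩ ⟨_, ⟨z, rfl⟩, hz⟩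
  obtain ⟨r, hr⟩ := (mk_eq_mk_iff (Units.map (ι : ℂ →* BPt a b ℝ) z) (realUnit a b x)).1 hz
  have hz0 : z.val ≠ 0 := z.ne_zero
  have hzn : ‖z.val‖ ≠ 0 := norm_ne_zero_iff.2 hz0
  -- The scalar adele is trivial at all primes and normalises the real component to the image of the
  -- unit complex number $z/|z|$.
  obtain ⟨α, hα, hαp⟩ := exists_adele_unit (r.val * ‖z.val‖)⁻¹ (by simp [hzn]) (fun _ => 1)
    (fun _ => one_ne_zero) (by simp)
  have hx' : ∀ p, locUnit a b p (scalarUnit a b α * x) = locUnit a b p x := by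
    intro p
    have : Units.map (toPadic p : Adele →* ℚ_[(p : ℕ)]) α = 1 := Units.ext (hαp p)
    rw [map_mul, locUnit, map_scalarUnit, this, map_one, one_mul]
  have hw : (realUnit a b (scalarUnit a b α * x)).val = ι (z.val / ‖z.val‖) := by
    rw [map_mul, hr, realUnit, map_scalarUnit, ← mul_assoc, ← map_mul, scalarUnit_mul_val]
    have h1 : z.val / ‖z.val‖ = (‖z.val‖⁻¹ : ℝ) • z.val := by
      rw [Complex.real_smul, Complex.ofReal_inv, div_eq_inv_mul]
    rw [h1, map_smul]
    congr 1
    change toReal α.val * r.val = _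
    rw [hα]
    field_simp
  have hw1 : z.val / ‖z.val‖ * (z.val / ‖z.val‖)⁻¹ = 1 := by
    rw [mul_inv_cancel₀]
    simp [hz0]
  have hw' : (realUnit a b (scalarUnit a b α * x))⁻¹.val = ι (z.val / ‖z.val‖)⁻¹ := by
    refine Units.inv_eq_of_mul_eq_one_right ?_
    rw [hw, ← map_mul, hw1, map_one]
  rw [← mk_scalarUnit_mul α x]
  refine h _ ?_ ?_ fun p => ?_
  · rw [hw]
    exact ⟨_, by simp [hz0], rfl⟩
  · rw [hw']
    exact ⟨_, by simp [hz0], rfl⟩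
  · rw [hx']
    exact hx p

theorem IsZOrder.forall_isCompact_iff (hO : IsZOrder O) (hK : IsMaxCompactTorus K)
    {D : ℕ → ToralDatum a b} (hD : ∀ i, (D i).HasRealTorus K) :
    (∀ B : Set (GPt a b Adele), IsCompact B → ∃ N : ℕ, ∀ i > N, (D i).twistOrbit ∩ B = ∅) ↔
      ∀ M : ℕ, 0 < M → ∀ᶠ i in Filter.atTop, (D i).twistOrbit ∩ adelicBox O M = ∅ := by
  constructor
  · intro h M hM
    obtain ⟨Q, hQ, hQ'⟩ := hO.exists_isCompact_adelicBox hK hM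
    obtain ⟨N, hN⟩ := h Q hQ
    filter_upwards [Filter.eventually_gt_atTop N] with i hi
    rw [Set.eq_empty_iff_forall_notMem]
    rintro η ⟨h1, h2⟩
    have h3 : η ∈ (D i).twistOrbit ∩ Q :=
      ⟨h1, hQ' η h2 ((D i).map_toReal_mem_of_mem_twistOrbit (hD i) h1)⟩
    rw [hN i hi] at h3
    exact h3
  · intro h B hB
    obtain ⟨M, hM, hBM⟩ := hO.exists_subset_adelicBox hB
    obtain ⟨N, hN⟩ := Filter.eventually_atTop.1 (h M hM)
    exact ⟨N, fun i hi => Set.subset_eq_empty (Set.inter_subset_inter_right _ hBM) (hN i hi.le)⟩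

end CompactTorus

/-! ### Measures of intersections of conjugates in unimodular groups -/

section Overlap

open MeasureTheory MeasureTheory.Measure

variable {G : Type} [TopologicalSpace G] [Group G] [IsTopologicalGroup G]

/-- The measure of `Ω ∩ η Ω η⁻¹`. -/
def overlap [MeasurableSpace G] (μ : Measure G) (Ω : Set G) (η : G) : ENNReal := μ {x | x ∈ Ω ∧ η⁻¹ * x * η ∈ Ω}

/-- For $\eta$ in the compact set $B$ the tube lemma gives one neighbourhood $V$ of the identity
with $\eta^{-1}V\eta$ inside the interior of $\Omega$; the measure of
$V\cap\operatorname{int}\Omega$ is then a lower bound. -/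
theorem exists_pos_le_overlap [MeasurableSpace G] (μ : Measure G) [μ.IsHaarMeasure]
    {Ω : Set G} (hΩ1 : Ω ∈ 𝓝 1) {B : Set G} (hB : IsCompact B) :
    ∃ c : ENNReal, 0 < c ∧ ∀ η ∈ B, c ≤ overlap μ Ω η := by
  have hcont : Continuous fun t : G × G => t.1⁻¹ * t.2 * t.1 := by fun_prop
  have hopen := (isOpen_interior (s := Ω)).preimage hcont
  obtain ⟨U, V, -, hV, hU', hV', hUV⟩ := generalized_tube_lemma hB (isCompact_singleton (x := (1 : G)))
    hopen (by
      rintro ⟨η, u⟩ ⟨-, hu⟩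
      obtain rfl : u = 1 := hu
      simpa using mem_interior_iff_mem_nhds.2 hΩ1)
  have hpos : 0 < μ (V ∩ interior Ω) :=
    (hV.inter isOpen_interior).measure_pos μ
      ⟨1, hV' rfl, mem_interior_iff_mem_nhds.2 hΩ1⟩
  refine ⟨_, hpos, fun η hη => measure_mono ?_⟩
  rintro x ⟨hx, hx'⟩
  refine ⟨interior_subset hx', ?_⟩
  have : (η, x) ∈ U ×ˢ V := ⟨hU' hη, hx⟩
  exact interior_subset (hUV this)

variable [LocallyCompactSpace G]

theorem modularCharacterFun_eq_one_of_mul_self {u : G} (hu : u * u = 1) :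
    modularCharacterFun u = 1 := by
  have h := modularCharacterFun_map_mul u u
  rw [hu, modularCharacterFun_map_one] at h
  have h2 : modularCharacterFun u ^ 2 = 1 := by rw [sq, ← h]
  exact (pow_eq_one_iff_of_nonneg zero_le two_ne_zero).1 h2

variable [MeasurableSpace G] [BorelSpace G] (μ : Measure G) [μ.IsHaarMeasure]

/-- Invariance is stated for sets of compact closure: `μ` is not assumed regular, and on such sets
uniqueness of Haar measure holds without regularity. -/
theorem measure_image_mul_right (hG : ∀ g : G, modularCharacterFun g = 1) (g : G) {s : Set G}
    (hs : IsCompact (closure s)) : μ ((· * g) '' s) = μ s := by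
  have hfin : IsFiniteMeasureOnCompacts (μ.map (· * g⁻¹)) := ⟨fun K hK => by
    rw [show (fun x => x * g⁻¹) = MeasurableEquiv.mulRight g⁻¹ from rfl, MeasurableEquiv.map_apply]
    exact ((Homeomorph.mulRight g⁻¹).isCompact_preimage.2 hK).measure_lt_top⟩
  have h1 := measure_isMulInvariant_eq_smul_of_isCompact_closure (μ.map (· * g⁻¹)) μ hs
  rw [← modularCharacterFun_eq_haarScalarFactor, hG, one_smul] at h1
  rw [← h1, show (fun x => x * g⁻¹) = MeasurableEquiv.mulRight g⁻¹ from rfl,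
    MeasurableEquiv.map_apply]
  congr 1
  ext x
  simp

/-- The substitution $h=xkx^{-1}$ is a left and a right translation, both of which preserve the
measure here. -/
theorem measure_conj_inter (hG : ∀ g : G, modularCharacterFun g = 1) {Ω : Set G}
    (hΩ : IsCompact Ω) (x y : G) :
    μ {h | x⁻¹ * h * x ∈ Ω ∧ y⁻¹ * h * y ∈ Ω} = overlap μ Ω (x⁻¹ * y) := by
  have hs : IsCompact (closure {k | k ∈ Ω ∧ (x⁻¹ * y)⁻¹ * k * (x⁻¹ * y) ∈ Ω}) :=
    hΩ.closure_of_subset fun k hk => hk.1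
  rw [overlap, ← measure_image_mul_right μ hG x⁻¹ hs, ← measure_preimage_mul μ x⁻¹ ((· * x⁻¹) '' _)]
  congr 1
  ext h
  simp only [Set.mem_ofPred_eq, Set.mem_preimage, Set.mem_image]
  constructor
  · rintro ⟨h1, h2⟩
    refine ⟨x⁻¹ * h * x, ⟨h1, ?_⟩, by group⟩
    convert h2 using 1
    group
  · rintro ⟨k, ⟨h1, h2⟩, h3⟩
    have hk : k = x⁻¹ * h * x := by rw [← h3]; group
    rw [hk] at h1 h2
    refine ⟨h1, ?_⟩
    convert h2 using 1
    group

/-- Packing. Cover $\Omega$ by finitely many cosets $kW$ and let $A_k$ be the part of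
$\overline\Omega$ that $\eta^{-1}$ conjugates into $kW$. If no $\eta^{-1}v_iv_j^{-1}\eta$ with $i\ne
j$ lies in $W$, the translates $A_kv_i$ are disjoint for fixed $k$ and lie in $\overline\Omega V$,
so each $A_k$ has measure at most $\mu(\overline\Omega V)/(r+1)$. For large $r$ this contradicts the
lower bound $\varepsilon$, and $r$ does not depend on $\eta$. -/
theorem exists_conj_mem_of_le_overlap (hG : ∀ g : G, modularCharacterFun g = 1) {Ω V : Set G}
    (hΩ : IsCompact Ω) (hV : IsCompact V) (W : Subgroup G) (hW : IsOpen (W : Set G))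
    {ε : ENNReal} (hε : 0 < ε) :
    ∃ r : ℕ, ∀ η : G, ε ≤ overlap μ Ω η → ∀ v : Fin (r + 1) → G, (∀ i, v i ∈ V) →
      ∃ i j, i ≠ j ∧ η⁻¹ * (v i * (v j)⁻¹) * η ∈ W := by
  obtain ⟨F, hF⟩ := hΩ.closure.elim_finite_subcover (fun k : G => (k⁻¹ * ·) ⁻¹' (W : Set G))
    (fun k => hW.preimage (continuous_const_mul _)) (fun x _ => Set.mem_iUnion.2 ⟨x, by simp⟩)
  have hfin : (F.card : ENNReal) * μ (closure Ω * V) ≠ ⊤ :=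
    ENNReal.mul_ne_top (by simp) (hΩ.closure.mul hV).measure_lt_top.ne
  obtain ⟨r, hr⟩ := ENNReal.exists_nat_mul_gt hε.ne' hfin
  refine ⟨r, fun η hη v hv => ?_⟩
  by_contra! hne
  -- The closure of `Ω` replaces `Ω` because a compact set need be neither closed nor measurable
  -- here.
  have hA : ∀ k : G, MeasurableSet {x | x ∈ closure Ω ∧ k⁻¹ * (η⁻¹ * x * η) ∈ W} := fun k => by
    have hc : Continuous fun x : G => k⁻¹ * (η⁻¹ * x * η) := by fun_prop
    exact isClosed_closure.measurableSet.inter (hW.preimage hc).measurableSet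
  have hbound : ∀ k : G, ((r + 1 : ℕ) : ENNReal) *
      μ {x | x ∈ closure Ω ∧ k⁻¹ * (η⁻¹ * x * η) ∈ W} ≤ μ (closure Ω * V) := by
    intro k
    set A := {x | x ∈ closure Ω ∧ k⁻¹ * (η⁻¹ * x * η) ∈ W} with hAdef
    have hAc : IsCompact (closure A) := hΩ.closure.closure_of_subset fun x hx => hx.1
    have hdisj : (↑(Finset.univ : Finset (Fin (r + 1))) : Set (Fin (r + 1))).PairwiseDisjoint
        fun i => (· * v i) '' A := by
      intro i _ j _ hij
      rw [Function.onFun, Set.disjoint_left]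
      rintro _ ⟨x, ⟨hx, hx'⟩, rfl⟩ ⟨y, ⟨hy, hy'⟩, hxy⟩
      refine hne j i hij.symm ?_
      -- If $xv_i=yv_j$, then $\eta^{-1}v_jv_i^{-1}\eta=(\eta^{-1}y\eta)^{-1}(\eta^{-1}x\eta)$, a
      -- quotient of two elements of the same coset $kW$, hence in $W$.
      have h1 := W.mul_mem (W.inv_mem hy') hx'
      have h2 : x = y * v j * (v i)⁻¹ := by
        change y * v j = x * v i at hxy
        rw [hxy]; group
      rw [h2] at h1
      convert h1 using 1
      group
    have hmeas : ∀ i ∈ (Finset.univ : Finset (Fin (r + 1))),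
        MeasurableSet ((· * v i) '' A) := fun i _ =>
      ((Homeomorph.mulRight (v i)).measurableEmbedding.measurableSet_image).2 (hA k)
    have h1 := measure_biUnion_finset (μ := μ) hdisj hmeas
    have h2 : ∀ i : Fin (r + 1), μ ((· * v i) '' A) = μ A := fun i =>
      measure_image_mul_right μ hG (v i) hAc
    simp only [h2, Finset.sum_const, Finset.card_univ, Fintype.card_fin, nsmul_eq_mul] at h1
    rw [← h1]
    refine measure_mono ?_
    simp only [Set.iUnion_subset_iff]
    rintro i - _ ⟨x, hx, rfl⟩
    exact Set.mul_mem_mul hx.1 (hv i)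
  have hcover : overlap μ Ω η ≤ ∑ k ∈ F, μ {x | x ∈ closure Ω ∧ k⁻¹ * (η⁻¹ * x * η) ∈ W} := by
    refine (measure_mono ?_).trans (measure_biUnion_finset_le F _)
    rintro x ⟨hx, hx'⟩
    have := hF (subset_closure hx')
    simp only [Set.mem_iUnion] at this ⊢
    obtain ⟨k, hk, hk'⟩ := this
    exact ⟨k, hk, subset_closure hx, hk'⟩
  have h3 : ((r + 1 : ℕ) : ENNReal) * ε ≤ F.card * μ (closure Ω * V) := by
    calc ((r + 1 : ℕ) : ENNReal) * ε
        ≤ (r + 1 : ℕ) * ∑ k ∈ F, μ {x | x ∈ closure Ω ∧ k⁻¹ * (η⁻¹ * x * η) ∈ W} := by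
          gcongr
          exact hη.trans hcover
      _ = ∑ k ∈ F, (r + 1 : ℕ) * μ {x | x ∈ closure Ω ∧ k⁻¹ * (η⁻¹ * x * η) ∈ W} :=
          Finset.mul_sum _ _ _
      _ ≤ ∑ k ∈ F, μ (closure Ω * V) := Finset.sum_le_sum fun k _ => hbound k
      _ = F.card * μ (closure Ω * V) := by rw [Finset.sum_const, nsmul_eq_mul]
  have h4 : (r : ENNReal) * ε ≤ ((r + 1 : ℕ) : ENNReal) * ε := by
    gcongr
    exact Nat.le_succ r
  exact absurd (hr.trans_le (h4.trans h3)) (lt_irrefl _)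

end Overlap

/-! ### Unimodularity of the adelic group -/

section Unimodular

variable {a b : ℚ}

theorem re_mul_of_re_eq_zero {R : Type} [CommRing R] [Algebra ℚ R] {u : BPt a b R} (hu : u.re = 0)
    (x : BPt a b R) : (u * x).re = algebraMap ℚ R a * u.imI * x.imI
      + algebraMap ℚ R b * u.imJ * x.imJ
      - algebraMap ℚ R a * algebraMap ℚ R b * u.imK * x.imK := by
  simp [hu]

/-- The condition on `u` is orthogonality to the imaginary part of `x`. The three cross products of
that vector with the basis satisfy it; if all had reduced norm zero, a combination of the norms
would give `x.imI = 0`, and then $u=i$ works. -/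
theorem exists_pure_mul_pure (ha : a ≠ 0) (hb : b ≠ 0) {F : Type} [Field F] [Algebra ℚ F]
    (x : BPt a b F) : ∃ u : BPt a b F, u.re = 0 ∧ (u * x).re = 0 ∧ nrd u ≠ 0 := by
  have ha' : algebraMap ℚ F a ≠ 0 := (map_ne_zero _).2 ha
  have hb' : algebraMap ℚ F b ≠ 0 := (map_ne_zero _).2 hb
  have h2 : (2 : F) ≠ 0 := by
    have := (map_ne_zero (algebraMap ℚ F)).2 (two_ne_zero (α := ℚ))
    simpa using this
  by_contra! h
  have h0 := h ⟨0, 1, 0, 0⟩ rfl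
  have h1 := h ⟨0, algebraMap ℚ F b * x.imJ, - (algebraMap ℚ F a * x.imI), 0⟩ rfl
    (by simp; ring)
  have h3 := h ⟨0, algebraMap ℚ F b * x.imK, 0, x.imI⟩ rfl (by simp; ring)
  have h4 := h ⟨0, 0, algebraMap ℚ F a * x.imK, x.imJ⟩ rfl (by simp; ring)
  simp only [nrd] at h0 h1 h3 h4
  have hx : x.imI = 0 := by
    have : (2 * algebraMap ℚ F a ^ 2 * algebraMap ℚ F b) * x.imI ^ 2 = 0 := by
      linear_combination -h1 + algebraMap ℚ F a * h3 - algebraMap ℚ F b * h4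
    exact (pow_eq_zero_iff two_ne_zero).1 ((mul_eq_zero.1 this).resolve_left
      (mul_ne_zero (mul_ne_zero h2 (pow_ne_zero 2 ha')) hb'))
  refine ha' ?_
  have := h0 (by rw [re_mul_of_re_eq_zero rfl]; simp [hx])
  simpa using this

/-- At all but finitely many primes the choice can be made integral with unit norm, as is needed to
assemble the local choices into an adelic unit. After scaling the imaginary part of `x` to a
primitive vector $y$, the same cross products are integral; if all their norms were non-units,
combinations of them would put every coordinate of $y$ in the maximal ideal. -/
theorem exists_integral_pure_mul_pure {p : Nat.Primes} (h2 : ‖(2 : ℚ_[(p : ℕ)])‖ = 1)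
    (ha : ‖(a : ℚ_[(p : ℕ)])‖ = 1) (hb : ‖(b : ℚ_[(p : ℕ)])‖ = 1) (x : BPt a b ℚ_[(p : ℕ)]) :
    ∃ u : BPt a b ℚ_[(p : ℕ)], u.re = 0 ∧ (u * x).re = 0 ∧ coordNorm u ≤ 1 ∧ ‖nrd u‖ = 1 := by
  by_cases hx : x.im = 0
  · refine ⟨⟨0, 1, 0, 0⟩, rfl, ?_, ?_, ?_⟩
    · have : x.imI = 0 := congrArg QuaternionAlgebra.imI hx
      rw [re_mul_of_re_eq_zero rfl]
      simp [this]
    · simp [coordNorm]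
    · simp [nrd, ha]
  obtain ⟨c, hc, hcx⟩ : ∃ c : ℚ_[(p : ℕ)], ‖c‖ = coordNorm x.im ∧ c ≠ 0 := by
    have hpos := coordNorm_pos hx
    rcases exists_coord_eq_coordNorm x.im with h | h | h | h <;>
      exact ⟨_, h, norm_pos_iff.1 (h ▸ hpos)⟩
  obtain ⟨y, hy⟩ : ∃ y : BPt a b ℚ_[(p : ℕ)], y = c⁻¹ • x.im := ⟨_, rfl⟩
  have hy1 : coordNorm y = 1 := by
    rw [hy, coordNorm_smul, norm_inv, hc, inv_mul_cancel₀ (coordNorm_pos hx).ne']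
  have hxy : ∀ u : BPt a b ℚ_[(p : ℕ)], u.re = 0 → (u * y).re = 0 → (u * x).re = 0 := by
    intro u hu h
    rw [re_mul_of_re_eq_zero hu] at h ⊢
    rw [hy] at h
    simp only [QuaternionAlgebra.imI_smul, QuaternionAlgebra.imJ_smul, QuaternionAlgebra.imK_smul,
      QuaternionAlgebra.imI_im, QuaternionAlgebra.imJ_im, QuaternionAlgebra.imK_im,
      smul_eq_mul] at h
    have : c * (c⁻¹ * (algebraMap ℚ ℚ_[(p : ℕ)] a * u.imI * x.imI
      + algebraMap ℚ ℚ_[(p : ℕ)] b * u.imJ * x.imJ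
      - algebraMap ℚ ℚ_[(p : ℕ)] a * algebraMap ℚ ℚ_[(p : ℕ)] b * u.imK * x.imK)) = 0 := by
      linear_combination c * h
    rwa [mul_inv_cancel_left₀ hcx] at this
  have hyre : y.re = 0 := by simp [hy]
  obtain ⟨-, i1, i2, i3⟩ := coordNorm_le_iff.1 hy1.le
  have ha' : ‖algebraMap ℚ ℚ_[(p : ℕ)] a‖ = 1 := by rwa [eq_ratCast]
  have hb' : ‖algebraMap ℚ ℚ_[(p : ℕ)] b‖ = 1 := by rwa [eq_ratCast]
  by_contra! h
  have h1 := h ⟨0, algebraMap ℚ ℚ_[(p : ℕ)] b * y.imJ, - (algebraMap ℚ ℚ_[(p : ℕ)] a * y.imI), 0⟩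
    rfl (hxy _ rfl (by simp; ring))
    (by rw [coordNorm_le_iff]; simp only [norm_zero, norm_neg, norm_mul, ha', hb']; simp [i1, i2])
  have h3 := h ⟨0, algebraMap ℚ ℚ_[(p : ℕ)] b * y.imK, 0, y.imI⟩
    rfl (hxy _ rfl (by simp; ring))
    (by rw [coordNorm_le_iff]; simp only [norm_zero, norm_mul, hb']; simp [i1, i3])
  have h4 := h ⟨0, 0, algebraMap ℚ ℚ_[(p : ℕ)] a * y.imK, y.imJ⟩
    rfl (hxy _ rfl (by simp; ring))
    (by rw [coordNorm_le_iff]; simp only [norm_zero, norm_mul, ha']; simp [i2, i3])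
  simp only [nrd] at h1 h3 h4
  have toInt : ∀ z : ℚ_[(p : ℕ)], ‖z‖ ≤ 1 → ∃ w : ℤ_[(p : ℕ)], (w : ℚ_[(p : ℕ)]) = z :=
    fun z hz => ⟨⟨z, hz⟩, rfl⟩
  obtain ⟨A, hA⟩ := toInt _ ha'.le
  obtain ⟨B, hB⟩ := toInt _ hb'.le
  obtain ⟨Y1, hY1⟩ := toInt _ i1
  obtain ⟨Y2, hY2⟩ := toInt _ i2
  obtain ⟨Y3, hY3⟩ := toInt _ i3
  rw [← hY2, ← hY1, ← hA, ← hB] at h1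
  rw [← hY3, ← hY1, ← hA, ← hB] at h3
  rw [← hY2, ← hY3, ← hA, ← hB] at h4
  have unit_iff : ∀ z : ℤ_[(p : ℕ)], ‖(z : ℚ_[(p : ℕ)])‖ ≠ 1 → z ∈ IsLocalRing.maximalIdeal ℤ_[(p : ℕ)] := by
    intro z hz
    rw [IsLocalRing.mem_maximalIdeal, mem_nonunits_iff, PadicInt.isUnit_iff]
    exact hz
  have m1 := unit_iff (0 ^ 2 - A * (B * Y2) ^ 2 - B * (-(A * Y1)) ^ 2 + A * B * 0 ^ 2) (by push_cast; exact h1)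
  have m3 := unit_iff (0 ^ 2 - A * (B * Y3) ^ 2 - B * 0 ^ 2 + A * B * Y1 ^ 2) (by push_cast; exact h3)
  have m4 := unit_iff (0 ^ 2 - A * 0 ^ 2 - B * (A * Y3) ^ 2 + A * B * Y2 ^ 2) (by push_cast; exact h4)
  have uA : IsUnit A := PadicInt.isUnit_iff.2 (by rw [PadicInt.norm_def, hA, ha'])
  have uB : IsUnit B := PadicInt.isUnit_iff.2 (by rw [PadicInt.norm_def, hB, hb'])
  have u2 : IsUnit (2 : ℤ_[(p : ℕ)]) := PadicInt.isUnit_iff.2 (by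
    rw [PadicInt.norm_def]; exact h2)
  have hprime : (IsLocalRing.maximalIdeal ℤ_[(p : ℕ)]).IsPrime := inferInstance
  have key : ∀ u Z : ℤ_[(p : ℕ)], IsUnit u → u * Z ^ 2 ∈ IsLocalRing.maximalIdeal ℤ_[(p : ℕ)] →
      ‖(Z : ℚ_[(p : ℕ)])‖ < 1 := by
    intro u Z hu hZ
    have h5 := (hprime.mem_or_mem hZ).resolve_left fun h => by
      rw [IsLocalRing.mem_maximalIdeal] at h
      exact h hu
    have h6 := hprime.mem_of_pow_mem 2 h5
    rw [IsLocalRing.mem_maximalIdeal, mem_nonunits_iff, PadicInt.isUnit_iff] at h6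
    exact lt_of_le_of_ne Z.2 h6
  have k3 : ‖y.imK‖ < 1 := by
    rw [← hY3]
    refine key (-(2 * A ^ 2 * B ^ 2)) Y3 ((u2.mul (uA.pow 2)).mul (uB.pow 2)).neg ?_
    convert add_mem (add_mem m1 (Ideal.mul_mem_left _ A m3)) (Ideal.mul_mem_left _ B m4) using 1
    ring
  have k1 : ‖y.imI‖ < 1 := by
    rw [← hY1]
    refine key (-(2 * A ^ 2 * B)) Y1 ((u2.mul (uA.pow 2)).mul uB).neg ?_
    convert add_mem (sub_mem m1 (Ideal.mul_mem_left _ A m3)) (Ideal.mul_mem_left _ B m4) using 1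
    ring
  have k2 : ‖y.imJ‖ < 1 := by
    rw [← hY2]
    refine key (-(2 * A * B ^ 2)) Y2 ((u2.mul uA).mul (uB.pow 2)).neg ?_
    convert sub_mem (add_mem m1 (Ideal.mul_mem_left _ A m3)) (Ideal.mul_mem_left _ B m4) using 1
    ring
  have : coordNorm y < 1 := coordNorm_lt_iff.2 ⟨by rw [hyre]; simp, k1, k2, k3⟩
  exact this.ne hy1

theorem mk_mul_self_of_re_eq_zero {R : Type} [CommRing R] [Algebra ℚ R] (u : (BPt a b R)ˣ)
    (hu : u.val.re = 0) : (QuotientGroup.mk u : GPt a b R) * QuotientGroup.mk u = 1 := by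
  rw [← QuotientGroup.mk_mul, QuotientGroup.eq_one_iff]
  have h := nrd_inv_mul_nrd u
  refine ⟨⟨-nrd u.val, -nrd u⁻¹.val, ?_, ?_⟩, ?_⟩
  · linear_combination h
  · linear_combination h
  · ext1
    exact (mul_self_of_re_eq_zero u.val hu).symm

theorem coordNorm_star {F : Type} [NormedField F] [Algebra ℚ F] (x : BPt a b F) :
    coordNorm (star x) = coordNorm x := by
  simp [coordNorm]

theorem exists_unit_pure_mul_pure (ha : a ≠ 0) (hb : b ≠ 0) (x : (BPt a b Adele)ˣ) :
    ∃ u : (BPt a b Adele)ˣ, u.val.re = 0 ∧ (u * x).val.re = 0 := by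
  obtain ⟨ur, hur, hurx, hur0⟩ := exists_pure_mul_pure ha hb (realMap a b x.val)
  have hloc : ∀ p : Nat.Primes, ∃ u : BPt a b ℚ_[(p : ℕ)], u.re = 0 ∧
      (u * locMap a b p x.val).re = 0 ∧ nrd u ≠ 0 ∧
      (‖(2 : ℚ_[(p : ℕ)])‖ = 1 → ‖(a : ℚ_[(p : ℕ)])‖ = 1 → ‖(b : ℚ_[(p : ℕ)])‖ = 1 →
        coordNorm u ≤ 1 ∧ ‖nrd u‖ = 1) := by
    intro p
    by_cases h : ‖(2 : ℚ_[(p : ℕ)])‖ = 1 ∧ ‖(a : ℚ_[(p : ℕ)])‖ = 1 ∧ ‖(b : ℚ_[(p : ℕ)])‖ = 1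
    · obtain ⟨u, h1, h2, h3, h4⟩ := exists_integral_pure_mul_pure h.1 h.2.1 h.2.2 (locMap a b p x.val)
      exact ⟨u, h1, h2, norm_pos_iff.1 (by rw [h4]; exact one_pos), fun _ _ _ => ⟨h3, h4⟩⟩
    · obtain ⟨u, h1, h2, h3⟩ := exists_pure_mul_pure ha hb (locMap a b p x.val)
      exact ⟨u, h1, h2, h3, fun e1 e2 e3 => absurd ⟨e1, e2, e3⟩ h⟩
  choose uf huf hufx huf0 hint using hloc
  obtain ⟨u, hu, hup⟩ := exists_unit (unitOfNrd ur (Units.mk0 _ hur0) rfl)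
    (fun p => unitOfNrd (uf p) (Units.mk0 _ (huf0 p)) rfl) (by
      filter_upwards [eventually_norm_ratCast_eq_one 2 two_ne_zero,
        eventually_norm_ratCast_eq_one a ha, eventually_norm_ratCast_eq_one b hb] with p e1 e2 e3
      obtain ⟨h1, h2⟩ := hint p (by simpa using e1) e2 e3
      refine ⟨h1, ?_⟩
      change coordNorm ((Units.mk0 _ (huf0 p))⁻¹.val • star (uf p)) ≤ 1
      rw [coordNorm_smul, coordNorm_star, Units.val_inv_eq_inv_val,
        Units.val_mk0, norm_inv, h2, inv_one, one_mul]
      exact h1)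
  have hu' : realMap a b u.val = ur := congrArg Units.val hu
  have hup' : ∀ p, locMap a b p u.val = uf p := fun p => congrArg Units.val (hup p)
  refine ⟨u, adele_ext ?_ fun p => ?_, adele_ext ?_ fun p => ?_⟩
  · rw [map_zero, ← hur, ← hu']; rfl
  · rw [map_zero, ← huf p, ← hup' p]; rfl
  · rw [map_zero, ← hurx, ← hu', ← map_mul]; rfl
  · rw [map_zero, ← hufx p, ← hup' p, ← map_mul]; rfl

/-- A pure quaternion squares to a scalar. With $u$ and $ux$ both pure, the class of $x=u^{-1}(ux)$
is a product of two elements of square one, on which a positive character is trivial. -/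
theorem modularCharacterFun_eq_one (ha : a ≠ 0) (hb : b ≠ 0) [LocallyCompactSpace (GPt a b Adele)]
    (g : GPt a b Adele) : MeasureTheory.Measure.modularCharacterFun g = 1 := by
  obtain ⟨x, rfl⟩ := QuotientGroup.mk_surjective g
  obtain ⟨u, hu, hux⟩ := exists_unit_pure_mul_pure ha hb x
  have h1 := modularCharacterFun_eq_one_of_mul_self (mk_mul_self_of_re_eq_zero u hu)
  have h2 := modularCharacterFun_eq_one_of_mul_self (mk_mul_self_of_re_eq_zero (u * x) hux)
  rwa [QuotientGroup.mk_mul, MeasureTheory.Measure.modularCharacterFun_map_mul, h1, one_mul] at h2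

end Unimodular

/-! ### Hecke sets containing a joint toral set -/

section Centralizer

variable {a b : ℚ}

/-- Commuting means that the imaginary parts have vanishing cross product, so $\beta\in\mathbb
Q+\mathbb Q\theta$. -/
theorem mem_of_mul_comm (ha : a ≠ 0) (hb : b ≠ 0) {E : Subalgebra ℚ (BPt a b ℚ)} {θ β : BPt a b ℚ}
    (hθ : θ ∈ E) (hθ0 : θ.im ≠ 0) (h : θ * β = β * θ) : β ∈ E := by
  have hI := congrArg QuaternionAlgebra.imI h
  have hJ := congrArg QuaternionAlgebra.imJ h
  have hK := congrArg QuaternionAlgebra.imK h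
  simp only [QuaternionAlgebra.imI_mul, QuaternionAlgebra.imJ_mul, QuaternionAlgebra.imK_mul,
    Algebra.algebraMap_self, RingHom.id_apply] at hI hJ hK
  have h1 : θ.imJ * β.imK = θ.imK * β.imJ := by
    have : (2 * b) * (θ.imJ * β.imK - θ.imK * β.imJ) = 0 := by linear_combination -hI
    simpa [hb, sub_eq_zero] using this
  have h2 : θ.imI * β.imK = θ.imK * β.imI := by
    have : (2 * a) * (θ.imI * β.imK - θ.imK * β.imI) = 0 := by linear_combination hJ
    simpa [ha, sub_eq_zero] using this
  have h3 : θ.imI * β.imJ = θ.imJ * β.imI := by linarith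
  have key : ∀ c d : ℚ, d ≠ 0 → d * β.imI = c * θ.imI → d * β.imJ = c * θ.imJ →
      d * β.imK = c * θ.imK → β ∈ E := by
    intro c d hd e1 e2 e3
    have : β = algebraMap ℚ _ (β.re - c / d * θ.re) + (c / d) • θ := by
      ext
      · simp [QuaternionAlgebra.algebraMap_eq]
      · simp [QuaternionAlgebra.algebraMap_eq]; field_simp; linarith
      · simp [QuaternionAlgebra.algebraMap_eq]; field_simp; linarith
      · simp [QuaternionAlgebra.algebraMap_eq]; field_simp; linarith
    rw [this]
    exact add_mem (E.algebraMap_mem _) (E.smul_mem hθ _)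
  by_cases c1 : θ.imI = 0
  · by_cases c2 : θ.imJ = 0
    · by_cases c3 : θ.imK = 0
      · exact absurd (by ext <;> simp [c1, c2, c3]) hθ0
      · exact key β.imK θ.imK c3 (by linarith) (by linarith) (by ring)
    · exact key β.imJ θ.imJ c2 (by linarith) (by ring) (by linarith)
  · exact key β.imI θ.imI c1 (by ring) (by linarith) (by linarith)

/-- The factor equals a ratio of nonzero rational coordinates. -/
theorem exists_smul_eq_of_ofRat {R : Type} [CommRing R] [Nontrivial R] [Algebra ℚ R]
    {β γ : BPt a b ℚ} (hβ : β ≠ 0) {r : R}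
    (h : BPt.ofRat a b R β = r • BPt.ofRat a b R γ) : ∃ q : ℚ, q ≠ 0 ∧ β = q • γ := by
  have hinj : Function.Injective (algebraMap ℚ R) := (algebraMap ℚ R).injective
  have h1 : algebraMap ℚ R β.re = r * algebraMap ℚ R γ.re := congrArg QuaternionAlgebra.re h
  have h2 : algebraMap ℚ R β.imI = r * algebraMap ℚ R γ.imI := congrArg QuaternionAlgebra.imI h
  have h3 : algebraMap ℚ R β.imJ = r * algebraMap ℚ R γ.imJ := congrArg QuaternionAlgebra.imJ h
  have h4 : algebraMap ℚ R β.imK = r * algebraMap ℚ R γ.imK := congrArg QuaternionAlgebra.imK h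
  have key : ∀ x y : ℚ, x ≠ 0 → algebraMap ℚ R x = r * algebraMap ℚ R y →
      ∃ q : ℚ, q ≠ 0 ∧ β = q • γ := by
    intro x y hx hxy
    have hy : y ≠ 0 := by
      rintro rfl
      rw [map_zero, mul_zero, ← map_zero (algebraMap ℚ R)] at hxy
      exact hx (hinj hxy)
    have cross : ∀ z w : ℚ, algebraMap ℚ R z = r * algebraMap ℚ R w → z = x / y * w := by
      intro z w hzw
      have : z * y = x * w := hinj (by
        rw [map_mul, map_mul, hzw, hxy]; ring)
      field_simp
      exact this
    exact ⟨x / y, div_ne_zero hx hy, by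
      ext
      · exact cross _ _ h1
      · exact cross _ _ h2
      · exact cross _ _ h3
      · exact cross _ _ h4⟩
  by_contra hne
  have : ∀ x y : ℚ, algebraMap ℚ R x = r * algebraMap ℚ R y → x = 0 := fun x y hxy => by
    by_contra hx
    exact hne (key x y hx hxy)
  exact hβ (by ext <;> simp [this _ _ h1, this _ _ h2, this _ _ h3, this _ _ h4])

end Centralizer

namespace ToralDatum

variable {a b : ℚ} (D : ToralDatum a b)

theorem exists_im_ne_zero : ∃ θ ∈ D.E, θ.im ≠ 0 := by
  by_contra! h
  have : D.E = ⊥ := by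
    refine le_antisymm (fun x hx => ?_) bot_le
    refine Algebra.mem_bot.2 ⟨x.re, ?_⟩
    have := h x hx
    have h1 := congrArg QuaternionAlgebra.imI this
    have h2 := congrArg QuaternionAlgebra.imJ this
    have h3 := congrArg QuaternionAlgebra.imK this
    ext
    · rfl
    · exact h1.symm
    · exact h2.symm
    · exact h3.symm
  have h2 := D.finrank_eq_two
  rw [this, Subalgebra.finrank_bot] at h2
  omega

theorem exists_unit_of_mem {e : BPt a b ℚ} (he : e ∈ D.E) (he0 : e ≠ 0) :
    ∃ u : (BPt a b ℚ)ˣ, u.val = e ∧ u⁻¹.val ∈ D.E := by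
  obtain ⟨f, hf⟩ := D.isField.mul_inv_cancel (a := ⟨e, he⟩) (fun h => he0 (congrArg Subtype.val h))
  have hf' : e * f.val = 1 := congrArg Subtype.val hf
  exact ⟨⟨e, f, hf', by rw [D.E_mul_comm _ f.2 _ he, hf']⟩, rfl, f.2⟩

theorem mem_EPt_of_components {x : BPt a b Adele} {e : BPt a b ℚ} (he : e ∈ D.E)
    (hr : realMap a b x = BPt.ofRat a b ℝ e) (hp : ∀ p, locMap a b p x = 1) :
    x ∈ EPt D.E Adele := by
  -- The idempotents $(1,0)$ and $(0,1)$ of the adele ring separate the real place from the finite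
  -- places.
  have : x = ((1, 0) : Adele) • BPt.ofRat a b Adele e + algebraMap Adele _ ((0, 1) : Adele) := by
    refine BPt_ext ?_ fun p => ?_
    · rw [hr, map_add, map_smul', map_algebraMap, map_ofRat]
      have h1 : toReal ((1, 0) : Adele) = 1 := rfl
      have h2 : toReal ((0, 1) : Adele) = 0 := rfl
      rw [h1, h2, one_smul, map_zero, add_zero]
    · rw [hp, map_add, map_smul', map_algebraMap, map_ofRat]
      have h1 : toPadic p ((1, 0) : Adele) = 0 := rfl
      have h2 : toPadic p ((0, 1) : Adele) = 1 := rfl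
      rw [h1, h2, zero_smul, map_one, zero_add]
  rw [this]
  exact add_mem ((EPt D.E Adele).smul_mem (ofRat_mem_EPt he) _) ((EPt D.E Adele).algebraMap_mem _)

/-- Take $t$ equal to $e$ at the real place and to $1$ at all primes. The conjugate of $\beta$ by
$t$ is rational modulo scalars; a finite place shows that it is $\beta$ up to a rational factor, so
at the real place $e\beta=c\beta e$, and reduced norms give $c^2=1$. -/
theorem mul_eq_or_neg_of_conj {β : (BPt a b ℚ)ˣ}
    (h : ∀ t ∈ torus D.E Adele, ∃ γ, GPt.diag a b γ
      = t * GPt.diag a b (QuotientGroup.mk β) * t⁻¹) {e : BPt a b ℚ} (he : e ∈ D.E) (he0 : e ≠ 0) :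
    e * β.val = β.val * e ∨ e * β.val = -(β.val * e) := by
  obtain ⟨u, rfl, hu⟩ := D.exists_unit_of_mem he he0
  obtain ⟨t, ht, htp⟩ := exists_unit
    (Units.map (BPt.ofRat a b ℝ : BPt a b ℚ →* BPt a b ℝ) u) (fun _ => 1)
    (by simp [coordNorm])
  have ht1 : realMap a b t.val = BPt.ofRat a b ℝ u.val := congrArg Units.val ht
  have ht2 : realMap a b t⁻¹.val = BPt.ofRat a b ℝ u⁻¹.val :=
    congrArg (fun x : (BPt a b ℝ)ˣ => x⁻¹.val) ht
  have htp1 : ∀ p, locMap a b p t.val = 1 := fun p => congrArg Units.val (htp p)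
  have htp2 : ∀ p, locMap a b p t⁻¹.val = 1 := fun p => by
    have := congrArg (fun x : (BPt a b ℚ_[(p : ℕ)])ˣ => x⁻¹.val) (htp p)
    simpa using this
  obtain ⟨γ, hγ⟩ := h (QuotientGroup.mk t) ⟨t, mem_torusTilde.2
    ⟨D.mem_EPt_of_components he ht1 htp1, D.mem_EPt_of_components hu ht2 htp2⟩, rfl⟩
  obtain ⟨β', rfl⟩ := QuotientGroup.mk_surjective γ
  obtain ⟨r, hr⟩ := (mk_eq_mk_iff (Units.map (BPt.ofRat a b Adele : BPt a b ℚ →* BPt a b Adele) β')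
    (t * Units.map (BPt.ofRat a b Adele : BPt a b ℚ →* BPt a b Adele) β * t⁻¹)).1 hγ
  have hr' : t.val * BPt.ofRat a b Adele β.val
      = (r.val • BPt.ofRat a b Adele β'.val) * t.val := by
    have := congrArg Units.val (mul_inv_eq_iff_eq_mul.1 hr)
    rwa [Units.val_mul, Units.val_mul, scalarUnit_mul_val] at this
  -- Any single finite place will do.
  obtain ⟨p⟩ : Nonempty Nat.Primes := ⟨⟨2, Nat.prime_two⟩⟩
  have hfin := congrArg (locMap a b p) hr'
  rw [map_mul, map_mul, htp1, one_mul, mul_one, map_smul', map_ofRat, map_ofRat] at hfin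
  obtain ⟨q, hq0, hq⟩ := exists_smul_eq_of_ofRat β.ne_zero hfin
  have hreal := congrArg (realMap a b) hr'
  rw [map_mul, map_mul, map_smul', map_ofRat, map_ofRat, ht1] at hreal
  have hβ' : β'.val = q⁻¹ • β.val := by rw [hq, smul_smul, inv_mul_cancel₀ hq0, one_smul]
  rw [hβ', ofRat_smul, smul_smul, smul_mul_assoc] at hreal
  set c : ℝ := toReal r.val * algebraMap ℚ ℝ q⁻¹
  have hn := congrArg nrd hreal
  rw [nrd_smul, nrd_mul, nrd_mul, mul_comm (nrd (BPt.ofRat a b ℝ β.val))] at hn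
  have hne : nrd (BPt.ofRat a b ℝ u.val) * nrd (BPt.ofRat a b ℝ β.val) ≠ 0 := by
    rw [BPt.ofRat, nrd_map, nrd_map]
    exact mul_ne_zero ((map_ne_zero _).2 (nrd_unit_ne_zero u))
      ((map_ne_zero _).2 (nrd_unit_ne_zero β))
  have hc : c ^ 2 = 1 := (mul_eq_right₀ hne).1 hn.symm
  rw [← map_mul, ← map_mul] at hreal
  rcases mul_self_eq_one_iff.1 ((sq c).symm.trans hc) with hc | hc
  · left
    rw [hc, one_smul] at hreal
    exact ofRat_injective hreal
  · right
    rw [hc, neg_one_smul, ← map_neg] at hreal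
    exact ofRat_injective hreal

/-- If $\theta$ and $\theta+1$ both anticommuted with $\beta$, then $2\beta=0$. Hence $\beta$
commutes with a generator $\theta$ of $E$ and lies in $E$. -/
theorem mem_torus_of_conj (ha : a ≠ 0) (hb : b ≠ 0) {γ₀ : GPt a b ℚ}
    (h : ∀ t ∈ torus D.E Adele, ∃ γ, GPt.diag a b γ = t * GPt.diag a b γ₀ * t⁻¹) :
    γ₀ ∈ torus D.E ℚ := by
  obtain ⟨β, rfl⟩ := QuotientGroup.mk_surjective γ₀
  obtain ⟨θ, hθ, hθ0⟩ := D.exists_im_ne_zero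
  have hne : θ ≠ 0 := by rintro rfl; exact hθ0 QuaternionAlgebra.im_zero
  have hne1 : θ + 1 ≠ 0 := by
    intro h
    refine hθ0 ?_
    rw [eq_neg_of_add_eq_zero_left h, QuaternionAlgebra.im_neg, QuaternionAlgebra.im_one, neg_zero]
  have hcomm : θ * β.val = β.val * θ := by
    rcases D.mul_eq_or_neg_of_conj h hθ hne with h0 | h0
    · exact h0
    · rcases D.mul_eq_or_neg_of_conj h (add_mem hθ (one_mem _)) hne1 with h1 | h1
      · simpa [add_mul, mul_add] using h1
      · exfalso
        rw [add_mul, mul_add, h0, one_mul, mul_one, neg_add] at h1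
        have h2 := add_left_cancel h1
        have h3 : (2 : ℚ) • β.val = 0 := by rw [two_smul]; exact eq_neg_iff_add_eq_zero.1 h2
        exact β.ne_zero ((smul_eq_zero.1 h3).resolve_left two_ne_zero)
  have hinv : θ * β⁻¹.val = β⁻¹.val * θ := by
    rw [Units.eq_inv_mul_iff_mul_eq, ← mul_assoc, ← hcomm, mul_assoc, Units.mul_inv, mul_one]
  refine ⟨β, mem_torusTilde.2 ?_, rfl⟩
  rw [EPt_rat]
  exact ⟨mem_of_mul_comm ha hb hθ hθ0 hcomm, mem_of_mul_comm ha hb hθ hθ0 hinv⟩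

end ToralDatum

/-! ### Hecke sets through the single element $\xi_1^{-1}\xi_2$ -/

section Hecke

variable {a b : ℚ}

theorem proj_mem_heckeSet_iff (ξ x : GPt a b Adele × GPt a b Adele) :
    proj x ∈ heckeSet ξ ↔ ∃ γ : GPt a b ℚ, x.2 = GPt.diag a b γ * x.1 * (ξ.1⁻¹ * ξ.2) := by
  constructor
  · rintro ⟨_, ⟨h, rfl⟩, hx⟩
    have := QuotientGroup.rightRel_apply.1 (Quotient.exact hx)
    obtain ⟨⟨γ₁, h1⟩, ⟨γ₂, h2⟩⟩ := this
    refine ⟨γ₂ * γ₁⁻¹, ?_⟩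
    simp only [Prod.fst_mul, Prod.snd_mul, Prod.fst_inv, Prod.snd_inv] at h1 h2
    rw [map_mul, map_inv, h1, h2]
    group
  · rintro ⟨γ, hγ⟩
    refine ⟨(x.1 * ξ.1⁻¹, x.1 * ξ.1⁻¹) * ξ, ⟨_, rfl⟩, Quotient.sound ?_⟩
    refine QuotientGroup.rightRel_apply.2 ⟨⟨1, ?_⟩, ⟨γ, ?_⟩⟩
    · simp
    · simp only [Prod.snd_mul, Prod.snd_inv, hγ]
      group

theorem heckeVol_eq [LocallyCompactSpace (GPt a b Adele)] (ha : a ≠ 0) (hb : b ≠ 0)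
    [MeasurableSpace (GPt a b Adele)]
    [BorelSpace (GPt a b Adele)] (μ : MeasureTheory.Measure (GPt a b Adele)) [μ.IsHaarMeasure]
    {Ω : Set (GPt a b Adele)} (hΩ : IsCompact Ω) (ξ : GPt a b Adele × GPt a b Adele) :
    heckeVol μ Ω ξ = (overlap μ Ω (ξ.1⁻¹ * ξ.2))⁻¹ := by
  rw [heckeVol, ← measure_conj_inter μ (modularCharacterFun_eq_one ha hb) hΩ]
  congr 2
  ext h
  constructor
  · rintro ⟨ω, ⟨h1, h2⟩, h3⟩
    have e1 : h = ξ.1 * ω.1 * ξ.1⁻¹ := congrArg Prod.fst h3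
    have e2 : h = ξ.2 * ω.2 * ξ.2⁻¹ := congrArg Prod.snd h3
    constructor
    · rw [e1]
      convert h1 using 1
      group
    · rw [e2]
      convert h2 using 1
      group
  · rintro ⟨h1, h2⟩
    refine ⟨(_, _), ⟨h1, h2⟩, Prod.ext ?_ ?_⟩
    · change h = ξ.1 * (ξ.1⁻¹ * h * ξ.1) * ξ.1⁻¹
      group
    · change h = ξ.2 * (ξ.2⁻¹ * h * ξ.2) * ξ.2⁻¹
      group

/-- Containment provides a rational $\gamma_t$ for each $t\in\mathbf T(\mathbb A)$, with
$\gamma_t=t\gamma_1t^{-1}$. Such a $\gamma_1$ lies in $\mathbf T(\mathbb Q)$ by `mem_torus_of_conj`;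
conversely a $\gamma\in\mathbf T(\mathbb Q)$ commutes with every $t$ and serves for all of them. -/
theorem ToralDatum.jointSet_subset_heckeSet_iff (D : ToralDatum a b) (ha : a ≠ 0) (hb : b ≠ 0)
    (ξ : GPt a b Adele × GPt a b Adele) :
    D.jointSet ⊆ heckeSet ξ ↔ ξ.1⁻¹ * ξ.2 ∈ D.twistOrbit := by
  have hsub : D.jointSet ⊆ heckeSet ξ ↔ ∀ t ∈ torus D.E Adele, ∃ γ : GPt a b ℚ,
      t * (D.s * D.g) = GPt.diag a b γ * (t * D.g) * (ξ.1⁻¹ * ξ.2) := by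
    constructor
    · intro h t ht
      exact (proj_mem_heckeSet_iff ξ ((t, t) * (D.g, D.s * D.g))).1 (h ⟨_, ⟨t, ht, rfl⟩, rfl⟩)
    · rintro h _ ⟨_, ⟨t, ht, rfl⟩, rfl⟩
      exact (proj_mem_heckeSet_iff ξ _).2 (h t ht)
  rw [hsub]
  constructor
  · intro h
    obtain ⟨γ₀, h0⟩ := h 1 (one_mem _)
    have hγ₀ : γ₀ ∈ torus D.E ℚ := by
      refine D.mem_torus_of_conj ha hb fun t ht => ?_
      obtain ⟨γ, hγ⟩ := h t ht
      refine ⟨γ, ?_⟩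
      have e1 : GPt.diag a b γ₀ = D.s * D.g * (ξ.1⁻¹ * ξ.2)⁻¹ * D.g⁻¹ := by
        rw [one_mul, one_mul] at h0
        rw [h0]; group
      have e2 : GPt.diag a b γ = t * (D.s * D.g) * (ξ.1⁻¹ * ξ.2)⁻¹ * D.g⁻¹ * t⁻¹ := by
        rw [hγ]; group
      rw [e1, e2]; group
    refine ⟨γ₀⁻¹, inv_mem hγ₀, ?_⟩
    rw [one_mul, one_mul] at h0
    rw [mul_assoc _ D.s, h0, map_inv]
    group
  · rintro ⟨γ, hγ, h⟩ t ht
    refine ⟨γ⁻¹, ?_⟩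
    have hc := mem_torus_mul_comm D.E_mul_comm ht (D.diag_mem_torus hγ)
    rw [h, map_inv]
    calc t * (D.s * D.g) = (GPt.diag a b γ)⁻¹ * (GPt.diag a b γ * t) * (D.s * D.g) := by group
      _ = (GPt.diag a b γ)⁻¹ * (t * GPt.diag a b γ) * (D.s * D.g) := by rw [hc]
      _ = _ := by group

theorem ToralDatum.tendsto_heckeVol_iff [LocallyCompactSpace (GPt a b Adele)]
    (ha : a ≠ 0) (hb : b ≠ 0)
    [MeasurableSpace (GPt a b Adele)]
    [BorelSpace (GPt a b Adele)] (μ : MeasureTheory.Measure (GPt a b Adele)) [μ.IsHaarMeasure]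
    {Ω : Set (GPt a b Adele)} (hΩ : IsCompact Ω) (D : ℕ → ToralDatum a b) :
    Filter.Tendsto (fun i => ⨅ (ξ : GPt a b Adele × GPt a b Adele)
        (_ : (D i).jointSet ⊆ heckeSet ξ), heckeVol μ Ω ξ) Filter.atTop (𝓝 ⊤) ↔
      ∀ ε : ENNReal, 0 < ε → ∀ᶠ i in Filter.atTop, ∀ η ∈ (D i).twistOrbit, overlap μ Ω η < ε := by
  have hinf : ∀ i, (⨅ (ξ : GPt a b Adele × GPt a b Adele)
        (_ : (D i).jointSet ⊆ heckeSet ξ), heckeVol μ Ω ξ)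
      = ⨅ η ∈ (D i).twistOrbit, (overlap μ Ω η)⁻¹ := by
    intro i
    refine le_antisymm (le_iInf₂ fun η hη => ?_) (le_iInf₂ fun ξ hξ => ?_)
    -- Volume and containment depend only on $\xi_1^{-1}\xi_2$, so $\xi=(1,\eta)$ represents $\eta$.
    · refine (iInf₂_le (1, η) (((D i).jointSet_subset_heckeSet_iff ha hb _).2 ?_)).trans ?_
      · simpa using hη
      · rw [heckeVol_eq ha hb μ hΩ]; simp
    · rw [heckeVol_eq ha hb μ hΩ]
      exact iInf₂_le _ (((D i).jointSet_subset_heckeSet_iff ha hb _).1 hξ)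
  simp only [hinf]
  constructor
  · intro h ε hε
    by_cases hε' : ε = ⊤
    · subst hε'
      refine Filter.Eventually.of_forall fun i η _ => ?_
      exact (MeasureTheory.measure_mono fun x hx => hx.1).trans_lt hΩ.measure_lt_top
    have h1 : ε⁻¹ < ⊤ := ENNReal.inv_lt_top.2 hε
    filter_upwards [h.eventually (lt_mem_nhds h1)] with i hi η hη
    exact ENNReal.inv_lt_inv.1 (hi.trans_le (iInf₂_le η hη))
  · intro h
    rw [ENNReal.tendsto_nhds_top_iff_nnreal]
    intro x
    have h1 : (0 : ENNReal) < ((x : ENNReal) + 1)⁻¹ := ENNReal.inv_pos.2 (by simp)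
    filter_upwards [h _ h1] with i hi
    refine lt_of_lt_of_le (b := (x : ENNReal) + 1) (ENNReal.lt_add_right (by simp) one_ne_zero) ?_
    refine le_iInf₂ fun η hη => ?_
    rw [← inv_inv ((x : ENNReal) + 1)]
    exact ENNReal.inv_le_inv.2 (hi η hη).le

end Hecke

/-! ### Elements whose conjugates have large intersection with the unit box -/

section SeparatedUnits

theorem PadicInt_norm_eq_one_iff_toZMod {p : ℕ} [Fact p.Prime] (z : ℤ_[p]) :
    ‖z‖ = 1 ↔ PadicInt.toZMod z ≠ 0 := by
  rw [← PadicInt.isUnit_iff, Ne, ← RingHom.mem_ker, PadicInt.ker_toZMod,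
    IsLocalRing.mem_maximalIdeal, mem_nonunits_iff, not_not]

/-- The expression is the reduced norm of $1+t_i\beta$ when $\beta$ has reduced trace `T` and
reduced norm `n`. The lower bound on the differences has to be uniform in $p$ and in `T`, `n`. -/
theorem exists_separated_units (p : Nat.Primes) (r : ℕ) (T n : ℤ_[(p : ℕ)]) :
    ∃ t : Fin (r + 1) → ℕ, (∀ i, ‖1 + t i * T + (t i) ^ 2 * n‖ = 1) ∧
      ∀ i j, i ≠ j → ‖(((r + 2).factorial ^ 2 : ℕ) : ℚ_[(p : ℕ)])‖
        ≤ ‖((t i : ℚ_[(p : ℕ)]) - t j)‖ := by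
  rcases le_or_gt (p : ℕ) (r + 2) with hp | hp
  -- At a small prime multiples of $p$ make the expression congruent to $1$; the differences
  -- $p(i-j)$ divide $(r+2)!\cdot(r+2)!$.
  · refine ⟨fun i => p * i, fun i => ?_, fun i j hij => ?_⟩
    · rw [PadicInt_norm_eq_one_iff_toZMod]
      simp
    · have hdvd : (((p : ℕ) : ℤ) * ((i : ℕ) - (j : ℕ))) ∣ (((r + 2).factorial ^ 2 : ℕ) : ℤ) := by
        rw [sq, Nat.cast_mul]
        refine mul_dvd_mul ?_ ?_
        · exact_mod_cast Nat.dvd_factorial p.2.pos hp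
        · rw [← Int.natAbs_dvd]
          have hne : (i : ℕ) ≠ j := fun h => hij (Fin.ext h)
          have h0 : 0 < (((i : ℕ) : ℤ) - (j : ℕ)).natAbs := by omega
          have h1 : (((i : ℕ) : ℤ) - (j : ℕ)).natAbs ≤ r + 2 := by omega
          exact Int.natCast_dvd_natCast.2 (Nat.dvd_factorial h0 h1)
      obtain ⟨k, hk⟩ := hdvd
      have h1 : (((r + 2).factorial ^ 2 : ℕ) : ℚ_[(p : ℕ)])
          = (((p : ℕ) * (i : ℕ) : ℕ) - ((p : ℕ) * (j : ℕ) : ℕ)) * (k : ℚ_[(p : ℕ)]) := by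
        have := congrArg (Int.cast : ℤ → ℚ_[(p : ℕ)]) hk
        push_cast at this ⊢
        rw [this]; ring
      rw [h1, norm_mul]
      exact mul_le_of_le_one_right (norm_nonneg _) (Padic.norm_int_le_one k)
  · classical
    set f : Polynomial (ZMod p) := Polynomial.C (PadicInt.toZMod n) * Polynomial.X ^ 2
      + Polynomial.C (PadicInt.toZMod T) * Polynomial.X + Polynomial.C 1 with hf
    have hf0 : f ≠ 0 := by
      intro h
      have := congrArg (Polynomial.eval 0) h
      simp [hf] at this
    have hdeg : f.roots.toFinset.card ≤ 2 :=
      (Multiset.toFinset_card_le _).trans ((Polynomial.card_roots' f).trans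
        Polynomial.natDegree_quadratic_le)
    have hinj : ∀ s t : ℕ, s < p → t < p → (s : ZMod p) = t → s = t := fun s t hs ht h => by
      have := (ZMod.natCast_eq_natCast_iff' s t p).1 h
      rwa [Nat.mod_eq_of_lt hs, Nat.mod_eq_of_lt ht] at this
    -- At a large prime the $r+3$ integers $0,\dots,r+2$ are distinct modulo $p$, and a nonzero
    -- quadratic polynomial excludes at most two of them, which leaves $r+1$.
    have hbad : ((Finset.range (r + 3)).filter fun t : ℕ => f.eval (t : ZMod p) = 0).card ≤ 2 := by
      refine le_trans (Finset.card_le_card_of_injOn (fun t : ℕ => (t : ZMod p)) ?_ ?_) hdeg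
      · intro t ht
        simp only [Finset.coe_filter, Set.mem_ofPred_eq] at ht
        simpa [hf0] using ht.2
      · intro s hs t ht h
        simp only [Finset.coe_filter, Set.mem_ofPred_eq, Finset.mem_range] at hs ht
        exact hinj s t (by omega) (by omega) h
    have hgood : r + 1 ≤
        ((Finset.range (r + 3)).filter fun t : ℕ => ¬ f.eval (t : ZMod p) = 0).card := by
      have := Finset.card_filter_add_card_filter_not (s := Finset.range (r + 3))
        (fun t : ℕ => f.eval (t : ZMod p) = 0)
      rw [Finset.card_range] at this
      omega
    obtain ⟨s, hs, hcard⟩ := Finset.exists_subset_card_eq hgood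
    have hmem : ∀ i, s.orderEmbOfFin hcard i < r + 3 ∧
        f.eval ((s.orderEmbOfFin hcard i : ℕ) : ZMod p) ≠ 0 := fun i => by
      simpa using hs (s.orderEmbOfFin_mem hcard i)
    refine ⟨s.orderEmbOfFin hcard, fun i => ?_, fun i j hij => ?_⟩
    · rw [PadicInt_norm_eq_one_iff_toZMod]
      convert (hmem i).2 using 1
      simp [hf]
      ring
    · refine (norm_natCast_le_one p _).trans ?_
      have hne : (s.orderEmbOfFin hcard i : ℕ) ≠ s.orderEmbOfFin hcard j := fun h =>
        hij ((s.orderEmbOfFin hcard).injective h)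
      have hi := (hmem i).1
      have hj := (hmem j).1
      have key : ‖(((s.orderEmbOfFin hcard i : ℤ_[(p : ℕ)]) - s.orderEmbOfFin hcard j))‖ = 1 := by
        rw [PadicInt_norm_eq_one_iff_toZMod, map_sub, map_natCast, map_natCast, sub_ne_zero]
        exact fun h => hne (hinj _ _ (by omega) (by omega) h)
      rw [PadicInt.norm_def] at key
      push_cast at key
      exact key.ge

end SeparatedUnits

/-! ### Denominators of conjugates of the order -/

section Conjugation

variable {a b : ℚ} {O : Subring (BPt a b ℚ)}

/-- Put $d=t_1-t_2$ and $y'=x^{-1}yv_2^{-1}x$. Comparing reduced norms shows that the scalar $z$ is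
a unit, so $x^{-1}v_1v_2^{-1}x=1+dy'$ is integral. With $g=x^{-1}v_2^{-1}x=1-t_2y'$ the element $dg$
is integral, hence so is $dg^{-1}$, as $g^{-1}$ is a unit multiple of the conjugate of $g$. The
claim follows from $x^{-1}yx=y'g^{-1}$; removing $v_2^{-1}$ costs the second factor $d$. -/
theorem IsZOrder.sq_smul_conj_mem (hO : IsZOrder O) {p : Nat.Primes} {y : BPt a b ℚ_[(p : ℕ)]}
    {t₁ t₂ : ℚ_[(p : ℕ)]} (h₁ : ‖t₁‖ ≤ 1) (h₂ : ‖t₂‖ ≤ 1)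
    {x v₁ v₂ : (BPt a b ℚ_[(p : ℕ)])ˣ} (hv₁ : v₁.val = 1 + t₁ • y) (hv₂ : v₂.val = 1 + t₂ • y)
    (hn₁ : ‖nrd v₁.val‖ = 1) (hn₂ : ‖nrd v₂.val‖ = 1) {z : ℚ_[(p : ℕ)]ˣ}
    {w : (BPt a b ℚ_[(p : ℕ)])ˣ} (hw : w.val ∈ localOrder O p) (hw' : w⁻¹.val ∈ localOrder O p)
    (h : x⁻¹ * (v₁ * v₂⁻¹) * x = scalarUnit a b z * w) :
    (t₁ - t₂) ^ 2 • (x⁻¹.val * y * x.val) ∈ localOrder O p := by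
  set d := t₁ - t₂ with hd
  have hdn : ‖d‖ ≤ 1 := by
    rw [hd, sub_eq_add_neg]
    exact (Padic.nonarchimedean _ _).trans (max_le h₁ (by rwa [norm_neg]))
  have hn₂' : ‖nrd v₂⁻¹.val‖ = 1 := by
    have := congrArg norm (nrd_inv_mul_nrd v₂)
    rwa [norm_mul, hn₂, mul_one, norm_one] at this
  have hx : nrd x⁻¹.val * nrd x.val = 1 := nrd_inv_mul_nrd x
  have hz : ‖z.val‖ = 1 := by
    have h3 := congrArg (fun u : (BPt a b ℚ_[(p : ℕ)])ˣ => ‖nrd u.val‖) h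
    simp only [scalarUnit_mul_val] at h3
    simp only [Units.val_mul, nrd_mul, nrd_smul, norm_mul, norm_pow] at h3
    rw [hn₁, hn₂', hO.norm_nrd_eq_one hw hw', one_mul, mul_one, mul_one, ← norm_mul, hx,
      norm_one] at h3
    exact (pow_eq_one_iff_of_nonneg (norm_nonneg _) two_ne_zero).1 h3.symm
  have hc : x⁻¹.val * (v₁.val * v₂⁻¹.val) * x.val ∈ localOrder O p := by
    have h3 := congrArg Units.val h
    rw [scalarUnit_mul_val] at h3
    simp only [Units.val_mul] at h3
    rw [h3]
    exact smul_mem_localOrder hz.le hw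
  set y' := x⁻¹.val * (y * v₂⁻¹.val) * x.val with hy'
  have hdy : d • y' ∈ localOrder O p := by
    have h4 : v₁.val * v₂⁻¹.val = 1 + d • (y * v₂⁻¹.val) := by
      have : v₁.val = v₂.val + d • y := by rw [hv₁, hv₂, hd, sub_smul]; abel
      rw [this, add_mul, Units.mul_inv, smul_mul_assoc]
    have : d • y' = x⁻¹.val * (v₁.val * v₂⁻¹.val) * x.val - 1 := by
      rw [h4, mul_add, add_mul, mul_one, Units.inv_mul, add_sub_cancel_left, mul_smul_comm,
        smul_mul_assoc]
    rw [this]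
    exact sub_mem hc (one_mem _)
  set g := x⁻¹ * v₂⁻¹ * x with hg
  have hgy : g.val = 1 - t₂ • y' := by
    have h5 : v₂⁻¹.val = 1 - t₂ • (y * v₂⁻¹.val) := by
      have : v₂.val * v₂⁻¹.val = 1 := v₂.mul_inv
      rw [hv₂, add_mul, one_mul, smul_mul_assoc] at this
      rw [← this]; abel
    rw [hg, Units.val_mul, Units.val_mul, h5, mul_sub, sub_mul, mul_one, Units.inv_mul,
      mul_smul_comm, smul_mul_assoc]
  have hdg : d • g.val ∈ localOrder O p := by
    rw [hgy, smul_sub, smul_comm]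
    exact sub_mem (smul_mem_localOrder hdn (one_mem _)) (smul_mem_localOrder h₂ hdy)
  have hng : ‖nrd g⁻¹.val‖ = 1 := by
    have : g⁻¹ = x⁻¹ * v₂ * x := by rw [hg]; group
    rw [this, Units.val_mul, Units.val_mul, nrd_mul, nrd_mul, mul_right_comm, hx, one_mul, hn₂]
  have hdg' : d • g⁻¹.val ∈ localOrder O p := by
    rw [inv_eq_smul_star, smul_comm, ← QuaternionAlgebra.star_smul']
    exact smul_mem_localOrder hng.le (hO.star_mem hdg)
  have hfin : d ^ 2 • (x⁻¹.val * y * x.val) = (d • y') * (d • g⁻¹.val) := by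
    have h6 : y' * g⁻¹.val = x⁻¹.val * y * x.val := by
      have : g⁻¹ = x⁻¹ * v₂ * x := by rw [hg]; group
      rw [this, hy', Units.val_mul, Units.val_mul]
      simp only [mul_assoc]
      rw [Units.mul_inv_cancel_left, Units.inv_mul_cancel_left]
    rw [smul_mul_smul_comm, h6, sq]
  rw [hfin]
  exact mul_mem hdy hdg'

theorem IsZOrder.exists_unit_of_mem_localOrder (hO : IsZOrder O) (xr : (BPt a b ℝ)ˣ)
    (xf : ∀ p : Nat.Primes, (BPt a b ℚ_[(p : ℕ)])ˣ)
    (h : ∀ p, (xf p).val ∈ localOrder O p ∧ (xf p)⁻¹.val ∈ localOrder O p) :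
    ∃ x : (BPt a b Adele)ˣ, realUnit a b x = xr ∧ ∀ p, locUnit a b p x = xf p := by
  obtain ⟨M, hM, hM'⟩ := hO.exists_norm_mul_coordNorm_le
  refine exists_unit xr xf ?_
  filter_upwards [eventually_norm_ratCast_eq_one M (by exact_mod_cast hM.ne')] with p hp
  rw [Rat.cast_natCast] at hp
  have h1 := hM' p _ (h p).1
  have h2 := hM' p _ (h p).2
  rw [hp, one_mul] at h1 h2
  exact ⟨h1, h2⟩

theorem mem_adelicBox_one {η : GPt a b Adele} : η ∈ adelicBox O 1 ↔
    ∃ x : (BPt a b Adele)ˣ, QuotientGroup.mk x = η ∧ ∀ p,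
      (locUnit a b p x).val ∈ localOrder O p ∧ (locUnit a b p x)⁻¹.val ∈ localOrder O p := by
  simp only [adelicBox, Set.mem_ofPred_eq, Nat.cast_one, one_smul]

/-- The open subgroup of `𝐆(𝔸)` of the classes of the elements `x` with `x_p ∈ 𝕆_pˣ` for all
primes `p`. -/
noncomputable def unitBox (O : Subring (BPt a b ℚ)) : Subgroup (GPt a b Adele) where
  carrier := adelicBox O 1
  one_mem' := mem_adelicBox_one.2 ⟨1, rfl, fun p => by
    rw [map_one, inv_one]; exact ⟨one_mem _, one_mem _⟩⟩
  mul_mem' := by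
    intro η η' hη hη'
    obtain ⟨x, rfl, hx⟩ := mem_adelicBox_one.1 hη
    obtain ⟨y, rfl, hy⟩ := mem_adelicBox_one.1 hη'
    refine mem_adelicBox_one.2 ⟨x * y, rfl, fun p => ?_⟩
    rw [map_mul, mul_inv_rev]
    exact ⟨mul_mem (hx p).1 (hy p).1, mul_mem (hy p).2 (hx p).2⟩
  inv_mem' := by
    intro η hη
    obtain ⟨x, rfl, hx⟩ := mem_adelicBox_one.1 hη
    refine mem_adelicBox_one.2 ⟨x⁻¹, rfl, fun p => ?_⟩
    rw [map_inv, inv_inv]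
    exact ⟨(hx p).2, (hx p).1⟩

theorem mem_unitBox {η : GPt a b Adele} : η ∈ unitBox O ↔ η ∈ adelicBox O 1 := Iff.rfl

/-- The elements $1+t_{p,i}\beta$, with integers chosen separately at each prime, assemble into
$r+1$ adelic units of $V$. The packing hypothesis yields one pair $i\ne j$ for all primes at once,
and the differences $t_{p,i}-t_{p,j}$ are bounded below by the fixed factorial. -/
theorem IsZOrder.factorial_smul_conj_mem (hO : IsZOrder O) {V : Set (GPt a b Adele)}
    (hV : ∀ x : (BPt a b Adele)ˣ, realUnit a b x = 1 →
      (∀ p, (locUnit a b p x).val ∈ localOrder O p ∧ (locUnit a b p x)⁻¹.val ∈ localOrder O p) →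
      QuotientGroup.mk x ∈ V) {r : ℕ} {x : (BPt a b Adele)ˣ}
    (hx : ∀ v : Fin (r + 1) → GPt a b Adele, (∀ i, v i ∈ V) → ∃ i j, i ≠ j ∧
      (QuotientGroup.mk x : GPt a b Adele)⁻¹ * (v i * (v j)⁻¹) * QuotientGroup.mk x ∈ unitBox O)
    {β : BPt a b ℚ} (hβ : β ∈ O) (p : Nat.Primes) :
    (((r + 2).factorial ^ 2 : ℕ) : ℚ_[(p : ℕ)]) ^ 2 •
      ((locUnit a b p x)⁻¹.val * BPt.ofRat a b ℚ_[(p : ℕ)] β * (locUnit a b p x).val)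
        ∈ localOrder O p := by
  have hβp : ∀ p, BPt.ofRat a b ℚ_[(p : ℕ)] β ∈ localOrder O p := fun p => ofRat_mem_localOrder p hβ
  choose t ht ht' using fun p : Nat.Primes => exists_separated_units p r
    ⟨_, hO.norm_trd_le_one (hβp p)⟩ ⟨_, hO.norm_nrd_le_one (hβp p)⟩
  have hnrd : ∀ (i : Fin (r + 1)) (p : Nat.Primes), ‖nrd (1 + (t p i : ℚ_[(p : ℕ)]) • BPt.ofRat a b ℚ_[(p : ℕ)] β)‖ = 1 := by
    intro i p
    have := ht p i
    rw [PadicInt.norm_def] at this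
    push_cast at this
    rw [nrd_one_add_smul]
    exact this
  have hne : ∀ (i : Fin (r + 1)) (p : Nat.Primes), nrd (1 + (t p i : ℚ_[(p : ℕ)]) • BPt.ofRat a b ℚ_[(p : ℕ)] β) ≠ 0 :=
    fun i p => norm_pos_iff.1 (by rw [hnrd]; exact one_pos)
  have hmem : ∀ (i : Fin (r + 1)) (p : Nat.Primes), 1 + (t p i : ℚ_[(p : ℕ)]) • BPt.ofRat a b ℚ_[(p : ℕ)] β ∈ localOrder O p :=
    fun i p => add_mem (one_mem _) (smul_mem_localOrder (norm_natCast_le_one p _) (hβp p))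
  have hvint : ∀ (i : Fin (r + 1)) (p : Nat.Primes), (unitOfNrd _ (Units.mk0 _ (hne i p)) rfl).val ∈ localOrder O p ∧
      (unitOfNrd _ (Units.mk0 _ (hne i p)) rfl)⁻¹.val ∈ localOrder O p := fun i p =>
    ⟨hmem i p, hO.inv_mem (hmem i p) (hnrd i p)⟩
  choose v hv hvp using fun i => hO.exists_unit_of_mem_localOrder 1
    (fun p => unitOfNrd _ (Units.mk0 _ (hne i p)) rfl) (hvint i)
  obtain ⟨i, j, hij, h⟩ := hx (fun i => QuotientGroup.mk (v i)) fun i =>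
    hV (v i) (hv i) fun p => by rw [hvp]; exact hvint i p
  obtain ⟨w, hw, hwint⟩ := mem_adelicBox_one.1 (mem_unitBox.1 h)
  obtain ⟨z, hz⟩ := (mk_eq_mk_iff w (x⁻¹ * (v i * (v j)⁻¹) * x)).1 hw
  have hzp := congrArg (locUnit a b p) hz
  simp only [map_mul, map_inv] at hzp
  rw [hvp, hvp, locUnit, map_scalarUnit] at hzp
  have key := hO.sq_smul_conj_mem (norm_natCast_le_one p _) (norm_natCast_le_one p _)
    (unitOfNrd_val _ _ _) (unitOfNrd_val _ _ _) (hnrd i p) (hnrd j p) (hwint p).1 (hwint p).2 hzp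
  have hd := ht' p i j hij
  have hd0 : (t p i : ℚ_[(p : ℕ)]) - t p j ≠ 0 := by
    refine norm_pos_iff.1 (lt_of_lt_of_le ?_ hd)
    exact norm_natCast_pos p (pow_pos (Nat.factorial_pos _) 2)
  have hq : (((r + 2).factorial ^ 2 : ℕ) : ℚ_[(p : ℕ)]) ^ 2
      = ((((r + 2).factorial ^ 2 : ℕ) : ℚ_[(p : ℕ)]) / ((t p i : ℚ_[(p : ℕ)]) - t p j)) ^ 2
        * ((t p i : ℚ_[(p : ℕ)]) - t p j) ^ 2 := by
    field_simp
  rw [hq, mul_smul]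
  refine smul_mem_localOrder ?_ key
  rw [norm_pow, norm_div]
  exact pow_le_one₀ (by positivity) (div_le_one_of_le₀ hd (norm_nonneg _))

end Conjugation

/-! ### Bounds from large intersections -/

section Averaging

variable {a b : ℚ} {R : Type} [CommRing R] [Algebra ℚ R]

/-- The standard basis `1, i, j, ij` of `𝐁(ℚ)`. -/
def stdBasis (a b : ℚ) : Fin 4 → BPt a b ℚ :=
  ![⟨1, 0, 0, 0⟩, ⟨0, 1, 0, 0⟩, ⟨0, 0, 1, 0⟩, ⟨0, 0, 0, 1⟩]

/-- The inverses of the standard basis elements of `𝐁(ℚ)`. -/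
def stdBasisInv (a b : ℚ) : Fin 4 → BPt a b ℚ :=
  ![⟨1, 0, 0, 0⟩, ⟨0, a⁻¹, 0, 0⟩, ⟨0, 0, b⁻¹, 0⟩, ⟨0, 0, 0, -(a * b)⁻¹⟩]

/-- The coordinates with respect to the standard basis. -/
def coord (x : BPt a b R) : Fin 4 → R := ![x.re, x.imI, x.imJ, x.imK]

theorem re_mul_stdBasisInv (ha : a ≠ 0) (hb : b ≠ 0) (x : BPt a b R) (m : Fin 4) :
    (x * BPt.ofRat a b R (stdBasisInv a b m)).re = coord x m := by
  have ha' : algebraMap ℚ R a * algebraMap ℚ R a⁻¹ = 1 := by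
    rw [← map_mul, mul_inv_cancel₀ ha, map_one]
  have hb' : algebraMap ℚ R b * algebraMap ℚ R b⁻¹ = 1 := by
    rw [← map_mul, mul_inv_cancel₀ hb, map_one]
  fin_cases m
  · simp [BPt.map, stdBasisInv, coord]
  · simp [BPt.map, stdBasisInv, coord, Algebra.ofId_apply]
    linear_combination x.imI * ha'
  · simp [BPt.map, stdBasisInv, coord, Algebra.ofId_apply]
    linear_combination x.imJ * hb'
  · simp [BPt.map, stdBasisInv, coord, Algebra.ofId_apply]
    linear_combination x.imK * ha' * algebraMap ℚ R b * algebraMap ℚ R b⁻¹ + x.imK * hb'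

/-- Conjugation by each of $i,j,ij$ fixes its own coordinate and negates the other two imaginary
ones, so these cancel while the real part is counted four times. -/
theorem sum_stdBasis_conj (ha : a ≠ 0) (hb : b ≠ 0) (z : BPt a b R) :
    ∑ e, BPt.ofRat a b R (stdBasis a b e) * z * BPt.ofRat a b R (stdBasisInv a b e)
      = algebraMap R _ (4 * z.re) := by
  have ha' : algebraMap ℚ R a * algebraMap ℚ R a⁻¹ = 1 := by
    rw [← map_mul, mul_inv_cancel₀ ha, map_one]
  have hb' : algebraMap ℚ R b * algebraMap ℚ R b⁻¹ = 1 := by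
    rw [← map_mul, mul_inv_cancel₀ hb, map_one]
  simp only [Fin.sum_univ_four, stdBasis, stdBasisInv]
  generalize hα : algebraMap ℚ R a⁻¹ = α at *
  generalize hβ : algebraMap ℚ R b⁻¹ = β at *
  ext
  · simp [BPt.map, Algebra.ofId_apply, QuaternionAlgebra.algebraMap_eq, hα, hβ]
    linear_combination z.re * ha' + z.re * hb' + z.re * (ha' * algebraMap ℚ R b * β + hb')
  · simp [BPt.map, Algebra.ofId_apply, QuaternionAlgebra.algebraMap_eq, hα, hβ]
    linear_combination z.imI * ha' - z.imI * hb' - z.imI * (ha' * algebraMap ℚ R b * β + hb')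
  · simp [BPt.map, Algebra.ofId_apply, QuaternionAlgebra.algebraMap_eq, hα, hβ]
    linear_combination -z.imJ * ha' + z.imJ * hb' - z.imJ * (ha' * algebraMap ℚ R b * β + hb')
  · simp [BPt.map, Algebra.ofId_apply, QuaternionAlgebra.algebraMap_eq, hα, hβ]
    linear_combination -z.imK * ha' - z.imK * hb' + z.imK * (ha' * algebraMap ℚ R b * β + hb')

end Averaging

/-! ### A large overlap confines an element to a box -/

section Growth

variable {a b : ℚ} {O : Subring (BPt a b ℚ)}

theorem norm_nrd_lt_one {p : Nat.Primes} (ha : ‖(a : ℚ_[(p : ℕ)])‖ ≤ 1)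
    (hb : ‖(b : ℚ_[(p : ℕ)])‖ ≤ 1) {x : BPt a b ℚ_[(p : ℕ)]} (hx : coordNorm x < 1) :
    ‖nrd x‖ < 1 := by
  obtain ⟨h1, h2, h3, h4⟩ := coordNorm_lt_iff.1 hx
  have sq_lt : ∀ z : ℚ_[(p : ℕ)], ‖z‖ < 1 → ‖z ^ 2‖ < 1 := fun z hz => by
    rw [norm_pow]; exact pow_lt_one₀ (norm_nonneg _) hz two_ne_zero
  have mul_lt : ∀ c z : ℚ_[(p : ℕ)], ‖c‖ ≤ 1 → ‖z‖ < 1 → ‖c * z‖ < 1 := fun c z hc hz => by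
    rw [norm_mul]; exact (mul_le_of_le_one_left (norm_nonneg _) hc).trans_lt hz
  have add_lt : ∀ c z : ℚ_[(p : ℕ)], ‖c‖ < 1 → ‖z‖ < 1 → ‖c + z‖ < 1 := fun c z hc hz =>
    (Padic.nonarchimedean _ _).trans_lt (max_lt hc hz)
  have sub_lt : ∀ c z : ℚ_[(p : ℕ)], ‖c‖ < 1 → ‖z‖ < 1 → ‖c - z‖ < 1 := fun c z hc hz => by
    rw [sub_eq_add_neg]; exact add_lt _ _ hc (by rwa [norm_neg])
  unfold nrd
  simp only [eq_ratCast]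
  refine add_lt _ _ (sub_lt _ _ (sub_lt _ _ (sq_lt _ h1) (mul_lt _ _ ha (sq_lt _ h2)))
    (mul_lt _ _ hb (sq_lt _ h3))) (mul_lt _ _ ?_ (sq_lt _ h4))
  rw [norm_mul]
  exact mul_le_one₀ ha (norm_nonneg _) hb

/-- At almost all primes the reduced norm is a unit and $a,b$ are integral; coordinates all in the
maximal ideal would then give a non-unit norm. -/
theorem eventually_coordNorm_eq_one (ha : a ≠ 0) (hb : b ≠ 0) (x : (BPt a b Adele)ˣ) :
    ∀ᶠ p in Filter.cofinite, coordNorm (locUnit a b p x).val = 1 := by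
  let n : Adeleˣ := ⟨nrd x.val, nrd x⁻¹.val, by rw [mul_comm, nrd_inv_mul_nrd], nrd_inv_mul_nrd x⟩
  filter_upwards [eventually_norm_eq_one n, eventually_norm_ratCast_eq_one a ha,
    eventually_norm_ratCast_eq_one b hb, eventually_coordNorm_le_one x.val] with p h1 h2 h3 h4
  refine le_antisymm h4 (not_lt.1 fun h => ?_)
  have h5 := norm_nrd_lt_one h2.le h3.le h
  have h6 : nrd (locUnit a b p x).val = toPadic p n.val := nrd_map (toPadic p) x.val
  rw [h6, h1] at h5
  exact lt_irrefl _ h5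

theorem exists_coord_norm_eq {F : Type} [NormedField F] [Algebra ℚ F] (x : BPt a b F) :
    ∃ m, ‖coord x m‖ = coordNorm x := by
  rcases exists_coord_eq_coordNorm x with h | h | h | h
  · exact ⟨0, h⟩
  · exact ⟨1, h⟩
  · exact ⟨2, h⟩
  · exact ⟨3, h⟩

/-- Averaging $z=xe_m^{-1}$ over the basis gives $4x_m\,x^{-1}=\sum_e(x^{-1}ex)\,e_m^{-1}e^{-1}$,
where $x_m$ is the coordinate of $x$ at $e_m$. The conjugates $x^{-1}ex$ have denominator `N` up to
the denominators `M` of the constants. -/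
theorem IsZOrder.smul_coord_inv_mem {p : Nat.Primes} (ha : a ≠ 0) (hb : b ≠ 0) {N M : ℕ}
    (hM : ∀ e, (M : ℚ) • stdBasis a b e ∈ O)
    (hM' : ∀ m e, (M : ℚ) • (stdBasisInv a b m * stdBasisInv a b e) ∈ O)
    (x : (BPt a b ℚ_[(p : ℕ)])ˣ)
    (hx : ∀ β ∈ O, (N : ℚ_[(p : ℕ)]) • (x⁻¹.val * BPt.ofRat a b ℚ_[(p : ℕ)] β * x.val)
      ∈ localOrder O p) (m : Fin 4) :
    ((4 * N * M ^ 2 : ℕ) : ℚ_[(p : ℕ)]) • (coord x.val m • x⁻¹.val) ∈ localOrder O p := by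
  have h1 := sum_stdBasis_conj ha hb (x.val * BPt.ofRat a b ℚ_[(p : ℕ)] (stdBasisInv a b m))
  rw [re_mul_stdBasisInv ha hb] at h1
  have h2 : ((4 * N * M ^ 2 : ℕ) : ℚ_[(p : ℕ)]) • (coord x.val m • x⁻¹.val)
      = ∑ e, ((N : ℚ_[(p : ℕ)]) • (x⁻¹.val * BPt.ofRat a b ℚ_[(p : ℕ)]
          ((M : ℚ) • stdBasis a b e) * x.val))
        * BPt.ofRat a b ℚ_[(p : ℕ)] ((M : ℚ) • (stdBasisInv a b m * stdBasisInv a b e)) := by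
    have h3 : ((4 * N * M ^ 2 : ℕ) : ℚ_[(p : ℕ)]) • (coord x.val m • x⁻¹.val)
        = ((N * M ^ 2 : ℕ) : ℚ_[(p : ℕ)]) •
          (x⁻¹.val * algebraMap _ (BPt a b ℚ_[(p : ℕ)]) (4 * coord x.val m)) := by
      rw [← Algebra.commutes, ← Algebra.smul_def, smul_smul, smul_smul]
      congr 1
      push_cast
      ring
    rw [h3, ← h1, Finset.mul_sum, Finset.smul_sum]
    refine Finset.sum_congr rfl fun e _ => ?_
    simp only [ofRat_smul, map_mul, map_natCast, mul_smul_comm, smul_mul_assoc, smul_smul]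
    congr 1
    · push_cast; ring
    · simp only [mul_assoc]
  rw [h2]
  exact sum_mem fun e _ => mul_mem (hx _ (hM e)) (ofRat_mem_localOrder p (hM' m e))

theorem IsZOrder.exists_mem_adelicBox_of_conj (hO : IsZOrder O) (ha : a ≠ 0) (hb : b ≠ 0)
    {V : Set (GPt a b Adele)}
    (hV : ∀ x : (BPt a b Adele)ˣ, realUnit a b x = 1 →
      (∀ p, (locUnit a b p x).val ∈ localOrder O p ∧ (locUnit a b p x)⁻¹.val ∈ localOrder O p) →
      QuotientGroup.mk x ∈ V) (r : ℕ) :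
    ∃ N : ℕ, 0 < N ∧ ∀ η : GPt a b Adele,
      (∀ v : Fin (r + 1) → GPt a b Adele, (∀ i, v i ∈ V) →
        ∃ i j, i ≠ j ∧ η⁻¹ * (v i * (v j)⁻¹) * η ∈ unitBox O) → η ∈ adelicBox O N := by
  classical
  obtain ⟨M₁, hM₁, hb₁⟩ := hO.exists_nat_smul_mem_finset (Finset.univ.image (stdBasis a b) ∪
    Finset.univ.image fun t : Fin 4 × Fin 4 => stdBasisInv a b t.1 * stdBasisInv a b t.2)
  obtain ⟨M₂, hM₂, hb₂⟩ := hO.exists_mem_of_coordNorm_le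
  set N₀ := ((r + 2).factorial ^ 2) ^ 2 with hN₀
  have hN₀pos : 0 < N₀ := by positivity
  refine ⟨M₂ * (4 * N₀ * M₁ ^ 2), by positivity, fun η hη => ?_⟩
  obtain ⟨x, rfl⟩ := QuotientGroup.mk_surjective η
  have hcoord : ∀ p m, ((4 * N₀ * M₁ ^ 2 : ℕ) : ℚ_[(p : ℕ)]) •
      (coord (locUnit a b p x).val m • (locUnit a b p x)⁻¹.val) ∈ localOrder O p := fun p m =>
    IsZOrder.smul_coord_inv_mem ha hb
      (fun e => hb₁ _ (Finset.mem_union_left _ (Finset.mem_image_of_mem _ (Finset.mem_univ e))))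
      (fun m e => hb₁ _ (Finset.mem_union_right _
        (Finset.mem_image.2 ⟨(m, e), Finset.mem_univ _, rfl⟩))) _
      (fun β hβ => by
        have := hO.factorial_smul_conj_mem hV hη hβ p
        rwa [hN₀, Nat.cast_pow _ 2]) m
  choose m hm using fun p => exists_coord_norm_eq (locUnit a b p x).val
  have hcpos : ∀ p, 0 < coordNorm (locUnit a b p x).val := fun p => coordNorm_pos (Units.ne_zero _)
  have hz0 : ∀ p, coord (locUnit a b p x).val (m p) ≠ 0 := fun p =>
    norm_pos_iff.1 (by rw [hm]; exact hcpos p)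
  -- Dividing $x_p$ by its largest coordinate makes $x_p$ bounded, while $x_p^{-1}$ becomes the
  -- product controlled by `hcoord`. The divisors are units at almost all primes, so they form an
  -- adelic unit.
  obtain ⟨z, -, hzp⟩ := exists_adele_unit 1 one_ne_zero
    (fun p => (coord (locUnit a b p x).val (m p))⁻¹) (fun p => inv_ne_zero (hz0 p)) (by
      filter_upwards [eventually_coordNorm_eq_one ha hb x] with p hp
      rw [norm_inv, hm, hp, inv_one])
  refine ⟨scalarUnit a b z * x, mk_scalarUnit_mul z x, fun p => ?_⟩
  have hloc : locUnit a b p (scalarUnit a b z * x)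
      = scalarUnit a b (Units.mk0 _ (inv_ne_zero (hz0 p))) * locUnit a b p x := by
    rw [map_mul]
    congr 1
    exact (map_scalarUnit (toPadic p) z).trans (congrArg _ (Units.ext (hzp p)))
  have hinv : (scalarUnit a b (Units.mk0 _ (inv_ne_zero (hz0 p))) * locUnit a b p x)⁻¹.val
      = coord (locUnit a b p x).val (m p) • (locUnit a b p x)⁻¹.val := by
    refine Units.inv_eq_of_mul_eq_one_right ?_
    rw [scalarUnit_mul_val, smul_mul_smul_comm, Units.mul_inv, Units.val_mk0,
      inv_mul_cancel₀ (hz0 p), one_smul]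
  rw [hloc, hinv, scalarUnit_mul_val]
  constructor
  · refine natCast_smul_mem_localOrder_of_dvd (dvd_mul_right M₂ _) (hb₂ p _ ?_)
    rw [coordNorm_smul, coordNorm_smul, Units.val_mk0, norm_inv, hm, inv_mul_cancel₀ (hcpos p).ne',
      mul_one]
  · exact natCast_smul_mem_localOrder_of_dvd (dvd_mul_left _ M₂) (hcoord p (m p))

theorem ToralDatum.overlap_lt_iff [LocallyCompactSpace (GPt a b Adele)] (hO : IsZOrder O)
    (ha : a ≠ 0) (hb : b ≠ 0)
    [MeasurableSpace (GPt a b Adele)]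
    [BorelSpace (GPt a b Adele)] (μ : MeasureTheory.Measure (GPt a b Adele)) [μ.IsHaarMeasure]
    {Ω : Set (GPt a b Adele)} (hΩ : IsCompact Ω) (hΩ1 : Ω ∈ 𝓝 1) {K : Subgroup (GPt a b ℝ)}
    (hK : IsMaxCompactTorus K) {D : ℕ → ToralDatum a b} (hD : ∀ i, (D i).HasRealTorus K) :
    (∀ ε : ENNReal, 0 < ε → ∀ᶠ i in Filter.atTop, ∀ η ∈ (D i).twistOrbit, overlap μ Ω η < ε) ↔
      ∀ B : Set (GPt a b Adele), IsCompact B → ∃ N : ℕ, ∀ i > N, (D i).twistOrbit ∩ B = ∅ := by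
  constructor
  · intro h B hB
    obtain ⟨c, hc, hcB⟩ := exists_pos_le_overlap μ hΩ1 hB
    obtain ⟨N, hN⟩ := Filter.eventually_atTop.1 (h c hc)
    refine ⟨N, fun i hi => Set.eq_empty_iff_forall_notMem.2 ?_⟩
    rintro η ⟨h1, h2⟩
    exact absurd (hN i hi.le η h1) (not_lt.2 (hcB η h2))
  · intro h ε hε
    rw [hO.forall_isCompact_iff hK hD] at h
    -- The real component is fixed to be $1$, so $V$ is a compact set that contains the image of
    -- $\prod_p\mathbb O_p^\times$.
    obtain ⟨V, hVc, hV⟩ := hO.exists_isCompact_box (isCompact_singleton (x := (1 : BPt a b ℝ)))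
      one_pos
    have hV' : ∀ x : (BPt a b Adele)ˣ, realUnit a b x = 1 →
        (∀ p, (locUnit a b p x).val ∈ localOrder O p ∧
          (locUnit a b p x)⁻¹.val ∈ localOrder O p) → QuotientGroup.mk x ∈ V := by
      intro x hx hxp
      refine hV x (by rw [hx]; rfl) (by rw [hx]; rfl) fun p => ?_
      rw [Nat.cast_one, one_smul, one_smul]
      exact hxp p
    obtain ⟨r, hr⟩ := exists_conj_mem_of_le_overlap μ (modularCharacterFun_eq_one ha hb) hΩ hVc
      (unitBox O) (hO.isOpen_adelicBox 1) hε
    obtain ⟨N, hN, hNη⟩ := hO.exists_mem_adelicBox_of_conj ha hb hV' r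
    filter_upwards [h N hN] with i hi η hη
    by_contra hlt
    have : η ∈ (D i).twistOrbit ∩ adelicBox O N := ⟨hη, hNη η (hr η (not_lt.1 hlt))⟩
    rw [hi] at this
    exact this

end Growth

/-! ### Indices in lattices -/

section Index

/-- `H` need not be finitely generated, so the argument runs on finitely many classes.
Representatives of $m^d+1$ classes, $d=\dim V$, span a free group $M\subseteq H$ of rank at most
$d$. Since $mM\subseteq I$ and $M/mM$ has at most $m^d$ elements, two of the classes would coincide.
-/
theorem card_quotient_le_pow {V : Type} [AddCommGroup V] [Module ℚ V] [FiniteDimensional ℚ V]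
    {H : AddSubgroup V} {I : AddSubgroup H} {m : ℕ} (hm : 0 < m) (h : ∀ x, m • x ∈ I) :
    ENat.card (H ⧸ I) ≤ ((m ^ Module.finrank ℚ V : ℕ) : ℕ∞) := by
  classical
  by_contra! hlt
  obtain ⟨t, -, ht⟩ := Set.exists_subset_encard_eq (s := (Set.univ : Set (H ⧸ I)))
    (k := ((m ^ Module.finrank ℚ V + 1 : ℕ) : ℕ∞)) (by
      rw [Set.encard_univ, Nat.cast_add, Nat.cast_one]
      exact Order.add_one_le_of_lt hlt)
  have hfin : t.Finite := Set.finite_of_encard_eq_coe ht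
  let _ : Fintype t := hfin.fintype
  have hcard : Fintype.card t = m ^ Module.finrank ℚ V + 1 := by
    have := Set.encard_coe_eq_coe_finsetCard t.toFinset
    rw [Set.coe_toFinset, ht, Set.toFinset_card] at this
    exact_mod_cast this.symm
  let rep : t → V := fun q => (Quotient.out q.1 : H).val
  let M : Submodule ℤ V := Submodule.span ℤ (Set.range rep)
  have : Module.Finite ℤ M := Module.Finite.span_of_finite ℤ (Set.finite_range rep)
  have : Module.IsTorsionFree ℤ V := Module.IsTorsionFree.trans ℚ
  have : Module.Free ℤ M := inferInstance
  let B := Module.finBasis ℤ M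
  have hrank : Module.finrank ℤ M ≤ Module.finrank ℚ V := by
    have h1 : LinearIndependent ℤ (fun k => (B k : V)) :=
      B.linearIndependent.map' M.subtype (Submodule.ker_subtype M)
    have h2 := (LinearIndependent.iff_fractionRing ℤ ℚ).1 h1
    simpa using h2.fintype_card_le_finrank
  have hMH : ∀ x ∈ M, x ∈ H := fun x hx => by
    have : M ≤ AddSubgroup.toIntSubmodule H := by
      rw [Submodule.span_le]
      rintro _ ⟨q, rfl⟩
      exact (Quotient.out q.1 : H).2
    exact this hx
  let f : t → (Fin (Module.finrank ℤ M) → ZMod m) := fun q k =>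
    ((B.repr ⟨rep q, Submodule.subset_span ⟨q, rfl⟩⟩ k : ℤ) : ZMod m)
  have : NeZero m := ⟨hm.ne'⟩
  have hf : Function.Injective f := by
    intro q r hqr
    have hdvd : ∀ k, (m : ℤ) ∣ B.repr (⟨rep q, Submodule.subset_span ⟨q, rfl⟩⟩
        - ⟨rep r, Submodule.subset_span ⟨r, rfl⟩⟩) k := fun k => by
      rw [map_sub, Finsupp.sub_apply, ← ZMod.intCast_zmod_eq_zero_iff_dvd, Int.cast_sub]
      exact sub_eq_zero.2 (congrFun hqr k)
    choose c hc using hdvd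
    have hsum : rep q - rep r = m • ((∑ k, c k • B k : M) : V) := by
      have h3 := B.sum_repr (⟨rep q, Submodule.subset_span ⟨q, rfl⟩⟩
        - ⟨rep r, Submodule.subset_span ⟨r, rfl⟩⟩)
      simp only [hc, mul_smul, ← Finset.smul_sum] at h3
      have h4 := congrArg Subtype.val h3
      rw [natCast_zsmul] at h4
      exact h4.symm
    have hmem := h (⟨_, hMH _ (∑ k, c k • B k : M).2⟩ : H)
    have h5 : m • (⟨_, hMH _ (∑ k, c k • B k : M).2⟩ : H)
        = (Quotient.out q.1 : H) - Quotient.out r.1 := Subtype.ext hsum.symm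
    rw [h5] at hmem
    refine Subtype.ext ?_
    rw [← Quotient.out_eq q.1, ← Quotient.out_eq r.1]
    refine (QuotientAddGroup.eq.2 ?_).symm
    rwa [neg_add_eq_sub]
  have h6 := Fintype.card_le_of_injective f hf
  rw [hcard, Fintype.card_fun, ZMod.card, Fintype.card_fin] at h6
  have h7 := Nat.pow_le_pow_right hm hrank
  omega

end Index

/-! ### Ideals in the twist class -/

section Approximation

variable {a b : ℚ}

/-- The closure of $E$ is a ring, and it contains the scalars $\mathbb Q_p$ because $\mathbb Q$ is
dense in them. -/
theorem EPt_subset_closure (E : Subalgebra ℚ (BPt a b ℚ)) (p : Nat.Primes) :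
    (EPt E ℚ_[(p : ℕ)] : Set (BPt a b ℚ_[(p : ℕ)])) ⊆
      closure (BPt.ofRat a b ℚ_[(p : ℕ)] '' (E : Set (BPt a b ℚ))) := by
  let T : Subring (BPt a b ℚ_[(p : ℕ)]) :=
    (E.toSubring.map (BPt.ofRat a b ℚ_[(p : ℕ)])).topologicalClosure
  have hT : ∀ x ∈ E, BPt.ofRat a b ℚ_[(p : ℕ)] x ∈ T := fun x hx =>
    Subring.le_topologicalClosure _ ⟨x, hx, rfl⟩
  have hc : Continuous (algebraMap ℚ_[(p : ℕ)] (BPt a b ℚ_[(p : ℕ)])) :=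
    continuous_BPt_iff.2 ⟨continuous_id, continuous_const, continuous_const, continuous_const⟩
  suffices h : ∀ x ∈ EPt E ℚ_[(p : ℕ)], x ∈ T from h
  intro x hx
  induction hx using Algebra.adjoin_induction with
  | mem x hx =>
    obtain ⟨e, he, rfl⟩ := hx
    exact hT e he
  | algebraMap r =>
    have h1 : r ∈ closure (Set.range (Rat.cast : ℚ → ℚ_[(p : ℕ)])) :=
      Padic.denseRange_ratCast (p : ℕ) r
    refine closure_minimal ?_ (Subring.isClosed_topologicalClosure _)
      (mem_closure_image hc.continuousAt h1)
    rintro _ ⟨_, ⟨q, rfl⟩, rfl⟩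
    have h2 := hT (algebraMap ℚ _ q) (E.algebraMap_mem q)
    have h3 : BPt.ofRat a b ℚ_[(p : ℕ)] (algebraMap ℚ _ q)
        = algebraMap _ _ (q : ℚ_[(p : ℕ)]) :=
      (map_algebraMap _ q).trans (congrArg _ (eq_ratCast (Algebra.ofId ℚ ℚ_[(p : ℕ)]) q))
    rw [h3] at h2
    exact h2
  | add x y _ _ hx hy => exact add_mem hx hy
  | mul x y _ _ hx hy => exact mul_mem hx hy

theorem continuous_coordNorm (p : Nat.Primes) :
    Continuous (coordNorm : BPt a b ℚ_[(p : ℕ)] → ℝ) := by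
  unfold coordNorm
  have h1 := continuous_re (a := a) (b := b) (R := ℚ_[(p : ℕ)])
  have h2 := continuous_imI (a := a) (b := b) (R := ℚ_[(p : ℕ)])
  have h3 := continuous_imJ (a := a) (b := b) (R := ℚ_[(p : ℕ)])
  have h4 := continuous_imK (a := a) (b := b) (R := ℚ_[(p : ℕ)])
  fun_prop

theorem IsZOrder.localOrder_mem_nhds_zero {O : Subring (BPt a b ℚ)} (hO : IsZOrder O)
    (p : Nat.Primes) : (localOrder O p : Set (BPt a b ℚ_[(p : ℕ)])) ∈ 𝓝 0 := by
  obtain ⟨M, hM, h⟩ := hO.exists_mem_of_coordNorm_le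
  refine Filter.mem_of_superset ((isOpen_Iio.preimage (continuous_coordNorm p)).mem_nhds
    (x := 0) (show coordNorm 0 < ‖(M : ℚ_[(p : ℕ)])‖ from ?_)) fun y hy => h p y (le_of_lt hy)
  rw [coordNorm_zero]
  exact norm_natCast_pos p hM

end Approximation

namespace ToralDatum

variable {a b : ℚ} (D : ToralDatum a b) {O : Subring (BPt a b ℚ)}

theorem sLoc_mem (p : Nat.Primes) : D.sLoc p ∈ torusTilde D.E ℚ_[(p : ℕ)] :=
  map_mem_torusTilde (toPadic p) D.sRep_mem

theorem mem_localRing_iff {p : Nat.Primes} {l : BPt a b ℚ_[(p : ℕ)]} :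
    l ∈ D.localRing O p ↔ l ∈ EPt D.E ℚ_[(p : ℕ)] ∧
      (D.gLoc p)⁻¹.val * l * (D.gLoc p).val ∈ localOrder O p := by
  refine and_congr Iff.rfl ⟨?_, fun h => ⟨_, h, ?_⟩⟩
  · rintro ⟨y, hy, rfl⟩
    simpa [mul_assoc] using hy
  · simp [mul_assoc]

theorem mem_globalRing_iff {x : BPt a b ℚ} :
    x ∈ D.globalRing O ↔ x ∈ D.E ∧ ∀ p : Nat.Primes,
      (D.gLoc p)⁻¹.val * BPt.ofRat a b ℚ_[(p : ℕ)] x * (D.gLoc p).val ∈ localOrder O p := by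
  rw [globalRing, Subring.mem_inf, Subring.mem_iInf]
  refine and_congr_right fun hx => forall_congr' fun p => ?_
  rw [Subring.mem_comap, mem_localRing_iff]
  exact and_iff_right (ofRat_mem_EPt hx)

theorem mem_twistIdeal_iff {x : BPt a b ℚ} :
    x ∈ D.twistIdeal O ↔ x ∈ D.E ∧ ∀ p : Nat.Primes,
      (D.gLoc p)⁻¹.val * ((D.sLoc p)⁻¹.val * BPt.ofRat a b ℚ_[(p : ℕ)] x) * (D.gLoc p).val
        ∈ localOrder O p := by
  refine and_congr_right fun hx => forall_congr' fun p => ⟨?_, fun h => ?_⟩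
  · rintro ⟨l, hl, h⟩
    rw [h, Units.inv_mul_cancel_left]
    exact (D.mem_localRing_iff.1 hl).2
  · exact ⟨_, D.mem_localRing_iff.2
      ⟨mul_mem (mem_torusTilde.1 (D.sLoc_mem p)).2 (ofRat_mem_EPt hx), h⟩,
      (Units.mul_inv_cancel_left _ _).symm⟩

/-- The element `g⁻¹ e s g` of `𝐁ˣ(𝔸)`, for `e ∈ 𝐁ˣ(ℚ)`. -/
def twist (u : (BPt a b ℚ)ˣ) : (BPt a b Adele)ˣ :=
  D.gRep⁻¹ * Units.map (BPt.ofRat a b Adele : BPt a b ℚ →* BPt a b Adele) u * D.sRep * D.gRep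

theorem mem_twistOrbit_iff {η : GPt a b Adele} :
    η ∈ D.twistOrbit ↔ ∃ u : (BPt a b ℚ)ˣ, u.val ∈ D.E ∧ u⁻¹.val ∈ D.E ∧
      η = QuotientGroup.mk (D.twist u) := by
  constructor
  · rintro ⟨_, ⟨u, hu, rfl⟩, rfl⟩
    have h := mem_torusTilde.1 hu
    rw [EPt_rat] at h
    exact ⟨u, h.1, h.2, rfl⟩
  · rintro ⟨u, h1, h2, rfl⟩
    refine ⟨QuotientGroup.mk u, ⟨u, mem_torusTilde.2 ?_, rfl⟩, rfl⟩
    rw [EPt_rat]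
    exact ⟨h1, h2⟩

theorem locUnit_twist (u : (BPt a b ℚ)ˣ) (p : Nat.Primes) :
    (locUnit a b p (D.twist u)).val = (D.gLoc p)⁻¹.val * BPt.ofRat a b ℚ_[(p : ℕ)] u.val *
      (D.sLoc p).val * (D.gLoc p).val := by
  rw [twist, map_mul, map_mul, map_mul, map_inv, Units.val_mul, Units.val_mul, Units.val_mul]
  congr 3

theorem locUnit_twist_inv (u : (BPt a b ℚ)ˣ) (p : Nat.Primes) :
    (locUnit a b p (D.twist u))⁻¹.val = (D.gLoc p)⁻¹.val * ((D.sLoc p)⁻¹.val *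
      BPt.ofRat a b ℚ_[(p : ℕ)] u⁻¹.val) * (D.gLoc p).val := by
  have h : BPt.ofRat a b ℚ_[(p : ℕ)] u.val * BPt.ofRat a b ℚ_[(p : ℕ)] u⁻¹.val = 1 := by
    rw [← map_mul, Units.mul_inv, map_one]
  refine Units.inv_eq_of_mul_eq_one_right ?_
  rw [locUnit_twist]
  simp only [mul_assoc, Units.mul_inv_cancel_left]
  rw [← mul_assoc (BPt.ofRat a b _ u.val), h, one_mul, Units.inv_mul]

end ToralDatum

theorem tendsto_mul_sub_mul {A : Type} [Ring A] [TopologicalSpace A] [IsTopologicalRing A]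
    (c d e s : A) : Filter.Tendsto (fun y => c * (d * (s - y)) * e) (𝓝 s) (𝓝 0) := by
  have : Continuous (fun y => c * (d * (s - y)) * e) := by fun_prop
  simpa using this.tendsto s

theorem scalarUnit_mul_inv_val {a b : ℚ} {R : Type} [CommRing R] [Algebra ℚ R] (r : Rˣ)
    (x : (BPt a b R)ˣ) : (scalarUnit a b r * x)⁻¹.val = r⁻¹.val • x⁻¹.val := by
  refine Units.inv_eq_of_mul_eq_one_right ?_
  rw [scalarUnit_mul_val, smul_mul_smul_comm, Units.mul_inv, Units.mul_inv, one_smul]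

namespace ToralDatum

variable {a b : ℚ} (D : ToralDatum a b) {O : Subring (BPt a b ℚ)}

/-- The passage from the global ideal back to $s_p$. By density some $e\in E$ is so close to $s_p$
that $e\in s_p\Lambda_p$ and the error $u(s_p-e)$ is integral after conjugation by $g_p$. An integer
$m$ prime to $p$ then clears the denominators of $e$ at the other primes. -/
theorem exists_natCast_mem_twistIdeal (hO : IsZOrder O) (u : (BPt a b ℚ)ˣ) (p : Nat.Primes) :
    ∃ e ∈ D.E, (D.gLoc p)⁻¹.val * (BPt.ofRat a b ℚ_[(p : ℕ)] u.val *
        ((D.sLoc p).val - BPt.ofRat a b ℚ_[(p : ℕ)] e)) * (D.gLoc p).val ∈ localOrder O p ∧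
      ∃ m : ℕ, ‖(m : ℚ_[(p : ℕ)])‖ = 1 ∧ (m : ℚ) • e ∈ D.twistIdeal O := by
  have h1 := tendsto_mul_sub_mul (D.gLoc p)⁻¹.val (BPt.ofRat a b ℚ_[(p : ℕ)] u.val)
    (D.gLoc p).val (D.sLoc p).val
  have h2 := tendsto_mul_sub_mul (D.gLoc p)⁻¹.val (D.sLoc p)⁻¹.val (D.gLoc p).val (D.sLoc p).val
  have hcl := EPt_subset_closure D.E p (mem_torusTilde.1 (D.sLoc_mem p)).1
  obtain ⟨_, ⟨h3, h4⟩, e, he, rfl⟩ := mem_closure_iff_nhds.1 hcl _ (Filter.inter_mem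
    (h1 (hO.localOrder_mem_nhds_zero p)) (h2 (hO.localOrder_mem_nhds_zero p)))
  refine ⟨e, he, h3, ?_⟩
  have h5 : (D.gLoc p)⁻¹.val * ((D.sLoc p)⁻¹.val * BPt.ofRat a b ℚ_[(p : ℕ)] e) *
      (D.gLoc p).val ∈ localOrder O p := by
    have h6 : (D.gLoc p)⁻¹.val * ((D.sLoc p)⁻¹.val *
      ((D.sLoc p).val - BPt.ofRat a b ℚ_[(p : ℕ)] e)) * (D.gLoc p).val ∈ localOrder O p := h4
    rw [mul_sub, Units.inv_mul, mul_sub, sub_mul, mul_one, Units.inv_mul] at h6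
    simpa using sub_mem (one_mem (localOrder O p)) h6
  obtain ⟨N, hN, h7⟩ := hO.exists_nat_smul_locMap_mem
    (D.gRep⁻¹.val * (D.sRep⁻¹.val * BPt.ofRat a b Adele e) * D.gRep.val)
  have h8 : ∀ q : Nat.Primes, locMap a b q
      (D.gRep⁻¹.val * (D.sRep⁻¹.val * BPt.ofRat a b Adele e) * D.gRep.val)
      = (D.gLoc q)⁻¹.val * ((D.sLoc q)⁻¹.val * BPt.ofRat a b ℚ_[(q : ℕ)] e) * (D.gLoc q).val := by
    intro q
    rw [map_mul, map_mul, map_mul]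
    exact congrArg (fun y => (D.gLoc q)⁻¹.val * ((D.sLoc q)⁻¹.val * y) * (D.gLoc q).val)
      (map_ofRat (toPadic q) e)
  -- The $p$-part of the denominator is dropped: nothing has to be cleared at $p$, and $p^k$ is a
  -- unit at every other prime.
  obtain ⟨k, m, hm, rfl⟩ := Nat.exists_eq_pow_mul_and_not_dvd hN.ne' (p : ℕ) p.2.ne_one
  refine ⟨m, Padic.norm_natCast_eq_one_iff.2 ((Nat.Prime.coprime_iff_not_dvd p.2).2 hm),
    D.mem_twistIdeal_iff.2 ⟨D.E.smul_mem he _, fun q => ?_⟩⟩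
  rw [ofRat_smul, mul_smul_comm, mul_smul_comm, smul_mul_assoc, map_natCast]
  by_cases hqp : q = p
  · subst hqp
    exact smul_mem_localOrder (norm_natCast_le_one q m) h5
  · have h9 := h7 q
    rw [h8, Nat.cast_mul, mul_smul] at h9
    have hu : ‖(((p : ℕ) ^ k : ℕ) : ℚ_[(q : ℕ)])‖ = 1 :=
      Padic.norm_natCast_eq_one_iff.2 (((Nat.coprime_primes q.2 p.2).2
        fun h => hqp (Subtype.ext h)).pow_right k)
    have h10 := smul_mem_localOrder (O := O) (c := (((p : ℕ) ^ k : ℕ) : ℚ_[(q : ℕ)])⁻¹)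
      (by rw [norm_inv, hu, inv_one]) h9
    rwa [inv_smul_smul₀ (norm_pos_iff.1 (by rw [hu]; exact one_pos))] at h10

/-- The index $n$ of $I=u\mathfrak s$ lies in $I$, so $nu^{-1}\in\mathfrak s$ bounds the denominator
of the inverse of $x=g^{-1}usg$, while $u\mathfrak s\subseteq\Lambda$ makes $x$ integral. The
factorial is a common multiple of all possible indices. -/
theorem exists_mem_twistOrbit_of_idealNorm_le (hO : IsZOrder O) {I : Ideal (D.globalRing O)}
    (hI : D.InTwistClass O I) {N : ℕ} (hN : D.idealNorm O I ≤ N) :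
    (D.twistOrbit ∩ adelicBox O N.factorial).Nonempty := by
  obtain ⟨e, he, he0, hIe⟩ := hI
  have hfin : Finite (D.globalRing O ⧸ I) :=
    ENat.card_lt_top.1 (hN.trans_lt (ENat.natCast_lt_top N))
  set n := Nat.card (D.globalRing O ⧸ I) with hn
  have hnN : n ≤ N := by
    rw [idealNorm, ENat.card_eq_coe_natCard] at hN
    exact_mod_cast hN
  have hnI : (n : D.globalRing O) ∈ I := by
    have h : n • (Submodule.Quotient.mk (1 : D.globalRing O) : D.globalRing O ⧸ I) = 0 :=
      card_nsmul_eq_zero'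
    rw [← Submodule.Quotient.mk_smul, Submodule.Quotient.mk_eq_zero] at h
    simpa using h
  obtain ⟨u, rfl, hu⟩ := D.exists_unit_of_mem he he0
  obtain ⟨σ, hσ, hσe⟩ : (n : BPt a b ℚ) ∈ (fun x => u.val * x) '' D.twistIdeal O := by
    rw [← hIe]
    exact ⟨_, hnI, rfl⟩
  have hmem : ∀ σ ∈ D.twistIdeal O, ∀ p : Nat.Primes, (D.gLoc p)⁻¹.val *
      (BPt.ofRat a b ℚ_[(p : ℕ)] u.val * BPt.ofRat a b ℚ_[(p : ℕ)] σ) * (D.gLoc p).val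
        ∈ localOrder O p := by
    intro σ hσ p
    obtain ⟨l, -, hl⟩ : u.val * σ ∈ (Subtype.val : D.globalRing O → BPt a b ℚ) ''
        (I : Set (D.globalRing O)) := by
      rw [hIe]
      exact ⟨σ, hσ, rfl⟩
    have := (D.mem_globalRing_iff.1 l.2).2 p
    rwa [hl, map_mul] at this
  have hx : ∀ p, (locUnit a b p (D.twist u)).val ∈ localOrder O p := by
    intro p
    -- The split $us_p=u(s_p-e_0)+ue_0$: the first term is integral by approximation, the second
    -- because $m$ is a unit at $p$ and $m\,ue_0\in u\mathfrak s\subseteq\Lambda$.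
    obtain ⟨e₀, -, h1, m, hm, h2⟩ := D.exists_natCast_mem_twistIdeal hO u p
    have h3 := hmem _ h2 p
    rw [ofRat_smul, mul_smul_comm, mul_smul_comm, smul_mul_assoc, map_natCast] at h3
    have h4 := smul_mem_localOrder (O := O) (c := (m : ℚ_[(p : ℕ)])⁻¹)
      (by rw [norm_inv, hm, inv_one]) h3
    rw [inv_smul_smul₀ (norm_pos_iff.1 (by rw [hm]; exact one_pos))] at h4
    have h5 := add_mem h1 h4
    rw [← add_mul, ← mul_add, ← mul_add, sub_add_cancel, ← mul_assoc] at h5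
    rwa [locUnit_twist]
  have hx' : ∀ p, (n : ℚ_[(p : ℕ)]) • (locUnit a b p (D.twist u))⁻¹.val ∈ localOrder O p := by
    intro p
    have h1 : σ = (n : ℚ) • u⁻¹.val := by
      rw [← Units.inv_mul_cancel_left u σ]
      change u⁻¹.val * (fun x => u.val * x) σ = _
      rw [hσe, ← nsmul_one, mul_smul_comm, mul_one, Nat.cast_smul_eq_nsmul]
    have h2 := (D.mem_twistIdeal_iff.1 hσ).2 p
    rw [h1, ofRat_smul, mul_smul_comm, mul_smul_comm, smul_mul_assoc,
      map_natCast] at h2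
    rwa [locUnit_twist_inv]
  refine ⟨_, D.mem_twistOrbit_iff.2 ⟨u, he, hu, rfl⟩, _, rfl, fun p =>
    ⟨smul_mem_localOrder (norm_natCast_le_one p _) (hx p),
      natCast_smul_mem_localOrder_of_dvd (Nat.dvd_factorial Nat.card_pos hnN) (hx' p)⟩⟩

/-- The integral ideal `{λ ∈ Λ | λ ∈ u 𝔰}`. -/
def twistedIdeal (O : Subring (BPt a b ℚ)) (u : (BPt a b ℚ)ˣ) :
    Ideal (D.globalRing O) where
  carrier := {l | u⁻¹.val * l.val ∈ D.twistIdeal O}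
  zero_mem' := D.mem_twistIdeal_iff.2 (by simp [zero_mem])
  add_mem' := fun {x y} hx hy => by
    obtain ⟨h1, h2⟩ := D.mem_twistIdeal_iff.1 hx
    obtain ⟨h3, h4⟩ := D.mem_twistIdeal_iff.1 hy
    refine D.mem_twistIdeal_iff.2 ?_
    have h : u⁻¹.val * (x + y).val = u⁻¹.val * x.val + u⁻¹.val * y.val := mul_add _ _ _
    rw [h]
    refine ⟨add_mem h1 h3, fun p => ?_⟩
    rw [map_add, mul_add, mul_add, add_mul]
    exact add_mem (h2 p) (h4 p)
  smul_mem' := fun c x hx => by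
    obtain ⟨h1, h2⟩ := D.mem_twistIdeal_iff.1 hx
    obtain ⟨h3, h4⟩ := D.mem_globalRing_iff.1 c.2
    have h : u⁻¹.val * (c • x).val = u⁻¹.val * x.val * c.val := by
      rw [mul_assoc, D.E_mul_comm _ (D.mem_globalRing_iff.1 x.2).1 _ h3]
      rfl
    refine D.mem_twistIdeal_iff.2 ?_
    rw [h]
    refine ⟨mul_mem h1 h3, fun p => ?_⟩
    have h5 := mul_mem (h2 p) (h4 p)
    simp only [mul_assoc, Units.mul_inv_cancel_left] at h5
    simpa only [map_mul, mul_assoc] using h5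

theorem mem_twistedIdeal {u : (BPt a b ℚ)ˣ} {l : D.globalRing O} :
    l ∈ D.twistedIdeal O u ↔ u⁻¹.val * l.val ∈ D.twistIdeal O := Iff.rfl

/-- Integrality of $g^{-1}usg$ at all primes gives $u\mathfrak s\subseteq\Lambda$, so the
intersection of $u\mathfrak s$ with $\Lambda$ is all of $u\mathfrak s$. -/
theorem inTwistClass_twistedIdeal {u : (BPt a b ℚ)ˣ} (hu : u.val ∈ D.E)
    (h : ∀ p, (locUnit a b p (D.twist u)).val ∈ localOrder O p) :
    D.InTwistClass O (D.twistedIdeal O u) := by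
  refine ⟨u.val, hu, u.ne_zero, Set.Subset.antisymm ?_ ?_⟩
  · rintro _ ⟨l, hl, rfl⟩
    exact ⟨_, hl, Units.mul_inv_cancel_left _ _⟩
  · rintro _ ⟨σ, hσ, rfl⟩
    obtain ⟨h1, h2⟩ := D.mem_twistIdeal_iff.1 hσ
    refine ⟨⟨u.val * σ, D.mem_globalRing_iff.2 ⟨mul_mem hu h1, fun p => ?_⟩⟩, ?_, rfl⟩
    · have h3 := mul_mem (h p) (h2 p)
      rw [locUnit_twist] at h3
      simpa only [mul_assoc, Units.mul_inv_cancel_left, map_mul] using h3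
    · rw [SetLike.mem_coe, mem_twistedIdeal, Units.inv_mul_cancel_left]
      exact hσ

theorem idealNorm_twistedIdeal_le {u : (BPt a b ℚ)ˣ} (hu' : u⁻¹.val ∈ D.E) {m : ℕ} (hm : 0 < m)
    (h : ∀ p : Nat.Primes,
      (m : ℚ_[(p : ℕ)]) • (locUnit a b p (D.twist u))⁻¹.val ∈ localOrder O p) :
    D.idealNorm O (D.twistedIdeal O u) ≤ ((m ^ 4 : ℕ) : ℕ∞) := by
  -- The exponent $4$ is the dimension of $\mathbf B(\mathbb Q)$, in which $\Lambda$ is viewed; any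
  -- bound in terms of $m$ suffices.
  rw [← QuaternionAlgebra.finrank_eq_four (algebraMap ℚ ℚ a) 0 (algebraMap ℚ ℚ b)]
  refine card_quotient_le_pow (H := (D.globalRing O).toAddSubgroup)
    (I := (D.twistedIdeal O u).toAddSubgroup) hm ?_
  have h1 : (m : D.globalRing O) ∈ D.twistedIdeal O u := by
    rw [mem_twistedIdeal, mem_twistIdeal_iff]
    have h2 : u⁻¹.val * ((m : D.globalRing O) : BPt a b ℚ) = (m : ℚ) • u⁻¹.val := by
      rw [Subring.coe_natCast, ← nsmul_one, mul_smul_comm, mul_one, Nat.cast_smul_eq_nsmul]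
    rw [h2]
    refine ⟨D.E.smul_mem hu' _, fun p => ?_⟩
    have h3 := h p
    rw [locUnit_twist_inv] at h3
    rwa [ofRat_smul, mul_smul_comm, mul_smul_comm, smul_mul_assoc, map_natCast]
  have h2 : ∀ x : D.globalRing O, m • x ∈ D.twistedIdeal O u := fun x => by
    rw [nsmul_eq_mul, Nat.cast_comm]
    exact (D.twistedIdeal O u).mul_mem_left x h1
  exact h2

theorem exists_idealNorm_le {N : ℕ} (hN : 0 < N)
    (h : (D.twistOrbit ∩ adelicBox O N).Nonempty) :
    ∃ I, D.InTwistClass O I ∧ D.idealNorm O I ≤ (((N ^ 2) ^ 4 : ℕ) : ℕ∞) := by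
  obtain ⟨η, h1, y, rfl, hy⟩ := h
  obtain ⟨u, hu, hu', hyu⟩ := D.mem_twistOrbit_iff.1 h1
  obtain ⟨z, rfl⟩ := (mk_eq_mk_iff (D.twist u) y).1 hyu.symm
  have hz0 : ∀ p, toPadic p z.val ≠ 0 := fun p =>
    (Units.map (toPadic p : Adele →* ℚ_[(p : ℕ)]) z).ne_zero
  obtain ⟨q, hq, hqz⟩ := exists_rat_norm_eq (fun p => toPadic p z.val) hz0
    (eventually_norm_eq_one z)
  have hNq : (N : ℚ) * q ≠ 0 := mul_ne_zero (by exact_mod_cast hN.ne') hq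
  -- The adelic scalar $z$ is replaced by a rational $q$ of the same absolute values. The extra
  -- factor $N$ makes the twist by $v$ integral, at the price of the denominator $N^2$ for its
  -- inverse.
  set v : (BPt a b ℚ)ˣ := scalarUnit a b (Units.mk0 _ hNq) * u with hv
  have hvv : v.val = ((N : ℚ) * q) • u.val := scalarUnit_mul_val _ _
  have hvi : v⁻¹.val = ((N : ℚ) * q)⁻¹ • u⁻¹.val := by
    refine Units.inv_eq_of_mul_eq_one_right ?_
    rw [hvv, smul_mul_smul_comm, mul_inv_cancel₀ hNq, one_smul, Units.mul_inv]
  have hvE : v.val ∈ D.E := by rw [hvv]; exact D.E.smul_mem hu _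
  have hvE' : v⁻¹.val ∈ D.E := by rw [hvi]; exact D.E.smul_mem hu' _
  have hzv : ∀ p : Nat.Primes, (Units.map (toPadic p : Adele →* ℚ_[(p : ℕ)]) z).val = toPadic p z.val :=
    fun _ => rfl
  have hloc : ∀ p, locUnit a b p (scalarUnit a b z * D.twist u)
      = scalarUnit a b (Units.map (toPadic p : Adele →* ℚ_[(p : ℕ)]) z)
        * locUnit a b p (D.twist u) := fun p => by
    rw [map_mul]
    congr 1
  have hx : ∀ p, (locUnit a b p (D.twist v)).val ∈ localOrder O p := fun p => by
    have h2 := (hy p).1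
    rw [hloc, scalarUnit_mul_val] at h2
    have h3 := smul_mem_localOrder (c := (q : ℚ_[(p : ℕ)]) / toPadic p z.val)
      (by rw [norm_div, hqz, div_self (norm_ne_zero_iff.2 (hz0 p))]) h2
    rw [locUnit_twist, hvv, ofRat_smul, mul_smul_comm, smul_mul_assoc, smul_mul_assoc,
      ← locUnit_twist]
    convert h3 using 1
    rw [smul_smul, smul_smul]
    congr 1
    rw [map_mul, map_natCast, eq_ratCast, hzv]
    have := hz0 p
    field_simp
  have hx' : ∀ p : Nat.Primes, ((N ^ 2 : ℕ) : ℚ_[(p : ℕ)]) •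
      (locUnit a b p (D.twist v))⁻¹.val ∈ localOrder O p := fun p => by
    have h2 := (hy p).2
    rw [hloc, scalarUnit_mul_inv_val, Units.val_inv_eq_inv_val, hzv] at h2
    have h3 := smul_mem_localOrder (c := toPadic p z.val / (q : ℚ_[(p : ℕ)]))
      (by rw [norm_div, hqz, div_self (norm_ne_zero_iff.2 (hz0 p))]) h2
    rw [locUnit_twist_inv, hvi, ofRat_smul, mul_smul_comm, mul_smul_comm, smul_mul_assoc,
      ← locUnit_twist_inv]
    convert h3 using 1
    rw [smul_smul, smul_smul, smul_smul]
    congr 1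
    rw [map_inv₀, map_mul, map_natCast, eq_ratCast]
    have hz := hz0 p
    have hN' : (N : ℚ_[(p : ℕ)]) ≠ 0 := norm_pos_iff.1 (norm_natCast_pos p hN)
    have hq' : (q : ℚ_[(p : ℕ)]) ≠ 0 := by exact_mod_cast hq
    push_cast
    field_simp
  exact ⟨_, D.inTwistClass_twistedIdeal hvE hx, D.idealNorm_twistedIdeal_le hvE'
    (by positivity) hx'⟩

theorem tendsto_idealNorm_iff (hO : IsZOrder O) (D : ℕ → ToralDatum a b) :
    Filter.Tendsto (fun i => ⨅ (I : Ideal ((D i).globalRing O)) (_ : (D i).InTwistClass O I),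
        (D i).idealNorm O I) Filter.atTop (𝓝 ⊤) ↔
      ∀ M : ℕ, 0 < M → ∀ᶠ i in Filter.atTop, (D i).twistOrbit ∩ adelicBox O M = ∅ := by
  rw [ENat.tendsto_nhds_top_iff_natCast_lt]
  constructor
  · intro h M hM
    filter_upwards [h ((M ^ 2) ^ 4)] with i hi
    by_contra hne
    obtain ⟨I, hI, hle⟩ := (D i).exists_idealNorm_le hM (Set.nonempty_iff_ne_empty.2 hne)
    exact absurd (hi.trans_le (iInf₂_le I hI)) hle.not_gt
  · intro h n
    filter_upwards [h n.factorial n.factorial_pos] with i hi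
    refine lt_of_lt_of_le (b := ((n + 1 : ℕ) : ℕ∞)) (by exact_mod_cast n.lt_succ_self)
      (le_iInf₂ fun I hI => ?_)
    by_contra! hlt
    have hle : (D i).idealNorm O I ≤ n := by
      rw [Nat.cast_add, Nat.cast_one] at hlt
      exact Order.le_of_lt_add_one hlt
    exact ((D i).exists_mem_twistOrbit_of_idealNorm_le hO hI hle).ne_empty hi

end ToralDatum

end JointToral

end

/-! ### The equivalence of the three conditions -/

theorem proposition6p5 (a b : ℚ) (ha : a ≠ 0) (hb : b ≠ 0)
    (O : Subring (JointToral.BPt a b ℚ)) (hO : Maximal JointToral.IsZOrder O)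
    (K : Subgroup (JointToral.GPt a b ℝ)) (hK : JointToral.IsMaxCompactTorus K)
    [MeasurableSpace (JointToral.GPt a b JointToral.Adele)]
    [BorelSpace (JointToral.GPt a b JointToral.Adele)]
    (μ : MeasureTheory.Measure (JointToral.GPt a b JointToral.Adele)) [μ.IsHaarMeasure]
    (Ω : Set (JointToral.GPt a b JointToral.Adele)) (hΩ : IsCompact Ω) (hΩ1 : Ω ∈ 𝓝 1)
    (D : ℕ → JointToral.ToralDatum a b) (hD : ∀ i, (D i).HasRealTorus K) :
    List.TFAE [
      Filter.Tendsto
        (fun i => ⨅ (ξ : JointToral.GPt a b JointToral.Adele × JointToral.GPt a b JointToral.Adele)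
          (_ : (D i).jointSet ⊆ JointToral.heckeSet ξ), JointToral.heckeVol μ Ω ξ)
        Filter.atTop (𝓝 ⊤),
      Filter.Tendsto
        (fun i => ⨅ (I : Ideal ((D i).globalRing O)) (_ : (D i).InTwistClass O I),
          (D i).idealNorm O I)
        Filter.atTop (𝓝 ⊤),
      ∀ B : Set (JointToral.GPt a b JointToral.Adele), IsCompact B →
        ∃ N : ℕ, ∀ i > N, (D i).twistOrbit ∩ B = ∅] := by
  -- Local compactness of $\mathbf G(\mathbb A)$ comes from the compact identity neighbourhood `Ω`.
  have : LocallyCompactSpace (JointToral.GPt a b JointToral.Adele) :=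
    hΩ.locallyCompactSpace_of_mem_nhds_of_group hΩ1
  tfae_have 1 ↔ 3 :=
    (JointToral.ToralDatum.tendsto_heckeVol_iff ha hb μ hΩ D).trans
      (JointToral.ToralDatum.overlap_lt_iff hO.prop ha hb μ hΩ hΩ1 hK hD)
  tfae_have 2 ↔ 3 :=
    (JointToral.ToralDatum.tendsto_idealNorm_iff hO.prop D).trans
      (hO.prop.forall_isCompact_iff hK hD).symm
  tfae_finish
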